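/- Setting. For sample sizes $n_1,m_1,n_2,m_2$ (all even, $n:=n_1\wedge n_2$) one observes mutually independent data: labeled pairs $(X_i,V_i)_{i\le n_1}$ i.i.d. $\sim P_{XV}$, unlabeled covariates $(V_i)_{n_1<i\le n_1+m_1}$ i.i.d. $\sim P_V$ (the $V$-marginal), labeled pairs $(Y_i,W_i)_{i\le n_2}$ i.i.d. $\sim P_{YW}$, and unlabeled covariates $(W_i)_{n_2<i\le n_2+m_2}$ i.i.d. $\sim P_W$. Let $f$ be a real-valued, possibly random, measurable function, independent of all these data. The laws and $f$ may change with the sample sizes. All expectations, variances and conditional expectations of $f(X)$ and $f(Y)$ below are conditional on $f$. Put $$\sigma_{1,X,f}^2=\mathbb E[\mathrm{Var}\{f(X)\mid V\}],\quad \sigma_{2,X,f}^2=\mathrm{Var}[\mathbb E\{f(X)\mid V\}],\quad \sigma_{X,f}^2=\frac{\sigma_{1,X,f}^2}{n_1}+\frac{\sigma_{2,X,f}^2}{n_1+m_1}.$$ Given numbers $e_1,\dots,e_{n_1+m_1}$ in the role of $\mathbb E[f(X_i)\mid V_i]$, put $\bar e=\frac1{n_1+m_1}\sum_{i\le n_1+m_1}e_i$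 and $$\widehat\mu_X=\frac1{n_1}\sum_{i\le n_1}\{f(X_i)-e_i\}+\bar e,\qquad \widehat\sigma_X^2=\frac1{n_1}\cdot\frac1{n_1}\sum_{i\le n_1}\{f(X_i)-e_i\}^2+\frac1{n_1+m_1}\cdot\frac1{n_1+m_1}\sum_{i\le n_1+m_1}(e_i-\bar e)^2 .$$ Define the same objects for $(Y,W)$ with $n_2,m_2$, and $T=(\widehat\mu_X-\widehat\mu_Y)/\sqrt{\widehat\sigma_X^2+\widehat\sigma_Y^2}$. The oracle statistic $T_{\mathrm{oracle}}$ uses $e_i=\mathbb E[f(X_i)\mid V_i]$ (and $\mathbb E[f(Y_i)\mid W_i]$ in the second group). The cross-fit statistic $T_{\mathrm{cross}}$ uses $e_i=\widehat{\mathbb E}[f(X_i)\mid V_i]$, the value at $V_i$ of an estimator (possibly using $f$ and independent algorithmic randomness) of the function $v\mapsto\mathbb E[f(X)\mid V=v]$ trained on the labeled pairs with odd index if $i$ is even, and on those with even index if $i$ is odd; analogously for $(Y,W)$. For fixed $\alpha\in(0,1)$, each test rejects when its statistic exceeds $z_{1-\alpha}$, where $\Phi$ is the $N(0,1)$ distribution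 function and $z_p=\Phi^{-1}(p)$. Statement. Suppose that for some $\delta>0$ $$\frac{\mathbb E[|f(X)-\mathbb E f(X)|^{2+\delta}]}{\sigma_{1,X,f}^{2+\delta}\wedge\sigma_{2,X,f}^{2+\delta}}=o_P(n_1^{\delta/2}),\qquad \frac{\mathbb E[|f(Y)-\mathbb E f(Y)|^{2+\delta}]}{\sigma_{1,Y,f}^{2+\delta}\wedge\sigma_{2,Y,f}^{2+\delta}}=o_P(n_2^{\delta/2}),$$ and that $$\frac{\mathbb E[\{\widehat{\mathbb E}[f(X)\mid V]-\mathbb E[f(X)\mid V]\}^2]}{\sigma_{1,X,f}^2\wedge\sigma_{2,X,f}^2}=o_P(1),\qquad \frac{\mathbb E[\{\widehat{\mathbb E}[f(Y)\mid W]-\mathbb E[f(Y)\mid W]\}^2]}{\sigma_{1,Y,f}^2\wedge\sigma_{2,Y,f}^2}=o_P(1),$$ all as $n\to\infty$. Here $o_P$ refers to the randomness of $f$, a ratio with denominator $0$ counts as $+\infty$, and the last two expectations, conditional on $f$, are over the training sample (half of the labeled pairs), the algorithmic randomness, and an independent pair $(X,V)$, respectively $(Y,W)$. Then, as $n\to\infty$,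 with no restriction on $m_1,m_2$, $$\mathbb P(T_{\mathrm{cross}}>z_{1-\alpha})-\mathbb E\biggl[\Phi\biggl(z_\alpha+\frac{\mathbb E[f(X)]-\mathbb E[f(Y)]}{\sqrt{\sigma_{X,f}^2+\sigma_{Y,f}^2}}\biggr)\biggr]\to0,$$ where the outer expectation is over $f$ (so it can be dropped if $f$ is nonrandom), and $\mathbb P(T_{\mathrm{cross}}>z_{1-\alpha})-\mathbb P(T_{\mathrm{oracle}}>z_{1-\alpha})\to0$. -/

import Mathlib

open MeasureTheory ProbabilityTheory Filter Topology
open scoped ENNReal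

noncomputable section

namespace SemiSupTest

/-! ### Standard normal distribution -/

/-- The distribution function `Φ` of `N(0,1)`. -/
def stdNormalCDF (x : ℝ) : ℝ := cdf (gaussianReal 0 1) x

/-- The `p`-quantile `z_p` of `N(0,1)`, for `0 < p < 1`. -/
def stdNormalQuantile (p : ℝ) : ℝ := sInf {x : ℝ | p ≤ stdNormalCDF x}

/-! ### Stochastic order -/

/-- `a / b` for a nonnegative denominator; a ratio with vanishing denominator counts as infinite,
so that it is never small. -/
def ratio (a : ℝ≥0∞) (b : ℝ) : ℝ≥0∞ := if 0 < b then a / ENNReal.ofReal b else ⊤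

/-- `A k = o_P(r k)` for nonnegative random quantities `A k` on the probability spaces
`(Θ k, τ k)`: for every `ε > 0`, the probability of `A k > ε * r k` tends to `0`. -/
def IsLittleOP {Θ : ℕ → Type*} [∀ k, MeasurableSpace (Θ k)] (τ : ∀ k, Measure (Θ k))
    (A : ∀ k, Θ k → ℝ≥0∞) (r : ℕ → ℝ) : Prop :=
  ∀ ε : ℝ, 0 < ε →
    Tendsto (fun k => τ k {θ | ENNReal.ofReal (ε * r k) < A k θ}) atTop (𝓝 0)

/-! ### Population quantities of one group

`P` is the joint law of a labelled pair `(X, V)` and `f` a fixed real function of `X`. -/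

section Population

variable {𝒳 𝒱 : Type*} [MeasurableSpace 𝒳] [MeasurableSpace 𝒱]

/-- The σ-algebra generated by the covariate `V` on the space of pairs `(X, V)`. -/
abbrev covariateSigma (𝒳 𝒱 : Type*) [MeasurableSpace 𝒱] : MeasurableSpace (𝒳 × 𝒱) :=
  MeasurableSpace.comap Prod.snd inferInstance

/-- `E[f(X) | V]`, as a random variable on the space of pairs `(X, V)`. -/
def condMean (P : Measure (𝒳 × 𝒱)) (f : 𝒳 → ℝ) : 𝒳 × 𝒱 → ℝ :=
  P[fun p => f p.1 | covariateSigma 𝒳 𝒱]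

/-- `E[f(X)]`. -/
def popMean (P : Measure (𝒳 × 𝒱)) (f : 𝒳 → ℝ) : ℝ := ∫ p, f p.1 ∂P

/-- `σ₁² = E[Var(f(X) | V)]`. -/
def sigmaSq₁ (P : Measure (𝒳 × 𝒱)) (f : 𝒳 → ℝ) : ℝ :=
  ∫ p, (condVar (covariateSigma 𝒳 𝒱) (fun p => f p.1) P) p ∂P

/-- `σ₂² = Var(E[f(X) | V])`. -/
def sigmaSq₂ (P : Measure (𝒳 × 𝒱)) (f : 𝒳 → ℝ) : ℝ := variance (condMean P f) P

/-- `σ² = σ₁² / n + σ₂² / (n + m)`. -/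
def sigmaSq (P : Measure (𝒳 × 𝒱)) (f : 𝒳 → ℝ) (n m : ℕ) : ℝ :=
  sigmaSq₁ P f / n + sigmaSq₂ P f / ((n : ℝ) + m)

/-- `E[|f(X) - E f(X)| ^ q]`, possibly infinite. -/
def absCentralMoment (P : Measure (𝒳 × 𝒱)) (f : 𝒳 → ℝ) (q : ℝ) : ℝ≥0∞ :=
  ∫⁻ p, ENNReal.ofReal (|f p.1 - popMean P f| ^ q) ∂P

/-- `E[|f(X) - E f(X)| ^ (2 + δ)] / (σ₁ ^ (2 + δ) ∧ σ₂ ^ (2 + δ))`. -/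
def momentRatio (P : Measure (𝒳 × 𝒱)) (δ : ℝ) (f : 𝒳 → ℝ) : ℝ≥0∞ :=
  ratio (absCentralMoment P f (2 + δ))
    (min (√(sigmaSq₁ P f) ^ (2 + δ)) (√(sigmaSq₂ P f) ^ (2 + δ)))

/-- The `L²` risk `E[{Ê[f(X) | V] - E[f(X) | V]}²]` of an estimator `v ↦ ghat s L v` built from a
training sample `L` of `t` i.i.d. labelled pairs and an algorithmic seed `s ∼ ρ`. The expectation
is over the seed, the training sample and an independent pair `(X, V) ∼ P`. -/
def l2Risk {S : Type*} [MeasurableSpace S] {t : ℕ} (P : Measure (𝒳 × 𝒱)) (ρ : Measure S)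
    (f : 𝒳 → ℝ) (ghat : S → (Fin t → 𝒳 × 𝒱) → 𝒱 → ℝ) : ℝ≥0∞ :=
  ∫⁻ q : S × (Fin t → 𝒳 × 𝒱) × (𝒳 × 𝒱),
    ENNReal.ofReal ((ghat q.1 q.2.1 q.2.2.2 - condMean P f q.2.2) ^ 2)
      ∂(ρ.prod ((Measure.pi fun _ => P).prod P))

/-- The `L²` risk divided by `σ₁² ∧ σ₂²`. -/
def riskRatio {S : Type*} [MeasurableSpace S] {t : ℕ} (P : Measure (𝒳 × 𝒱)) (ρ : Measure S)
    (f : 𝒳 → ℝ) (ghat : S → (Fin t → 𝒳 × 𝒱) → 𝒱 → ℝ) : ℝ≥0∞ :=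
  ratio (l2Risk P ρ f ghat) (min (sigmaSq₁ P f) (sigmaSq₂ P f))

/-- `g θ v` is a version of `E[f_θ(X) | V = v]`, jointly measurable in `(θ, v)`. -/
structure IsRegression {Θ : Type*} [MeasurableSpace Θ] (τ : Measure Θ) (P : Measure (𝒳 × 𝒱))
    (F : Θ → 𝒳 → ℝ) (g : Θ → 𝒱 → ℝ) : Prop where
  measurable : Measurable fun q : Θ × 𝒱 => g q.1 q.2
  ae_eq : ∀ᵐ θ ∂τ, (fun p : 𝒳 × 𝒱 => g θ p.2) =ᵐ[P] condMean P (F θ)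

end Population

/-! ### Empirical quantities of one group

`y i` is the value `f(X_i)`, `h i` the (true or estimated) conditional mean at `V_i` for a labelled
index `i`, and `u j` the (true or estimated) conditional mean at the `j`-th unlabelled covariate. -/

section Empirical

variable {n m : ℕ} (y h : Fin n → ℝ) (u : Fin m → ℝ)

/-- `n⁻¹ ∑ (y i - h i) + (n + m)⁻¹ (∑ h i + ∑ u j)`. -/
def muHat : ℝ :=
  (∑ i, (y i - h i)) / n + (∑ i, h i + ∑ j, u j) / ((n : ℝ) + m)

/-- `n⁻¹ ∑ (y i - h i)²`. -/
def sigmaSqHat₁ : ℝ := (∑ i, (y i - h i) ^ 2) / n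

/-- The mean of the conditional means over all labelled and unlabelled covariates. -/
def pooledMean : ℝ := (∑ i, h i + ∑ j, u j) / ((n : ℝ) + m)

/-- The empirical variance of the conditional means over all labelled and unlabelled covariates. -/
def sigmaSqHat₂ : ℝ :=
  (∑ i, (h i - pooledMean h u) ^ 2 + ∑ j, (u j - pooledMean h u) ^ 2) / ((n : ℝ) + m)

/-- The variance estimate of `muHat`. -/
def sigmaSqHat : ℝ := sigmaSqHat₁ y h / n + sigmaSqHat₂ h u / ((n : ℝ) + m)

end Empirical

/-! ### The data -/

/-- The data of one group: `n` labelled pairs, `m` unlabelled covariates, and the two seeds used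
when an estimator is trained on the first and on the second fold of the labelled pairs. -/
abbrev GroupSample (𝒳 𝒱 S : Type*) (n m : ℕ) : Type _ :=
  (Fin n → 𝒳 × 𝒱) × (Fin m → 𝒱) × (S × S)

/-- The law of the data of one group: all components are independent, the labelled pairs have
law `P`, the unlabelled covariates have the `V`-marginal of `P`, and the seeds have law `ρ`. -/
def groupLaw {𝒳 𝒱 S : Type*} [MeasurableSpace 𝒳] [MeasurableSpace 𝒱] [MeasurableSpace S]
    (P : Measure (𝒳 × 𝒱)) (ρ : Measure S) (n m : ℕ) : Measure (GroupSample 𝒳 𝒱 S n m) :=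
  (Measure.pi fun _ => P).prod ((Measure.pi fun _ => P.snd).prod (ρ.prod ρ))

/-- The joint law of the random parameter `θ` of `f` and of the data of the two groups: the three
are independent. -/
def jointLaw {𝒳 𝒱 Θ S S' : Type*} [MeasurableSpace 𝒳] [MeasurableSpace 𝒱] [MeasurableSpace Θ]
    [MeasurableSpace S] [MeasurableSpace S'] (τ : Measure Θ) (P Q : Measure (𝒳 × 𝒱))
    (ρ : Measure S) (ρ' : Measure S') (n₁ m₁ n₂ m₂ : ℕ) :
    Measure (Θ × GroupSample 𝒳 𝒱 S n₁ m₁ × GroupSample 𝒳 𝒱 S' n₂ m₂) :=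
  τ.prod ((groupLaw P ρ n₁ m₁).prod (groupLaw Q ρ' n₂ m₂))

section Fitted

variable {𝒳 𝒱 S : Type*} {n m : ℕ}

/-- The labelled pairs with odd index, indices running from `1` to `n`. -/
def oddFold (L : Fin n → 𝒳 × 𝒱) : Fin (n / 2) → 𝒳 × 𝒱 := fun j => L ⟨2 * j, by omega⟩

/-- The labelled pairs with even index, indices running from `1` to `n`. -/
def evenFold (L : Fin n → 𝒳 × 𝒱) : Fin (n / 2) → 𝒳 × 𝒱 := fun j => L ⟨2 * j + 1, by omega⟩

/-- The cross-fitted conditional mean at the covariate `v` carrying the index `i ∈ {1, …, n + m}`: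
it is trained on the odd fold if `i` is even, and on the even fold if `i` is odd. -/
def crossFit (ghat : S → (Fin (n / 2) → 𝒳 × 𝒱) → 𝒱 → ℝ) (d : GroupSample 𝒳 𝒱 S n m)
    (i : ℕ) (v : 𝒱) : ℝ :=
  if Even i then ghat d.2.2.1 (oddFold d.1) v else ghat d.2.2.2 (evenFold d.1) v

/-- The mean and variance estimates `(μ̂, σ̂²)` of one group, when `fit i v` is used as the
conditional mean of `f(X)` at the covariate `v` with index `i ∈ {1, …, n + m}`. -/
def groupEstimates (f : 𝒳 → ℝ) (fit : ℕ → 𝒱 → ℝ) (d : GroupSample 𝒳 𝒱 S n m) : ℝ × ℝ :=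
  let y : Fin n → ℝ := fun i => f (d.1 i).1
  let h : Fin n → ℝ := fun i => fit (i + 1) (d.1 i).2
  let u : Fin m → ℝ := fun j => fit (n + j + 1) (d.2.1 j)
  (muHat y h u, sigmaSqHat y h u)

/-- The studentized difference of two groups, from their estimates `(μ̂, σ̂²)`. -/
def studentized (a b : ℝ × ℝ) : ℝ := (a.1 - b.1) / √(a.2 + b.2)

end Fitted

/-! ### The two tests and the asymptotic power expression -/

section Tests

variable {𝒳 𝒱 Θ S S' : Type*} {n₁ m₁ n₂ m₂ : ℕ}

/-- The oracle statistic, with `gX θ`, `gY θ` the true conditional mean functions of `f_θ`. -/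
def oracleStat (F : Θ → 𝒳 → ℝ) (gX gY : Θ → 𝒱 → ℝ)
    (d : Θ × GroupSample 𝒳 𝒱 S n₁ m₁ × GroupSample 𝒳 𝒱 S' n₂ m₂) : ℝ :=
  studentized (groupEstimates (F d.1) (fun _ => gX d.1) d.2.1)
    (groupEstimates (F d.1) (fun _ => gY d.1) d.2.2)

/-- The cross-fit statistic, with `ghatX θ`, `ghatY θ` the estimators of the conditional mean
functions of `f_θ`. -/
def crossStat (F : Θ → 𝒳 → ℝ)
    (ghatX : Θ → S → (Fin (n₁ / 2) → 𝒳 × 𝒱) → 𝒱 → ℝ)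
    (ghatY : Θ → S' → (Fin (n₂ / 2) → 𝒳 × 𝒱) → 𝒱 → ℝ)
    (d : Θ × GroupSample 𝒳 𝒱 S n₁ m₁ × GroupSample 𝒳 𝒱 S' n₂ m₂) : ℝ :=
  studentized (groupEstimates (F d.1) (crossFit (ghatX d.1) d.2.1) d.2.1)
    (groupEstimates (F d.1) (crossFit (ghatY d.1) d.2.2) d.2.2)

/-- The power at level `α` of the test that rejects when the statistic `T` exceeds `z_{1-α}`,
under the law `μ` of the data. -/
def power {D : Type*} [MeasurableSpace D] (μ : Measure D) (T : D → ℝ) (α : ℝ) : ℝ :=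
  μ.real {d | stdNormalQuantile (1 - α) < T d}

/-- `Φ (z_α + (E f(X) - E f(Y)) / √(σ_X² + σ_Y²))`. -/
def powerExpression [MeasurableSpace 𝒳] [MeasurableSpace 𝒱] (α : ℝ) (P Q : Measure (𝒳 × 𝒱))
    (f : 𝒳 → ℝ) (n₁ m₁ n₂ m₂ : ℕ) : ℝ :=
  stdNormalCDF (stdNormalQuantile α +
    (popMean P f - popMean Q f) / √(sigmaSq P f n₁ m₁ + sigmaSq Q f n₂ m₂))

end Tests

end SemiSupTest

end

/-!
For a fixed function `f` put `ε = f(X) - E[f(X) | V]` and `γ = E[f(X) | V] - E f(X)`. The oracle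
estimate of `E f(X)` has as its error the average of `ε` over the labelled pairs plus the average
of `γ` over all covariates; grouping the terms by observation makes it a sum of independent
centred variables, and since `ε` and `γ` are uncorrelated its variance is `σ² = σ₁² / n + σ₂² / (n
+ m)`. The moment condition, split over `ε` and `γ` by convexity and the contraction property of
conditional expectation (`decomposition_of_momentRatio`), is Lyapunov's condition relative to each
of the variances, so the characteristic function of the standardized oracle estimate converges to
the normal one for every size of `m` (`norm_integral_cexp_oracleMean_sub_le`). By the same moment
bound, a truncated weak law of large numbers shows that the oracle variance estimates are ratio
consistent (`AsymptoticGroup.vanishes_oracleSq₁`, `AsymptoticGroup.vanishes_oracleSq₂`).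

Cross-fitting changes the estimate by a contrast, in each fold, between the fitting errors at the
labelled covariates and those at all covariates. Given the training data, this is a centred sum
whose variance is at most a multiple of `risk / n`, hence of smaller order than `σ²`
(`lintegral_foldMean_inner_le`, `AsymptoticGroup.vanishes_crossMean_sub`). It relies on the parity
of `n` and `m`: each fold then holds exactly half of the labelled and half of the unlabelled
covariates, and the means of the fitting errors cancel. The variance estimates change by a
relative amount controlled by the relative risk (`AsymptoticGroup.vanishes_crossVar`).

The studentized statistic is therefore `(N + e + s) / √R` with `N` asymptotically standard normal,
`e → 0` and `R → 1` in probability, and an arbitrary deterministic shift `s`. Since convergence to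
`Φ` is uniform (Pólya's theorem, `eventually_forall_abs_sub_stdNormalCDF_le`), its rejection
probability is `Φ(s - z) + o(1)` whatever the shift (`tendsto_measureReal_sub_stdNormalCDF`).

The passage to random `f` is by uniformity: as sample spaces, laws, functions and estimators may
all vary along the sequence, the result for fixed functions implies, by contradiction, that the
power approximation holds uniformly over all functions whose moment ratio and relative risk are
below a small threshold (`exists_forall_abs_powerGap_lt`). The `o_P` conditions make the remaining
functions negligible, and Fubini's theorem averages over `f`. The oracle test is the cross-fit
test whose estimators return the true regression function, which has zero risk, so that the second
claim is the difference of two instances of the first.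
-/


noncomputable section

namespace SemiSupTest

/-! ### A Lyapunov-type bound for characteristic functions -/

theorem norm_mul_sub_mul_le {a b c d : ℂ} (ha : ‖a‖ ≤ 1) (hd : ‖d‖ ≤ 1) :
    ‖a * b - c * d‖ ≤ ‖a - c‖ + ‖b - d‖ := by
  have h : a * b - c * d = (a - c) * d + a * (b - d) := by ring
  rw [h]
  refine (norm_add_le _ _).trans ?_
  rw [norm_mul, norm_mul]
  have h1 := norm_nonneg (a - c)
  have h2 := norm_nonneg (b - d)
  nlinarith

theorem norm_pow_sub_pow_le_mul {a b : ℂ} (ha : ‖a‖ ≤ 1) (hb : ‖b‖ ≤ 1) (n : ℕ) :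
    ‖a ^ n - b ^ n‖ ≤ n * ‖a - b‖ := by
  induction n with
  | zero => simp
  | succ n ih =>
    rw [pow_succ, pow_succ]
    have h : ‖a ^ n‖ ≤ 1 := by rw [norm_pow]; exact pow_le_one₀ (norm_nonneg _) ha
    refine (norm_mul_sub_mul_le h hb).trans ?_
    push_cast
    linarith

theorem norm_cexp_taylor_two_le_cube (u : ℝ) :
    ‖Complex.exp (Complex.I * u) - (1 + Complex.I * u - (u : ℂ) ^ 2 / 2)‖ ≤ 3 * |u| ^ 3 := by
  have hnorm : ‖Complex.I * (u : ℂ)‖ = |u| := by simp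
  rcases le_total |u| 1 with hu | hu
  · have h := Complex.exp_bound (x := Complex.I * u) (by rw [hnorm]; exact hu)
      (n := 3) (by norm_num)
    have hs : (∑ m ∈ Finset.range 3, (Complex.I * (u : ℂ)) ^ m / (m.factorial : ℂ))
        = 1 + Complex.I * u - (u : ℂ) ^ 2 / 2 := by
      simp [Finset.sum_range_succ, mul_pow, Complex.I_sq]
      ring
    rw [hs, hnorm] at h
    refine h.trans ?_
    have h3 : (0 : ℝ) ≤ |u| ^ 3 := by positivity
    norm_num [Nat.factorial]
    nlinarith
  · have h1 : ‖Complex.exp (Complex.I * u) - 1‖ ≤ |u| := by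
      simpa using Real.norm_exp_I_mul_ofReal_sub_one_le (x := u)
    have h2 : Complex.exp (Complex.I * u) - (1 + Complex.I * u - (u : ℂ) ^ 2 / 2)
        = (Complex.exp (Complex.I * u) - 1) - Complex.I * u + (u : ℂ) ^ 2 / 2 := by ring
    rw [h2]
    refine (norm_add_le _ _).trans ((add_le_add_left (norm_sub_le _ _) _).trans ?_)
    rw [hnorm]
    have h4 : ‖(u : ℂ) ^ 2 / 2‖ = |u| ^ 2 / 2 := by simp
    rw [h4]
    have h5 : |u| ≤ |u| ^ 3 := by nlinarith [sq_nonneg |u|, mul_self_nonneg (|u| - 1)]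
    have h6 : |u| ^ 2 ≤ |u| ^ 3 := by nlinarith [sq_nonneg |u|]
    linarith

theorem norm_cexp_taylor_two_le_sq (u : ℝ) :
    ‖Complex.exp (Complex.I * u) - (1 + Complex.I * u - (u : ℂ) ^ 2 / 2)‖ ≤ 3 * u ^ 2 := by
  rw [← sq_abs u]
  rcases le_total |u| 1 with hu | hu
  · refine (norm_cexp_taylor_two_le_cube u).trans ?_
    have := abs_nonneg u
    nlinarith [sq_nonneg |u|]
  · have hnorm : ‖Complex.I * (u : ℂ)‖ = |u| := by simp
    have h1 : ‖Complex.exp (Complex.I * u) - 1‖ ≤ |u| := by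
      simpa using Real.norm_exp_I_mul_ofReal_sub_one_le (x := u)
    have h2 : Complex.exp (Complex.I * u) - (1 + Complex.I * u - (u : ℂ) ^ 2 / 2)
        = (Complex.exp (Complex.I * u) - 1) - Complex.I * u + (u : ℂ) ^ 2 / 2 := by ring
    rw [h2]
    refine (norm_add_le _ _).trans ((add_le_add_left (norm_sub_le _ _) _).trans ?_)
    rw [hnorm]
    have h4 : ‖(u : ℂ) ^ 2 / 2‖ = |u| ^ 2 / 2 := by simp
    rw [h4]
    nlinarith

theorem abs_exp_neg_half_sub_le {v : ℝ} (hv : 0 ≤ v) :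
    |Real.exp (-v / 2) - (1 - v / 2)| ≤ v ^ 2 := by
  have h0 := Real.add_one_le_exp (-v / 2)
  rw [abs_of_nonneg (by linarith)]
  rcases le_total v 2 with h | h
  · have := Real.abs_exp_sub_one_sub_id_le (x := -v / 2) (by rw [abs_le]; constructor <;> linarith)
    rw [abs_le] at this
    nlinarith [this.2]
  · have : Real.exp (-v / 2) ≤ 1 := Real.exp_le_one_iff.2 (by linarith)
    nlinarith

/-- Truncation: above level `η`, a square is controlled by a higher power. -/
theorem sq_le_rpow_of_lt_abs {δ η x : ℝ} (hδ : 0 < δ) (hη : 0 < η) (hx : η < |x|) :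
    x ^ 2 ≤ η ^ (-δ) * |x| ^ (2 + δ) := by
  have hx0 : 0 < |x| := hη.trans hx
  rw [Real.rpow_add hx0, Real.rpow_two, sq_abs, Real.rpow_neg hη.le]
  have h : η ^ δ ≤ |x| ^ δ := Real.rpow_le_rpow hη.le hx.le hδ.le
  have hp : 0 < η ^ δ := Real.rpow_pos_of_pos hη _
  have : 1 ≤ (η ^ δ)⁻¹ * |x| ^ δ := by
    rw [← div_eq_inv_mul, le_div_iff₀ hp]; linarith
  nlinarith [sq_nonneg x]

theorem sq_le_add_rpow {δ η : ℝ} (hδ : 0 < δ) (hη : 0 < η) (x : ℝ) :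
    x ^ 2 ≤ η ^ 2 + η ^ (-δ) * |x| ^ (2 + δ) := by
  rcases le_or_gt |x| η with h | h
  · have : 0 ≤ η ^ (-δ) * |x| ^ (2 + δ) := by positivity
    have := pow_le_pow_left₀ (abs_nonneg x) h 2
    rw [sq_abs] at this
    linarith
  · have := sq_le_rpow_of_lt_abs hδ hη h
    nlinarith

section

variable {α : Type*} [MeasurableSpace α] {ν : Measure α} [IsProbabilityMeasure ν]

theorem norm_integral_cexp_le_one (a : α → ℝ) : ‖∫ x, Complex.exp (Complex.I * a x) ∂ν‖ ≤ 1 := by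
  refine (norm_integral_le_of_norm_le_const (C := 1) ?_).trans (by simp)
  exact Eventually.of_forall fun x => (Complex.norm_exp_I_mul_ofReal _).le

/-- The characteristic function of a centred variable `a` with variance `v` is close to that of the
normal law with the same variance, with an error controlled by a moment of order `2 + δ`. -/
theorem norm_integral_cexp_sub_le {a : α → ℝ} {δ η : ℝ} (hδ : 0 < δ) (hη : 0 < η)
    (ha : AEStronglyMeasurable a ν) (ha2 : Integrable (fun x => a x ^ 2) ν)
    (haq : Integrable (fun x => |a x| ^ (2 + δ)) ν) (ha0 : ∫ x, a x ∂ν = 0) :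
    ‖∫ x, Complex.exp (Complex.I * a x) ∂ν - Complex.exp (-(∫ x, a x ^ 2 ∂ν : ℝ) / 2)‖
      ≤ 3 * η * ∫ x, a x ^ 2 ∂ν + 3 * η ^ (-δ) * ∫ x, |a x| ^ (2 + δ) ∂ν
        + (∫ x, a x ^ 2 ∂ν) ^ 2 := by
  set v := ∫ x, a x ^ 2 ∂ν with hv
  have hv0 : 0 ≤ v := integral_nonneg fun x => sq_nonneg _
  have ha1 : Integrable a ν :=
    ((memLp_two_iff_integrable_sq ha).2 ha2).integrable one_le_two
  have hexp : Integrable (fun x => Complex.exp (Complex.I * a x)) ν := by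
    refine Integrable.of_bound (C := 1) ?_ (Eventually.of_forall fun x => ?_)
    · exact Complex.continuous_exp.comp_aestronglyMeasurable
        ((Complex.continuous_ofReal.comp_aestronglyMeasurable ha).const_mul _)
    · exact (Complex.norm_exp_I_mul_ofReal _).le
  have hsq : Integrable (fun x => ((a x : ℂ)) ^ 2 / 2) ν := by
    have := (ha2.ofReal (𝕜 := ℂ)).div_const 2
    simpa using this
  have hlin : Integrable (fun x => Complex.I * (a x : ℂ)) ν := (ha1.ofReal (𝕜 := ℂ)).const_mul _
  have htay : Integrable (fun x => 1 + Complex.I * (a x : ℂ) - (a x : ℂ) ^ 2 / 2) ν :=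
    ((integrable_const _).add hlin).sub hsq
  have hint : ∫ x, (1 + Complex.I * (a x : ℂ) - (a x : ℂ) ^ 2 / 2) ∂ν = 1 - (v : ℂ) / 2 := by
    have h0 : Integrable (fun x => 1 + Complex.I * (a x : ℂ)) ν := (integrable_const _).add hlin
    rw [integral_sub h0 hsq, integral_add (integrable_const _) hlin, integral_const_mul,
      integral_div]
    have h1 : ∫ x, (a x : ℂ) ∂ν = 0 := by rw [integral_complex_ofReal, ha0]; simp
    have h2 : ∫ x, (a x : ℂ) ^ 2 ∂ν = v := by
      rw [hv, ← integral_complex_ofReal]; simp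
    rw [h1, h2]; simp
  have hpt : ∀ x, ‖Complex.exp (Complex.I * a x) - (1 + Complex.I * (a x : ℂ) - (a x : ℂ) ^ 2 / 2)‖
      ≤ 3 * η * a x ^ 2 + 3 * η ^ (-δ) * |a x| ^ (2 + δ) := by
    intro x
    rcases le_or_gt |a x| η with h | h
    · refine (norm_cexp_taylor_two_le_cube _).trans ?_
      have : 0 ≤ 3 * η ^ (-δ) * |a x| ^ (2 + δ) := by positivity
      have h2 : |a x| ^ 3 ≤ η * a x ^ 2 := by
        rw [pow_succ, sq_abs, mul_comm]; gcongr
      linarith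
    · refine (norm_cexp_taylor_two_le_sq _).trans ?_
      have h1 := sq_le_rpow_of_lt_abs hδ hη h
      have : 0 ≤ 3 * η * a x ^ 2 := by positivity
      linarith
  have hA : ‖∫ x, Complex.exp (Complex.I * a x) ∂ν - (1 - (v : ℂ) / 2)‖
      ≤ 3 * η * v + 3 * η ^ (-δ) * ∫ x, |a x| ^ (2 + δ) ∂ν := by
    rw [← hint, ← integral_sub hexp htay]
    refine (norm_integral_le_of_norm_le ((ha2.const_mul (3 * η)).add
      (haq.const_mul (3 * η ^ (-δ)))) (Eventually.of_forall hpt)).trans ?_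
    simp only [Pi.add_apply]
    rw [integral_add (ha2.const_mul _) (haq.const_mul _), integral_const_mul, integral_const_mul]
  have hB : ‖(1 - (v : ℂ) / 2) - Complex.exp (-(v : ℂ) / 2)‖ ≤ v ^ 2 := by
    have := abs_exp_neg_half_sub_le hv0
    rw [norm_sub_rev]
    have hc : Complex.exp (-(v : ℂ) / 2) - (1 - (v : ℂ) / 2)
        = ((Real.exp (-v / 2) - (1 - v / 2) : ℝ) : ℂ) := by push_cast; ring
    rw [hc, Complex.norm_real, Real.norm_eq_abs]
    exact this
  calc _ ≤ _ := norm_sub_le_norm_sub_add_norm_sub _ (1 - (v : ℂ) / 2) _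
    _ ≤ _ := add_le_add hA hB

theorem integral_sq_le_add {a : α → ℝ} {δ η : ℝ} (hδ : 0 < δ) (hη : 0 < η)
    (ha2 : Integrable (fun x => a x ^ 2) ν) (haq : Integrable (fun x => |a x| ^ (2 + δ)) ν) :
    ∫ x, a x ^ 2 ∂ν ≤ η ^ 2 + η ^ (-δ) * ∫ x, |a x| ^ (2 + δ) ∂ν := by
  refine (integral_mono ha2 ((integrable_const (η ^ 2)).add (haq.const_mul (η ^ (-δ))))
    fun x => sq_le_add_rpow hδ hη (a x)).trans_eq ?_
  simp only [Pi.add_apply]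
  rw [integral_add (integrable_const _) (haq.const_mul _), integral_const_mul]
  simp

/-- `n`-th powers of characteristic functions, with an error linear in `n` times the variance and in
`n` times the moment of order `2 + δ`. -/
theorem norm_integral_cexp_pow_sub_le {a : α → ℝ} {δ η Λ : ℝ} (hδ : 0 < δ) (hη : 0 < η)
    (ha : AEStronglyMeasurable a ν) (ha2 : Integrable (fun x => a x ^ 2) ν)
    (haq : Integrable (fun x => |a x| ^ (2 + δ)) ν) (ha0 : ∫ x, a x ∂ν = 0) (n : ℕ)
    (hΛ : n * ∫ x, |a x| ^ (2 + δ) ∂ν ≤ Λ) :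
    ‖(∫ x, Complex.exp (Complex.I * a x) ∂ν) ^ n
        - Complex.exp (-(n * ∫ x, a x ^ 2 ∂ν : ℝ) / 2)‖
      ≤ (3 * η + η ^ 2 + η ^ (-δ) * Λ) * (n * ∫ x, a x ^ 2 ∂ν) + 3 * η ^ (-δ) * Λ := by
  set v := ∫ x, a x ^ 2 ∂ν with hv
  set L := ∫ x, |a x| ^ (2 + δ) ∂ν with hL
  have hv0 : 0 ≤ v := integral_nonneg fun x => sq_nonneg _
  have hL0 : 0 ≤ L := integral_nonneg fun x => by positivity
  have he : Complex.exp (-(n * v : ℝ) / 2) = Complex.exp (-(v : ℂ) / 2) ^ n := by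
    rw [← Complex.exp_nat_mul]; push_cast; ring_nf
  have hb : ‖Complex.exp (-(v : ℂ) / 2)‖ ≤ 1 := by
    rw [Complex.norm_exp]
    have : (-(v : ℂ) / 2).re = -v / 2 := by simp
    rw [this, Real.exp_le_one_iff]; linarith
  rw [he]
  refine (norm_pow_sub_pow_le_mul (norm_integral_cexp_le_one a) hb n).trans ?_
  have h1 := norm_integral_cexp_sub_le hδ hη ha ha2 haq ha0
  have h2 := integral_sq_le_add hδ hη ha2 haq
  rw [← hv, ← hL] at h1 h2
  have hp : 0 < η ^ (-δ) := Real.rpow_pos_of_pos hη _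
  have hn0 : (0 : ℝ) ≤ n := n.cast_nonneg
  have h3 : n * v ^ 2 ≤ (n * v) * (η ^ 2 + η ^ (-δ) * Λ) := by
    rcases Nat.eq_zero_or_pos n with h | h
    · subst h; simp
    · have hn1 : (1 : ℝ) ≤ n := by exact_mod_cast h
      have hLΛ : L ≤ Λ := by nlinarith
      have : v ≤ η ^ 2 + η ^ (-δ) * Λ := h2.trans (by gcongr)
      calc n * v ^ 2 = (n * v) * v := by ring
        _ ≤ _ := by gcongr
  calc n * _ ≤ n * (3 * η * v + 3 * η ^ (-δ) * L + v ^ 2) := by gcongr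
    _ = 3 * η * (n * v) + 3 * η ^ (-δ) * (n * L) + n * v ^ 2 := by ring
    _ ≤ 3 * η * (n * v) + 3 * η ^ (-δ) * Λ + (n * v) * (η ^ 2 + η ^ (-δ) * Λ) := by gcongr
    _ = _ := by ring

end

/-! ### Moments of the residual and of the regression function -/

/-- The orthogonal decomposition `f(X) - E f(X) = ε + γ` of one group, as functions of the labelled
pair: `ε = f(X) - E[f(X) | V]` is the residual, of variance `s₁`, and `γ = E[f(X) | V] - E f(X)` is
the centred regression function, of variance `s₂`. The parameter `b` bounds the moments of order
`2 + δ` relative to the variances. -/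
structure Decomposition {α : Type*} [MeasurableSpace α] (P : Measure α) (ε γ : α → ℝ)
    (δ s₁ s₂ b : ℝ) : Prop where
  pos₁ : 0 < s₁
  pos₂ : 0 < s₂
  measurable₁ : Measurable ε
  measurable₂ : Measurable γ
  integrable_rpow₁ : Integrable (fun p => |ε p| ^ (2 + δ)) P
  integrable_rpow₂ : Integrable (fun p => |γ p| ^ (2 + δ)) P
  integrable_sq₁ : Integrable (fun p => ε p ^ 2) P
  integrable_sq₂ : Integrable (fun p => γ p ^ 2) P
  integral₁ : ∫ p, ε p ∂P = 0
  integral₂ : ∫ p, γ p ∂P = 0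
  integral_sq₁ : ∫ p, ε p ^ 2 ∂P = s₁
  integral_sq₂ : ∫ p, γ p ^ 2 ∂P = s₂
  integral_mul : ∫ p, ε p * γ p ∂P = 0
  integral_rpow₁ : ∫ p, |ε p| ^ (2 + δ) ∂P ≤ b * √s₁ ^ (2 + δ)
  integral_rpow₂ : ∫ p, |γ p| ^ (2 + δ) ∂P ≤ b * √s₂ ^ (2 + δ)

theorem abs_add_rpow_le {q : ℝ} (hq : 0 ≤ q) (x y : ℝ) :
    |x + y| ^ q ≤ 2 ^ q * (|x| ^ q + |y| ^ q) := by
  have hx := abs_nonneg x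
  have hy := abs_nonneg y
  have h1 : |x + y| ≤ 2 * max |x| |y| := by
    refine (abs_add_le x y).trans ?_
    linarith [le_max_left |x| |y|, le_max_right |x| |y|]
  calc |x + y| ^ q ≤ (2 * max |x| |y|) ^ q := Real.rpow_le_rpow (abs_nonneg _) h1 hq
    _ = 2 ^ q * (max |x| |y|) ^ q := Real.mul_rpow (by norm_num) (hx.trans (le_max_left _ _))
    _ ≤ _ := by
        gcongr
        rcases max_choice |x| |y| with h | h <;> rw [h]
        · linarith [Real.rpow_nonneg hy q]
        · linarith [Real.rpow_nonneg hx q]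

theorem memLp_iff_integrable_abs_rpow {α : Type*} [MeasurableSpace α] {μ : Measure α} {h : α → ℝ}
    {q : ℝ} (hq : 0 < q) (hh : AEStronglyMeasurable h μ) :
    MemLp h (ENNReal.ofReal q) μ ↔ Integrable (fun x => |h x| ^ q) μ := by
  rw [← integrable_norm_rpow_iff hh (by simpa using hq) ENNReal.ofReal_ne_top]
  simp [ENNReal.toReal_ofReal hq.le]

section

variable {𝒳 𝒱 : Type*} [MeasurableSpace 𝒳] [MeasurableSpace 𝒱]

theorem covariateSigma_le : covariateSigma 𝒳 𝒱 ≤ (inferInstance : MeasurableSpace (𝒳 × 𝒱)) :=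
  measurable_snd.comap_le

/-- A finite moment ratio forces both variances to be positive, and the moment bound passes from `f`
to the regression function, because conditional expectation is a contraction of `L^(2 + δ)`, and
then to the residual. -/
theorem decomposition_of_momentRatio {P : Measure (𝒳 × 𝒱)} [IsProbabilityMeasure P] {f : 𝒳 → ℝ}
    {g : 𝒱 → ℝ} {δ b : ℝ} (hδ : 0 < δ) (hf : Measurable f) (hg : Measurable g)
    (hfg : (fun p : 𝒳 × 𝒱 => g p.2) =ᵐ[P] condMean P f) (hb : 0 ≤ b)
    (hM : momentRatio P δ f ≤ ENNReal.ofReal b) :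
    Decomposition P (fun p => f p.1 - g p.2) (fun p => g p.2 - popMean P f) δ
      (sigmaSq₁ P f) (sigmaSq₂ P f) (2 ^ (2 + δ) * (b + b)) := by
  have hq : (0 : ℝ) < 2 + δ := by linarith
  set m := popMean P f with hm
  set s := min (√(sigmaSq₁ P f) ^ (2 + δ)) (√(sigmaSq₂ P f) ^ (2 + δ)) with hs
  have hs0 : 0 < s := by
    by_contra h
    rw [momentRatio, ratio, if_neg h] at hM
    simp at hM
  rw [momentRatio, ratio, if_pos hs0] at hM
  have hpos : ∀ x : ℝ, 0 < √x ^ (2 + δ) → 0 < x := by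
    intro x hx
    by_contra h
    rw [Real.sqrt_eq_zero_of_nonpos (not_lt.1 h), Real.zero_rpow hq.ne'] at hx
    exact lt_irrefl _ hx
  have hs1 : 0 < sigmaSq₁ P f := hpos _ (hs0.trans_le (min_le_left _ _))
  have hs2 : 0 < sigmaSq₂ P f := hpos _ (hs0.trans_le (min_le_right _ _))
  have hM' : absCentralMoment P f (2 + δ) ≤ ENNReal.ofReal (b * s) := by
    rw [ENNReal.div_le_iff (ENNReal.ofReal_pos.2 hs0).ne' ENNReal.ofReal_ne_top] at hM
    rwa [ENNReal.ofReal_mul hb]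
  -- measurability
  have hfm : Measurable fun p : 𝒳 × 𝒱 => f p.1 := hf.comp measurable_fst
  have hgm : Measurable fun p : 𝒳 × 𝒱 => g p.2 := hg.comp measurable_snd
  have hfc : Measurable fun p : 𝒳 × 𝒱 => f p.1 - m := hfm.sub_const m
  have hgc : Measurable fun p : 𝒳 × 𝒱 => g p.2 - m := hgm.sub_const m
  have hfg' : Measurable fun p : 𝒳 × 𝒱 => f p.1 - g p.2 := hfm.sub hgm
  have hcint : Integrable (fun p : 𝒳 × 𝒱 => |f p.1 - m| ^ (2 + δ)) P := by
    refine ⟨(hfc.abs.pow_const _).aestronglyMeasurable, ?_⟩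
    rw [hasFiniteIntegral_iff_ofReal (Eventually.of_forall fun p => by positivity)]
    exact hM'.trans_lt ENNReal.ofReal_lt_top
  have hcM : ∫ p, |f p.1 - m| ^ (2 + δ) ∂P ≤ b * s := by
    rw [integral_eq_lintegral_of_nonneg_ae (Eventually.of_forall fun p => by positivity)
      (hfc.abs.pow_const _).aestronglyMeasurable]
    exact ENNReal.toReal_le_of_le_ofReal (by positivity) hM'
  have hcLp : MemLp (fun p : 𝒳 × 𝒱 => f p.1 - m) (ENNReal.ofReal (2 + δ)) P :=
    (memLp_iff_integrable_abs_rpow hq hfc.aestronglyMeasurable).2 hcint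
  have hle2 : (2 : ℝ≥0∞) ≤ ENNReal.ofReal (2 + δ) := by
    rw [show (2 : ℝ≥0∞) = ENNReal.ofReal 2 by simp]
    exact ENNReal.ofReal_le_ofReal (by linarith)
  have hle1 : (1 : ℝ≥0∞) ≤ ENNReal.ofReal (2 + δ) := one_le_two.trans hle2
  have hfLp : MemLp (fun p : 𝒳 × 𝒱 => f p.1) 2 P := by
    have := (hcLp.mono_exponent hle2).add (memLp_const m)
    refine this.congr_norm hfm.aestronglyMeasurable (Eventually.of_forall fun p => ?_)
    simp
  have hf1 : Integrable (fun p : 𝒳 × 𝒱 => f p.1) P := hfLp.integrable one_le_two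
  -- the regression function is a contraction of the centred function
  have hcond : (fun p : 𝒳 × 𝒱 => g p.2 - m) =ᵐ[P]
      P[fun p => f p.1 - m | covariateSigma 𝒳 𝒱] := by
    have h1 := condExp_sub hf1 (integrable_const (μ := P) m) (covariateSigma 𝒳 𝒱)
    rw [condExp_const covariateSigma_le] at h1
    filter_upwards [hfg, h1] with p hp hp1
    have hp2 : (P[fun p => f p.1 - m | covariateSigma 𝒳 𝒱]) p = condMean P f p - m := hp1
    rw [hp2, hp]
  have hgLp : MemLp (fun p : 𝒳 × 𝒱 => g p.2 - m) (ENNReal.ofReal (2 + δ)) P :=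
    (memLp_congr_ae hcond).2 (hcLp.condExp hle1)
  have hgint : Integrable (fun p : 𝒳 × 𝒱 => |g p.2 - m| ^ (2 + δ)) P :=
    (memLp_iff_integrable_abs_rpow hq hgc.aestronglyMeasurable).1 hgLp
  have hgM : ∫ p, |g p.2 - m| ^ (2 + δ) ∂P ≤ b * s := by
    refine le_trans ?_ hcM
    have h1 := eLpNorm_condExp_le_eLpNorm (μ := P) (m := covariateSigma 𝒳 𝒱)
      (fun p : 𝒳 × 𝒱 => f p.1 - m) hle1
    rw [← eLpNorm_congr_ae hcond] at h1
    have h0 : ENNReal.ofReal (2 + δ) ≠ 0 := by simpa using hq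
    rw [hgLp.eLpNorm_eq_integral_rpow_norm h0 ENNReal.ofReal_ne_top,
      hcLp.eLpNorm_eq_integral_rpow_norm h0 ENNReal.ofReal_ne_top,
      ENNReal.ofReal_le_ofReal_iff (by positivity), ENNReal.toReal_ofReal hq.le] at h1
    simp only [Real.norm_eq_abs] at h1
    exact (Real.rpow_le_rpow_iff (integral_nonneg fun p => by positivity)
      (integral_nonneg fun p => by positivity) (by positivity)).1 h1
  have hg2 : MemLp (fun p : 𝒳 × 𝒱 => g p.2 - m) 2 P := hgLp.mono_exponent hle2
  have hsum : ∀ p : 𝒳 × 𝒱, f p.1 - g p.2 = (f p.1 - m) + -(g p.2 - m) := fun p => by ring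
  have heLp : MemLp (fun p : 𝒳 × 𝒱 => f p.1 - g p.2) (ENNReal.ofReal (2 + δ)) P := by
    simp_rw [hsum]; exact hcLp.add hgLp.neg
  have he2 : MemLp (fun p : 𝒳 × 𝒱 => f p.1 - g p.2) 2 P := heLp.mono_exponent hle2
  have heint : Integrable (fun p : 𝒳 × 𝒱 => |f p.1 - g p.2| ^ (2 + δ)) P :=
    (memLp_iff_integrable_abs_rpow hq hfg'.aestronglyMeasurable).1 heLp
  have heM : ∫ p, |f p.1 - g p.2| ^ (2 + δ) ∂P ≤ 2 ^ (2 + δ) * (b * s + b * s) := by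
    calc ∫ p, |f p.1 - g p.2| ^ (2 + δ) ∂P
        ≤ ∫ p, 2 ^ (2 + δ) * (|f p.1 - m| ^ (2 + δ) + |g p.2 - m| ^ (2 + δ)) ∂P := by
          refine integral_mono heint ((hcint.add hgint).const_mul _) fun p => ?_
          have := abs_add_rpow_le hq.le (f p.1 - m) (-(g p.2 - m))
          rw [abs_neg, ← hsum p] at this
          exact this
      _ ≤ _ := by
          rw [integral_const_mul, integral_add hcint hgint]
          gcongr
  -- first two moments
  have hgmean : ∫ p, g p.2 ∂P = m := by
    rw [integral_congr_ae hfg, condMean, integral_condExp covariateSigma_le, hm, popMean]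
  have hg1 : Integrable (fun p : 𝒳 × 𝒱 => g p.2) P :=
    (integrable_congr hfg).2 integrable_condExp
  have h10 : ∫ p, (f p.1 - g p.2) ∂P = 0 := by
    rw [integral_sub hf1 hg1, hgmean, hm, popMean, sub_self]
  have h20 : ∫ p, (g p.2 - m) ∂P = 0 := by
    rw [integral_sub hg1 (integrable_const _), hgmean]; simp
  have h1s : ∫ p, (f p.1 - g p.2) ^ 2 ∂P = sigmaSq₁ P f := by
    rw [sigmaSq₁, condVar, integral_condExp covariateSigma_le]
    refine integral_congr_ae ?_
    filter_upwards [hfg] with p hp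
    rw [hp]; rfl
  have h2s : ∫ p, (g p.2 - m) ^ 2 ∂P = sigmaSq₂ P f := by
    rw [sigmaSq₂, ← variance_congr hfg, variance_eq_integral hgm.aemeasurable, hgmean]
  have hmul : ∫ p, (f p.1 - g p.2) * (g p.2 - m) ∂P = 0 := by
    have htot := integral_condVar_add_variance_condExp (covariateSigma_le (𝒳 := 𝒳) (𝒱 := 𝒱)) hfLp
    change sigmaSq₁ P f + sigmaSq₂ P f = _ at htot
    rw [variance_eq_integral hfm.aemeasurable] at htot
    change _ = ∫ p, (f p.1 - m) ^ 2 ∂P at htot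
    have hexp : ∀ p : 𝒳 × 𝒱, (f p.1 - m) ^ 2 = (f p.1 - g p.2) ^ 2 + (g p.2 - m) ^ 2
        + 2 * ((f p.1 - g p.2) * (g p.2 - m)) := fun p => by ring
    simp_rw [hexp] at htot
    have hi : Integrable (fun p : 𝒳 × 𝒱 => (f p.1 - g p.2) * (g p.2 - m)) P :=
      he2.integrable_mul hg2
    have hi2 : Integrable (fun p : 𝒳 × 𝒱 => (f p.1 - g p.2) ^ 2 + (g p.2 - m) ^ 2) P :=
      he2.integrable_sq.add hg2.integrable_sq
    rw [integral_add hi2 (hi.const_mul _), integral_add he2.integrable_sq hg2.integrable_sq,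
      integral_const_mul, h1s, h2s] at htot
    linarith
  have h2q : (1 : ℝ) ≤ 2 ^ (2 + δ) := Real.one_le_rpow (by norm_num) hq.le
  exact
    { pos₁ := hs1
      pos₂ := hs2
      measurable₁ := hfg'
      measurable₂ := hgc
      integrable_rpow₁ := heint
      integrable_rpow₂ := hgint
      integrable_sq₁ := he2.integrable_sq
      integrable_sq₂ := hg2.integrable_sq
      integral₁ := h10
      integral₂ := h20
      integral_sq₁ := h1s
      integral_sq₂ := h2s
      integral_mul := hmul
      integral_rpow₁ := by
        refine heM.trans ?_
        have : s ≤ √(sigmaSq₁ P f) ^ (2 + δ) := min_le_left _ _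
        rw [mul_assoc, add_mul]
        gcongr
      integral_rpow₂ := by
        refine hgM.trans ?_
        have : s ≤ √(sigmaSq₂ P f) ^ (2 + δ) := min_le_right _ _
        have h3 : b ≤ 2 ^ (2 + δ) * (b + b) := by nlinarith
        gcongr }

end

/-! ### Sums over product measures and a weak law of large numbers -/

section

variable {α : Type*} [MeasurableSpace α] {ν : Measure α} [IsProbabilityMeasure ν]

theorem integral_abs_le_sqrt {X : α → ℝ} (hX : MemLp X 2 ν) :
    ∫ x, |X x| ∂ν ≤ √(∫ x, X x ^ 2 ∂ν) := by
  have h := variance_nonneg |X| ν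
  rw [variance_eq_sub hX.abs] at h
  refine Real.le_sqrt_of_sq_le ?_
  have h2 : ∫ x, (|X| ^ 2) x ∂ν = ∫ x, X x ^ 2 ∂ν := by simp
  rw [h2] at h
  simp only [Pi.abs_apply] at h
  linarith

variable (n : ℕ)

theorem integrable_sum_comp_eval {ψ : α → ℝ} (hψ : Integrable ψ ν) :
    Integrable (fun w : Fin n → α => ∑ i, ψ (w i)) (Measure.pi fun _ => ν) :=
  integrable_finsetSum _ fun i _ =>
    (measurePreserving_eval (fun _ : Fin n => ν) i).integrable_comp_of_integrable hψ

theorem integral_comp_eval {ψ : α → ℝ} (hψ : AEStronglyMeasurable ψ ν) (i : Fin n) :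
    ∫ w, ψ (w i) ∂(Measure.pi fun _ : Fin n => ν) = ∫ x, ψ x ∂ν := by
  have h := measurePreserving_eval (fun _ : Fin n => ν) i
  conv_rhs => rw [← h.map_eq]
  rw [integral_map h.measurable.aemeasurable (by rwa [h.map_eq])]

theorem integral_sum_comp_eval {ψ : α → ℝ} (hψ : Integrable ψ ν) :
    ∫ w, ∑ i, ψ (w i) ∂(Measure.pi fun _ : Fin n => ν) = n * ∫ x, ψ x ∂ν := by
  have h (i : Fin n) : Integrable (fun w : Fin n → α => ψ (w i)) (Measure.pi fun _ => ν) :=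
    (measurePreserving_eval (fun _ : Fin n => ν) i).integrable_comp_of_integrable hψ
  rw [integral_finsetSum _ fun i _ => h i]
  simp [integral_comp_eval n hψ.aestronglyMeasurable]

theorem memLp_sum_comp_eval {ψ : α → ℝ} (hψ : MemLp ψ 2 ν) :
    MemLp (fun w : Fin n → α => ∑ i, ψ (w i)) 2 (Measure.pi fun _ => ν) :=
  memLp_finsetSum _ fun i _ =>
    hψ.comp_measurePreserving (measurePreserving_eval (fun _ : Fin n => ν) i)

theorem integral_sq_sum_comp_eval {ψ : α → ℝ} (hψ : MemLp ψ 2 ν) (h0 : ∫ x, ψ x ∂ν = 0) :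
    ∫ w, (∑ i, ψ (w i)) ^ 2 ∂(Measure.pi fun _ : Fin n => ν) = n * ∫ x, ψ x ^ 2 ∂ν := by
  have hv := variance_sum_pi (ι := Fin n) (μ := fun _ => ν) (X := fun _ => ψ) fun _ => hψ
  have he : (∑ i : Fin n, fun w : Fin n → α => ψ (w i)) = fun w => ∑ i, ψ (w i) := by
    ext w; simp
  rw [he, variance_of_integral_eq_zero (memLp_sum_comp_eval n hψ).aemeasurable
    (by rw [integral_sum_comp_eval n (hψ.integrable one_le_two), h0, mul_zero]),
    variance_of_integral_eq_zero hψ.aemeasurable h0] at hv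
  simpa using hv

theorem integral_sub_integral_sq_le {ψ : α → ℝ} (hψ : MemLp ψ 2 ν) :
    ∫ x, (ψ x - ∫ y, ψ y ∂ν) ^ 2 ∂ν ≤ ∫ x, ψ x ^ 2 ∂ν := by
  have h := variance_le_expectation_sq hψ.aestronglyMeasurable
  rwa [variance_eq_integral hψ.aemeasurable] at h

theorem integral_sq_sum_sub_le {ψ : α → ℝ} (hψ : MemLp ψ 2 ν) :
    ∫ w, (∑ i, (ψ (w i) - ∫ x, ψ x ∂ν)) ^ 2 ∂(Measure.pi fun _ : Fin n => ν)
      ≤ n * ∫ x, ψ x ^ 2 ∂ν := by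
  have h1 : MemLp (fun x => ψ x - ∫ y, ψ y ∂ν) 2 ν := hψ.sub (memLp_const _)
  rw [integral_sq_sum_comp_eval n h1 (by
    rw [integral_sub (hψ.integrable one_le_two) (integrable_const _)]; simp)]
  exact mul_le_mul_of_nonneg_left (integral_sub_integral_sq_le hψ) n.cast_nonneg

/-- A quantitative weak law of large numbers for squares: the part of `a ^ 2` below the level `K` is
handled by its variance, the part above by the moment of order `2 + δ`. -/
theorem integral_abs_sum_sq_sub_le {a : α → ℝ} {δ K v L : ℝ} (hδ : 0 < δ) (hK : 0 < K)
    (ha : Measurable a)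
    (haq : Integrable (fun x => |a x| ^ (2 + δ)) ν) (hv : ∫ x, a x ^ 2 ∂ν = v)
    (hL : ∫ x, |a x| ^ (2 + δ) ∂ν ≤ L) :
    ∫ w, |∑ i, (a (w i) ^ 2 - v)| ∂(Measure.pi fun _ : Fin n => ν)
      ≤ √(n * (K * v)) + 2 * n * (√K ^ (-δ) * L) := by
  have hK' : 0 < √K := Real.sqrt_pos.2 hK
  have hKs : √K ^ 2 = K := Real.sq_sqrt hK.le
  -- the squares truncated at the level `K`, and the remainder
  set T : α → ℝ := Set.indicator {x | |a x| ≤ √K} fun x => a x ^ 2 with hT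
  set U : α → ℝ := Set.indicator {x | |a x| ≤ √K}ᶜ fun x => a x ^ 2 with hU
  have hTU : ∀ x, a x ^ 2 = T x + U x := fun x =>
    (congrFun (Set.indicator_self_add_compl {x | |a x| ≤ √K} fun x => a x ^ 2) x).symm
  have hset : MeasurableSet {x | |a x| ≤ √K} := measurableSet_le ha.abs measurable_const
  have hTm : Measurable T := (ha.pow_const 2).indicator hset
  have hUm : Measurable U := (ha.pow_const 2).indicator hset.compl
  have hT0 : ∀ x, 0 ≤ T x := fun x => Set.indicator_nonneg (fun _ _ => sq_nonneg _) x
  have hU0 : ∀ x, 0 ≤ U x := fun x => Set.indicator_nonneg (fun _ _ => sq_nonneg _) x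
  have hTK : ∀ x, T x ≤ K := by
    intro x
    by_cases hx : |a x| ≤ √K
    · rw [hT, Set.indicator_of_mem (by exact hx), ← sq_abs, ← hKs]
      gcongr
    · rw [hT, Set.indicator_of_notMem (by exact hx)]; exact hK.le
  have hUle : ∀ x, U x ≤ √K ^ (-δ) * |a x| ^ (2 + δ) := by
    intro x
    by_cases hx : |a x| ≤ √K
    · rw [hU, Set.indicator_of_notMem (by simpa using hx)]; positivity
    · rw [hU, Set.indicator_of_mem (by simpa using hx)]
      exact sq_le_rpow_of_lt_abs hδ hK' (not_le.1 hx)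
  have hT2 : MemLp T 2 ν := MemLp.of_bound hTm.aestronglyMeasurable K
    (Eventually.of_forall fun x => by rw [Real.norm_of_nonneg (hT0 x)]; exact hTK x)
  have hTi : Integrable T ν := hT2.integrable one_le_two
  have hUi : Integrable U ν := (haq.const_mul (√K ^ (-δ))).mono' hUm.aestronglyMeasurable
    (Eventually.of_forall fun x => by rw [Real.norm_of_nonneg (hU0 x)]; exact hUle x)
  have hTUv : ∫ x, T x ∂ν + ∫ x, U x ∂ν = v := by
    rw [← hv, ← integral_add hTi hUi]
    simp_rw [hTU]
  have hTv : ∫ x, T x ∂ν ≤ v := by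
    have : 0 ≤ ∫ x, U x ∂ν := integral_nonneg hU0
    linarith
  have hTT : ∫ x, T x ^ 2 ∂ν ≤ K * v := by
    calc ∫ x, T x ^ 2 ∂ν ≤ ∫ x, K * T x ∂ν := by
          refine integral_mono hT2.integrable_sq (hTi.const_mul _) fun x => ?_
          have := hT0 x; have := hTK x
          simp only [sq]; gcongr
      _ ≤ K * v := by rw [integral_const_mul]; gcongr
  have hUL : ∫ x, U x ∂ν ≤ √K ^ (-δ) * L := by
    calc ∫ x, U x ∂ν ≤ ∫ x, √K ^ (-δ) * |a x| ^ (2 + δ) ∂ν :=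
          integral_mono hUi (haq.const_mul _) hUle
      _ ≤ _ := by rw [integral_const_mul]; gcongr
  have hTc : MemLp (fun x => T x - ∫ y, T y ∂ν) 2 ν := hT2.sub (memLp_const _)
  have hUc : Integrable (fun x => |U x - ∫ y, U y ∂ν|) ν := (hUi.sub (integrable_const _)).abs
  have hA : ∫ w, |∑ i, (T (w i) - ∫ y, T y ∂ν)| ∂(Measure.pi fun _ : Fin n => ν)
      ≤ √(n * (K * v)) := by
    refine (integral_abs_le_sqrt (memLp_sum_comp_eval n hTc)).trans (Real.sqrt_le_sqrt ?_)
    refine (integral_sq_sum_sub_le n hT2).trans ?_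
    gcongr
  have hB : ∫ w, ∑ i, |U (w i) - ∫ y, U y ∂ν| ∂(Measure.pi fun _ : Fin n => ν)
      ≤ 2 * n * (√K ^ (-δ) * L) := by
    rw [integral_sum_comp_eval n hUc]
    have h1 : ∫ x, |U x - ∫ y, U y ∂ν| ∂ν ≤ 2 * ∫ x, U x ∂ν := by
      have h0 : 0 ≤ ∫ x, U x ∂ν := integral_nonneg hU0
      calc ∫ x, |U x - ∫ y, U y ∂ν| ∂ν ≤ ∫ x, (U x + ∫ y, U y ∂ν) ∂ν := by
            refine integral_mono hUc (hUi.add (integrable_const _)) fun x => ?_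
            refine (abs_sub _ _).trans_eq ?_
            rw [abs_of_nonneg (hU0 x), abs_of_nonneg h0]
        _ = 2 * ∫ x, U x ∂ν := by
            rw [integral_add hUi (integrable_const _)]; simp; ring
    calc (n : ℝ) * _ ≤ n * (2 * (√K ^ (-δ) * L)) := by gcongr; exact h1.trans (by gcongr)
      _ = _ := by ring
  have hAi : Integrable (fun w : Fin n → α => |∑ i, (T (w i) - ∫ y, T y ∂ν)|)
      (Measure.pi fun _ => ν) :=
    ((memLp_sum_comp_eval n hTc).integrable one_le_two).abs
  have hBi := integrable_sum_comp_eval n hUc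
  refine le_trans ?_ (add_le_add hA hB)
  rw [← integral_add hAi hBi]
  refine integral_mono_of_nonneg (Eventually.of_forall fun w => abs_nonneg _) (hAi.add hBi)
    (Eventually.of_forall fun w => ?_)
  have hsplit : ∑ i, (a (w i) ^ 2 - v)
      = ∑ i, (T (w i) - ∫ y, T y ∂ν) + ∑ i, (U (w i) - ∫ y, U y ∂ν) := by
    rw [← Finset.sum_add_distrib]
    refine Finset.sum_congr rfl fun i _ => ?_
    rw [hTU, ← hTUv]; ring
  simp only
  rw [hsplit]
  refine (abs_add_le _ _).trans ?_
  gcongr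
  exact Finset.abs_sum_le_sum_abs _ _

end

/-! ### Convergence to zero in probability along a sequence of probability spaces -/

/-- `X k → 0` in probability, each `X k` being defined on its own space `(Ω k, μ k)`. -/
def VanishesInProb {Ω : ℕ → Type*} [∀ k, MeasurableSpace (Ω k)] (μ : ∀ k, Measure (Ω k))
    (X : ∀ k, Ω k → ℝ) : Prop :=
  ∀ ε : ℝ, 0 < ε → Tendsto (fun k => μ k {ω | ε ≤ |X k ω|}) atTop (𝓝 0)

namespace VanishesInProb

variable {Ω Ω' : ℕ → Type*} [∀ k, MeasurableSpace (Ω k)] [∀ k, MeasurableSpace (Ω' k)]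
  {μ : ∀ k, Measure (Ω k)} {μ' : ∀ k, Measure (Ω' k)} {X Y : ∀ k, Ω k → ℝ}

theorem of_imp (hY : VanishesInProb μ Y)
    (h : ∀ ε : ℝ, 0 < ε → ∃ η : ℝ, 0 < η ∧ ∀ᶠ k in atTop, ∀ ω, |Y k ω| < η → |X k ω| < ε) :
    VanishesInProb μ X := by
  intro ε hε
  obtain ⟨η, hη, hk⟩ := h ε hε
  refine tendsto_of_tendsto_of_tendsto_of_le_of_le' tendsto_const_nhds (hY η hη)
    (Eventually.of_forall fun _ => zero_le) ?_
  filter_upwards [hk] with k hk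
  refine measure_mono fun ω hω => ?_
  by_contra hlt
  exact absurd (hk ω (not_le.1 hlt)) (not_lt.2 hω)

theorem of_le (hY : VanishesInProb μ Y) (h : ∀ᶠ k in atTop, ∀ ω, |X k ω| ≤ |Y k ω|) :
    VanishesInProb μ X :=
  hY.of_imp fun ε hε => ⟨ε, hε, h.mono fun _ hk ω hω => (hk ω).trans_lt hω⟩

theorem add (hX : VanishesInProb μ X) (hY : VanishesInProb μ Y) :
    VanishesInProb μ fun k ω => X k ω + Y k ω := by
  intro ε hε
  have h := (hX (ε / 2) (by linarith)).add (hY (ε / 2) (by linarith))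
  rw [add_zero] at h
  refine tendsto_of_tendsto_of_tendsto_of_le_of_le tendsto_const_nhds h
    (fun _ => zero_le) fun k => ?_
  refine (measure_mono fun ω hω => ?_).trans (measure_union_le _ _)
  by_contra hlt
  simp only [Set.mem_union, Set.mem_ofPred_eq, not_or, not_le] at hlt hω
  linarith [abs_add_le (X k ω) (Y k ω), hlt.1, hlt.2]

theorem const_mul (hX : VanishesInProb μ X) (c : ℝ) : VanishesInProb μ fun k ω => c * X k ω := by
  refine hX.of_imp fun ε hε => ⟨ε / (|c| + 1), by positivity, Eventually.of_forall fun k ω h => ?_⟩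
  rw [lt_div_iff₀ (by positivity)] at h
  rw [abs_mul]
  nlinarith [abs_nonneg (X k ω)]

theorem of_forall_le_add
    (h : ∀ η : ℝ, 0 < η → ∃ Y : ∀ k, Ω k → ℝ, VanishesInProb μ Y ∧
      ∀ᶠ k in atTop, ∀ ω, |X k ω| ≤ η + Y k ω) : VanishesInProb μ X := by
  intro ε hε
  obtain ⟨Y, hY, hle⟩ := h (ε / 2) (by linarith)
  refine tendsto_of_tendsto_of_tendsto_of_le_of_le' tendsto_const_nhds (hY (ε / 2) (by linarith))
    (Eventually.of_forall fun _ => zero_le) ?_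
  filter_upwards [hle] with k hk
  refine measure_mono fun ω hω => ?_
  simp only [Set.mem_ofPred_eq] at hω ⊢
  linarith [hk ω, le_abs_self (Y k ω)]

theorem of_lintegral (hX : ∀ᶠ k in atTop, AEMeasurable (X k) (μ k))
    (h : Tendsto (fun k => ∫⁻ ω, ENNReal.ofReal |X k ω| ∂(μ k)) atTop (𝓝 0)) :
    VanishesInProb μ X := by
  intro ε hε
  have hε' : ENNReal.ofReal ε ≠ 0 := by simpa using hε
  have h2 := ENNReal.Tendsto.div_const h (Or.inr hε')
  rw [ENNReal.zero_div] at h2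
  refine tendsto_of_tendsto_of_tendsto_of_le_of_le' tendsto_const_nhds h2
    (Eventually.of_forall fun _ => zero_le) ?_
  filter_upwards [hX] with k hXk
  refine le_trans (measure_mono fun ω hω => ?_)
    (meas_ge_le_lintegral_div hXk.abs.ennreal_ofReal hε' ENNReal.ofReal_ne_top)
  exact ENNReal.ofReal_le_ofReal hω

theorem of_integral (hX : ∀ᶠ k in atTop, Integrable (X k) (μ k))
    (h : Tendsto (fun k => ∫ ω, |X k ω| ∂(μ k)) atTop (𝓝 0)) :
    VanishesInProb μ X := by
  refine of_lintegral (hX.mono fun k hk => hk.aemeasurable) ?_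
  have h2 := ENNReal.tendsto_ofReal h
  rw [ENNReal.ofReal_zero] at h2
  refine h2.congr' ?_
  filter_upwards [hX] with k hk
  exact ofReal_integral_eq_lintegral_ofReal hk.abs (Eventually.of_forall fun _ => abs_nonneg _)

theorem of_sq (h : VanishesInProb μ fun k ω => X k ω ^ 2) : VanishesInProb μ X := by
  refine h.of_imp fun ε hε => ⟨ε ^ 2, by positivity, Eventually.of_forall fun k ω hω => ?_⟩
  rw [abs_pow] at hω
  exact lt_of_pow_lt_pow_left₀ 2 hε.le hω

theorem fst [∀ k, IsProbabilityMeasure (μ' k)] (hX : VanishesInProb μ X) :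
    VanishesInProb (fun k => (μ k).prod (μ' k)) fun k ω => X k ω.1 := by
  intro ε hε
  refine (hX ε hε).congr fun k => ?_
  have : {ω : Ω k × Ω' k | ε ≤ |X k ω.1|} = {ω | ε ≤ |X k ω|} ×ˢ Set.univ := by ext; simp
  rw [this]
  rw [Measure.prod_prod, measure_univ, mul_one]

theorem snd [∀ k, SFinite (μ k)] [∀ k, IsProbabilityMeasure (μ' k)] (hX : VanishesInProb μ X) :
    VanishesInProb (fun k => (μ' k).prod (μ k)) fun k ω => X k ω.2 := by
  intro ε hε
  refine (hX ε hε).congr fun k => ?_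
  have : {ω : Ω' k × Ω k | ε ≤ |X k ω.2|} = Set.univ ×ˢ {ω | ε ≤ |X k ω|} := by ext; simp
  rw [this]
  rw [Measure.prod_prod, measure_univ, one_mul]

end VanishesInProb

/-- A sequence bounded, for each `η > 0`, by `η` plus a null sequence is a null sequence. -/
theorem tendsto_zero_of_forall_le_add {x : ℕ → ℝ} (h0 : ∀ k, 0 ≤ x k)
    (h : ∀ η : ℝ, 0 < η → ∃ y : ℕ → ℝ, Tendsto y atTop (𝓝 0) ∧ ∀ᶠ k in atTop, x k ≤ η + y k) :
    Tendsto x atTop (𝓝 0) := by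
  rw [Metric.tendsto_nhds]
  intro ε hε
  obtain ⟨y, hy, hle⟩ := h (ε / 2) (by linarith)
  filter_upwards [hle, hy.eventually_lt_const (show (0 : ℝ) < ε / 2 by linarith)] with k h1 h2
  rw [Real.dist_eq, sub_zero, abs_of_nonneg (h0 k)]
  linarith

/-! ### The oracle variance estimates -/

/-- The error of the truncated law of large numbers, relative to the variance: `η` is the relative
truncation level and `β` the moment bound divided by the appropriate power of the sample size. -/
def llnError (δ η β : ℝ) : ℝ := √η + 2 * (√η ^ (-δ) * β)

theorem sqrt_rpow_neg_mul {δ η N s b : ℝ} (hη : 0 < η) (hN : 0 < N) (hs : 0 < s) :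
    √(η * N * s) ^ (-δ) * (b * √s ^ (2 + δ)) = √η ^ (-δ) * (b * √N ^ (-δ)) * s := by
  have hs' : 0 < √s := Real.sqrt_pos.2 hs
  have h1 : √s ^ (-δ) * √s ^ (2 + δ) = s := by
    rw [← Real.rpow_add hs', show -δ + (2 + δ) = (2 : ℝ) by ring, Real.rpow_two, Real.sq_sqrt hs.le]
  rw [Real.sqrt_mul (by positivity), Real.sqrt_mul hη.le,
    Real.mul_rpow (by positivity) (by positivity), Real.mul_rpow (by positivity) (by positivity)]
  linear_combination √η ^ (-δ) * √N ^ (-δ) * b * h1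

section

variable {α : Type*} [MeasurableSpace α] {ν : Measure α} [IsProbabilityMeasure ν]

theorem integral_abs_sum_sq_sub_le_llnError {a : α → ℝ} {δ η s b β N : ℝ} (hδ : 0 < δ)
    (hη : 0 < η) (hs : 0 < s) (ha : Measurable a)
    (haq : Integrable (fun x => |a x| ^ (2 + δ)) ν) (has : ∫ x, a x ^ 2 ∂ν = s)
    (hb : ∫ x, |a x| ^ (2 + δ) ∂ν ≤ b * √s ^ (2 + δ)) (n : ℕ) (hN : 0 < N) (hnN : n ≤ N)
    (hβ : b * √N ^ (-δ) ≤ β) (hβ0 : 0 ≤ β) :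
    ∫ w, |∑ i, (a (w i) ^ 2 - s)| ∂(Measure.pi fun _ : Fin n => ν)
      ≤ N * s * llnError δ η β := by
  refine (integral_abs_sum_sq_sub_le n hδ (by positivity : 0 < η * N * s) ha haq has hb).trans ?_
  rw [sqrt_rpow_neg_mul hη hN hs, llnError]
  have h1 : √(n * (η * N * s * s)) ≤ N * s * √η := by
    rw [Real.sqrt_le_left (by positivity), mul_pow, mul_pow, Real.sq_sqrt hη.le]
    calc n * (η * N * s * s) ≤ N * (η * N * s * s) := by gcongr
      _ = _ := by ring
  have h2 : 2 * n * (√η ^ (-δ) * (b * √N ^ (-δ)) * s) ≤ 2 * N * (√η ^ (-δ) * β * s) := by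
    calc 2 * n * (√η ^ (-δ) * (b * √N ^ (-δ)) * s) ≤ 2 * n * (√η ^ (-δ) * β * s) := by gcongr
      _ ≤ _ := by gcongr
  calc _ ≤ N * s * √η + 2 * N * (√η ^ (-δ) * β * s) := add_le_add h1 h2
    _ = _ := by ring

end

section

variable {𝒳 𝒱 S : Type*} [MeasurableSpace 𝒳] [MeasurableSpace 𝒱] [MeasurableSpace S]
  {P : Measure (𝒳 × 𝒱)} [IsProbabilityMeasure P] {ρ : Measure S} [IsProbabilityMeasure ρ]
  {n m : ℕ}

instance : IsProbabilityMeasure (groupLaw P ρ n m) := by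
  unfold groupLaw; infer_instance

theorem measurePreserving_labelled :
    MeasurePreserving (fun d : GroupSample 𝒳 𝒱 S n m => d.1) (groupLaw P ρ n m)
      (Measure.pi fun _ => P) :=
  measurePreserving_fst

theorem measurePreserving_unlabelled :
    MeasurePreserving (fun d : GroupSample 𝒳 𝒱 S n m => d.2.1) (groupLaw P ρ n m)
      (Measure.pi fun _ => P.snd) :=
  (measurePreserving_fst (μ := Measure.pi fun _ : Fin m => P.snd) (ν := ρ.prod ρ)).comp
    (measurePreserving_snd (μ := Measure.pi fun _ : Fin n => P))

omit [IsProbabilityMeasure P] in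
theorem measurePreserving_covariate : MeasurePreserving Prod.snd P P.snd := ⟨measurable_snd, rfl⟩

omit [IsProbabilityMeasure P] in
theorem integral_covariate {h : 𝒱 → ℝ} (hh : Measurable h) :
    ∫ v, h v ∂P.snd = ∫ p, h p.2 ∂P :=
  integral_map measurable_snd.aemeasurable hh.aestronglyMeasurable

omit [IsProbabilityMeasure P] in
theorem integrable_covariate {h : 𝒱 → ℝ} (hh : Measurable h) :
    Integrable h P.snd ↔ Integrable (fun p => h p.2) P :=
  integrable_map_measure hh.aestronglyMeasurable measurable_snd.aemeasurable

theorem integral_comp_labelled {φ : (Fin n → 𝒳 × 𝒱) → ℝ}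
    (hφ : AEStronglyMeasurable φ (Measure.pi fun _ => P)) :
    ∫ d, φ d.1 ∂(groupLaw P ρ n m) = ∫ w, φ w ∂(Measure.pi fun _ => P) := by
  have h := measurePreserving_labelled (P := P) (ρ := ρ) (n := n) (m := m)
  rw [← h.map_eq, integral_map h.measurable.aemeasurable (by rwa [h.map_eq])]

theorem integral_comp_unlabelled {φ : (Fin m → 𝒱) → ℝ}
    (hφ : AEStronglyMeasurable φ (Measure.pi fun _ => P.snd)) :
    ∫ d, φ d.2.1 ∂(groupLaw P ρ n m) = ∫ w, φ w ∂(Measure.pi fun _ => P.snd) := by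
  have h := measurePreserving_unlabelled (P := P) (ρ := ρ) (n := n) (m := m)
  rw [← h.map_eq, integral_map h.measurable.aemeasurable (by rwa [h.map_eq])]

variable {f : 𝒳 → ℝ} {g : 𝒱 → ℝ} {c δ s₁ s₂ b : ℝ}

/-- The oracle estimate of `σ₁²`. -/
def oracleSq₁ (f : 𝒳 → ℝ) (g : 𝒱 → ℝ) (d : GroupSample 𝒳 𝒱 S n m) : ℝ :=
  sigmaSqHat₁ (fun i => f (d.1 i).1) (fun i => g (d.1 i).2)

/-- The oracle estimate of `σ₂²`. -/
def oracleSq₂ (g : 𝒱 → ℝ) (d : GroupSample 𝒳 𝒱 S n m) : ℝ :=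
  sigmaSqHat₂ (fun i => g (d.1 i).2) (fun j => g (d.2.1 j))

omit [MeasurableSpace 𝒳] [MeasurableSpace 𝒱] [MeasurableSpace S] in
theorem oracleSq₁_sub_eq (hn : 0 < n) (s : ℝ) (d : GroupSample 𝒳 𝒱 S n m) :
    oracleSq₁ f g d - s = (n : ℝ)⁻¹ * ∑ i, ((f (d.1 i).1 - g (d.1 i).2) ^ 2 - s) := by
  have : (n : ℝ) ≠ 0 := by positivity
  rw [oracleSq₁, sigmaSqHat₁, Finset.sum_sub_distrib]
  simp
  field_simp

theorem integrable_oracleSq₁_sub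
    (hD : Decomposition P (fun p => f p.1 - g p.2) (fun p => g p.2 - c) δ s₁ s₂ b) (hn : 0 < n) :
    Integrable (fun d => oracleSq₁ f g d - s₁) (groupLaw P ρ n m) := by
  simp_rw [oracleSq₁_sub_eq hn]
  refine Integrable.const_mul ?_ _
  exact measurePreserving_labelled.integrable_comp_of_integrable
    (integrable_sum_comp_eval n (hD.integrable_sq₁.sub (integrable_const s₁)))

theorem integral_abs_oracleSq₁_sub_le
    (hD : Decomposition P (fun p => f p.1 - g p.2) (fun p => g p.2 - c) δ s₁ s₂ b) (hδ : 0 < δ)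
    {η β : ℝ} (hη : 0 < η) (hn : 0 < n) (hβ : b * √(n : ℝ) ^ (-δ) ≤ β) (hβ0 : 0 ≤ β) :
    ∫ d, |oracleSq₁ f g d - s₁| ∂(groupLaw P ρ n m) ≤ s₁ * llnError δ η β := by
  have hn' : (0 : ℝ) < n := by exact_mod_cast hn
  have hi : Integrable (fun w : Fin n → 𝒳 × 𝒱 => |∑ i, ((f (w i).1 - g (w i).2) ^ 2 - s₁)|)
      (Measure.pi fun _ => P) :=
    (integrable_sum_comp_eval (ψ := fun p : 𝒳 × 𝒱 => (f p.1 - g p.2) ^ 2 - s₁) n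
      (hD.integrable_sq₁.sub (integrable_const s₁))).abs
  have he : ∀ d : GroupSample 𝒳 𝒱 S n m, |oracleSq₁ f g d - s₁|
      = (n : ℝ)⁻¹ * |∑ i, ((f (d.1 i).1 - g (d.1 i).2) ^ 2 - s₁)| := fun d => by
    rw [oracleSq₁_sub_eq hn, abs_mul, abs_of_pos (inv_pos.2 hn')]
  simp_rw [he]
  rw [integral_const_mul, integral_comp_labelled hi.aestronglyMeasurable]
  have h := integral_abs_sum_sq_sub_le_llnError hδ hη hD.pos₁ hD.measurable₁ hD.integrable_rpow₁
    hD.integral_sq₁ hD.integral_rpow₁ n hn' le_rfl hβ hβ0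
  calc (n : ℝ)⁻¹ * _ ≤ (n : ℝ)⁻¹ * (n * s₁ * llnError δ η β) := by gcongr
    _ = _ := by field_simp

omit [MeasurableSpace 𝒳] [MeasurableSpace 𝒱] [MeasurableSpace S] in
theorem oracleSq₂_sub_eq (hn : 0 < n) (c s : ℝ) (d : GroupSample 𝒳 𝒱 S n m) :
    oracleSq₂ g d - s = ((n : ℝ) + m)⁻¹ * (∑ i, ((g (d.1 i).2 - c) ^ 2 - s)
        + ∑ j, ((g (d.2.1 j) - c) ^ 2 - s))
      - (((n : ℝ) + m)⁻¹ * (∑ i, (g (d.1 i).2 - c) + ∑ j, (g (d.2.1 j) - c))) ^ 2 := by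
  have hN : (n : ℝ) + m ≠ 0 := by positivity
  set e := pooledMean (fun i => g (d.1 i).2) (fun j => g (d.2.1 j)) with he
  have he' : ∑ i, g (d.1 i).2 + ∑ j, g (d.2.1 j) = (n + m) * e := by
    rw [he, pooledMean]; field_simp
  have h1 : ∀ x : ℝ, (x - e) ^ 2 = (x - c) ^ 2 - 2 * (e - c) * x + (e ^ 2 - c ^ 2) :=
    fun x => by ring
  rw [oracleSq₂, sigmaSqHat₂, ← he]
  simp only [h1, Finset.sum_add_distrib, Finset.sum_sub_distrib, ← Finset.mul_sum]
  simp only [Finset.sum_const, Finset.card_univ, Fintype.card_fin, nsmul_eq_mul]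
  field_simp
  have e1 : ∑ j, g (d.2.1 j) = (n + m) * e - ∑ i, g (d.1 i).2 := by linarith
  rw [e1]
  ring

theorem Decomposition.nonneg {α : Type*} [MeasurableSpace α] {P : Measure α} {ε γ : α → ℝ}
    (hD : Decomposition P ε γ δ s₁ s₂ b) : 0 ≤ b := by
  have h : 0 ≤ b * √s₁ ^ (2 + δ) :=
    (integral_nonneg fun p => by positivity).trans hD.integral_rpow₁
  exact nonneg_of_mul_nonneg_left h (Real.rpow_pos_of_pos (Real.sqrt_pos.2 hD.pos₁) _)

/-- The laws of large numbers behind `oracleSq₂`, for the labelled and the unlabelled covariates. -/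
theorem integral_abs_oracleSq₂_sub_le (hg : Measurable g)
    (hD : Decomposition P (fun p => f p.1 - g p.2) (fun p => g p.2 - c) δ s₁ s₂ b) (hδ : 0 < δ)
    {η β : ℝ} (hη : 0 < η) (hn : 0 < n) (hβ : b * √(n : ℝ) ^ (-δ) ≤ β) :
    Integrable (fun d => oracleSq₂ g d - s₂) (groupLaw P ρ n m) ∧
    ∫ d, |oracleSq₂ g d - s₂| ∂(groupLaw P ρ n m) ≤ s₂ * (2 * llnError δ η β + 2 / n) := by
  have hn' : (0 : ℝ) < n := by exact_mod_cast hn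
  have hN : (0 : ℝ) < n + m := by positivity
  have hnN : (n : ℝ) ≤ n + m := by simp
  have hb := hD.nonneg
  have hβ0 : 0 ≤ β := le_trans (by positivity) hβ
  have hβN : b * √((n : ℝ) + m) ^ (-δ) ≤ β := by
    refine le_trans ?_ hβ
    gcongr b * ?_
    exact Real.rpow_le_rpow_of_nonpos (Real.sqrt_pos.2 hn') (Real.sqrt_le_sqrt hnN) (by linarith)
  have hgm : Measurable fun v => g v - c := hg.sub_const c
  have hgv : Measurable fun v => (g v - c) ^ 2 := hgm.pow_const 2
  have hgq : Measurable fun v => |g v - c| ^ (2 + δ) := hgm.abs.pow_const _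
  -- the four sums
  set A : GroupSample 𝒳 𝒱 S n m → ℝ := fun d => ∑ i, ((g (d.1 i).2 - c) ^ 2 - s₂) with hA
  set B : GroupSample 𝒳 𝒱 S n m → ℝ := fun d => ∑ j, ((g (d.2.1 j) - c) ^ 2 - s₂) with hB
  set A' : GroupSample 𝒳 𝒱 S n m → ℝ := fun d => ∑ i, (g (d.1 i).2 - c) with hA'
  set B' : GroupSample 𝒳 𝒱 S n m → ℝ := fun d => ∑ j, (g (d.2.1 j) - c) with hB'
  have hsqV : Integrable (fun v => (g v - c) ^ 2) P.snd :=
    (integrable_covariate hgv).2 hD.integrable_sq₂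
  have hwA : Integrable (fun w : Fin n → 𝒳 × 𝒱 => ∑ i, ((g (w i).2 - c) ^ 2 - s₂))
      (Measure.pi fun _ => P) :=
    integrable_sum_comp_eval (ψ := fun p : 𝒳 × 𝒱 => (g p.2 - c) ^ 2 - s₂) n
      (hD.integrable_sq₂.sub (integrable_const s₂))
  have hwB : Integrable (fun w : Fin m → 𝒱 => ∑ j, ((g (w j) - c) ^ 2 - s₂))
      (Measure.pi fun _ => P.snd) :=
    integrable_sum_comp_eval (ψ := fun v => (g v - c) ^ 2 - s₂) m
      (hsqV.sub (integrable_const s₂))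
  have hiA : Integrable A (groupLaw P ρ n m) :=
    measurePreserving_labelled.integrable_comp_of_integrable hwA
  have hiB : Integrable B (groupLaw P ρ n m) :=
    measurePreserving_unlabelled.integrable_comp_of_integrable hwB
  have h2P : MemLp (fun p : 𝒳 × 𝒱 => g p.2 - c) 2 P :=
    (memLp_two_iff_integrable_sq hD.measurable₂.aestronglyMeasurable).2 hD.integrable_sq₂
  have h2V : MemLp (fun v => g v - c) 2 P.snd :=
    (memLp_two_iff_integrable_sq hgm.aestronglyMeasurable).2 hsqV
  have hwA' : Integrable (fun w : Fin n → 𝒳 × 𝒱 => (∑ i, (g (w i).2 - c)) ^ 2)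
      (Measure.pi fun _ => P) := (memLp_sum_comp_eval n h2P).integrable_sq
  have hwB' : Integrable (fun w : Fin m → 𝒱 => (∑ j, (g (w j) - c)) ^ 2)
      (Measure.pi fun _ => P.snd) := (memLp_sum_comp_eval m h2V).integrable_sq
  have hiA' : Integrable (fun d => A' d ^ 2) (groupLaw P ρ n m) :=
    measurePreserving_labelled.integrable_comp_of_integrable hwA'
  have hiB' : Integrable (fun d => B' d ^ 2) (groupLaw P ρ n m) :=
    measurePreserving_unlabelled.integrable_comp_of_integrable hwB'
  have hbA : ∫ d, |A d| ∂(groupLaw P ρ n m) ≤ (n + m) * s₂ * llnError δ η β := by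
    rw [hA, integral_comp_labelled hwA.abs.aestronglyMeasurable]
    exact integral_abs_sum_sq_sub_le_llnError hδ hη hD.pos₂ hD.measurable₂ hD.integrable_rpow₂
      hD.integral_sq₂ hD.integral_rpow₂ n hN hnN hβN hβ0
  have hbB : ∫ d, |B d| ∂(groupLaw P ρ n m) ≤ (n + m) * s₂ * llnError δ η β := by
    rw [hB, integral_comp_unlabelled hwB.abs.aestronglyMeasurable]
    exact integral_abs_sum_sq_sub_le_llnError hδ hη hD.pos₂ hgm
      ((integrable_covariate hgq).2 hD.integrable_rpow₂)
      ((integral_covariate hgv).trans hD.integral_sq₂)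
      ((integral_covariate hgq).trans_le hD.integral_rpow₂) m hN (by simp) hβN hβ0
  have hbA' : ∫ d, A' d ^ 2 ∂(groupLaw P ρ n m) = n * s₂ := by
    rw [hA', integral_comp_labelled hwA'.aestronglyMeasurable, ← hD.integral_sq₂]
    exact integral_sq_sum_comp_eval n h2P hD.integral₂
  have hbB' : ∫ d, B' d ^ 2 ∂(groupLaw P ρ n m) = m * s₂ := by
    rw [hB', integral_comp_unlabelled hwB'.aestronglyMeasurable, ← hD.integral_sq₂,
      ← integral_covariate hgv]
    exact integral_sq_sum_comp_eval m h2V ((integral_covariate hgm).trans hD.integral₂)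
  have heq : ∀ d, oracleSq₂ g d - s₂ = ((n : ℝ) + m)⁻¹ * (A d + B d)
      - (((n : ℝ) + m)⁻¹ * (A' d + B' d)) ^ 2 := fun d => oracleSq₂_sub_eq hn c s₂ d
  set R : GroupSample 𝒳 𝒱 S n m → ℝ := fun d => ((n : ℝ) + m)⁻¹ * (|A d| + |B d|)
      + 2 * (((n : ℝ) + m)⁻¹) ^ 2 * (A' d ^ 2 + B' d ^ 2) with hR
  have hle : ∀ d, |oracleSq₂ g d - s₂| ≤ R d := by
    intro d
    rw [heq, hR]
    refine (abs_sub _ _).trans ?_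
    rw [abs_mul, abs_of_pos (inv_pos.2 hN),
      abs_of_nonneg (sq_nonneg (((n : ℝ) + m)⁻¹ * (A' d + B' d)))]
    have h1 : (A' d + B' d) ^ 2 ≤ 2 * (A' d ^ 2 + B' d ^ 2) := by nlinarith [sq_nonneg (A' d - B' d)]
    have h2 : 0 ≤ (((n : ℝ) + m)⁻¹) ^ 2 := sq_nonneg _
    have h3 : ((n : ℝ) + m)⁻¹ * |A d + B d| ≤ ((n : ℝ) + m)⁻¹ * (|A d| + |B d|) := by
      gcongr; exact abs_add_le _ _
    rw [mul_pow]
    nlinarith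
  have hi1 : Integrable (fun d => |A d| + |B d|) (groupLaw P ρ n m) := hiA.abs.add hiB.abs
  have hi2 : Integrable (fun d => A' d ^ 2 + B' d ^ 2) (groupLaw P ρ n m) := hiA'.add hiB'
  have hiR : Integrable R (groupLaw P ρ n m) := (hi1.const_mul _).add (hi2.const_mul _)
  have hgl : Measurable fun d : GroupSample 𝒳 𝒱 S n m => oracleSq₂ g d - s₂ := by
    unfold oracleSq₂ sigmaSqHat₂ pooledMean
    fun_prop
  refine ⟨hiR.mono' hgl.aestronglyMeasurable (Eventually.of_forall hle), ?_⟩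
  refine (integral_mono_of_nonneg (Eventually.of_forall fun d => abs_nonneg _) hiR
    (Eventually.of_forall hle)).trans ?_
  rw [hR, integral_add (hi1.const_mul _) (hi2.const_mul _), integral_const_mul,
    integral_const_mul, integral_add hiA.abs hiB.abs, integral_add hiA' hiB', hbA', hbB']
  have hs2 := hD.pos₂
  calc _ ≤ ((n : ℝ) + m)⁻¹ * ((n + m) * s₂ * llnError δ η β + (n + m) * s₂ * llnError δ η β)
        + 2 * (((n : ℝ) + m)⁻¹) ^ 2 * (n * s₂ + m * s₂) := by gcongr
    _ = s₂ * (2 * llnError δ η β + 2 / (n + m)) := by field_simp; ring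
    _ ≤ _ := by gcongr

end

/-! ### Asymptotic normality of the oracle mean estimate -/

theorem mul_sqrt_div_rpow {δ N s : ℝ} (hN : 0 < N) (b : ℝ) :
    N * (b * (√s / N) ^ (2 + δ)) = b * √N ^ (-δ) * √(s / N) ^ (2 + δ) := by
  have hr : 0 < √N := Real.sqrt_pos.2 hN
  have h1 : √s / N = √(s / N) / √N := by
    rw [Real.sqrt_div' _ hN.le, div_div, Real.mul_self_sqrt hN.le]
  have h2 : √N ^ (2 + δ) * √N ^ (-δ) = N := by
    rw [← Real.rpow_add hr, show 2 + δ + -δ = (2 : ℝ) by ring, Real.rpow_two, Real.sq_sqrt hN.le]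
  rw [h1, Real.div_rpow (Real.sqrt_nonneg _) hr.le]
  have h3 : √N ^ (2 + δ) ≠ 0 := (Real.rpow_pos_of_pos hr _).ne'
  field_simp
  linear_combination -(b * √(s / N) ^ (2 + δ)) * h2

section

variable {𝒳 𝒱 S : Type*} [MeasurableSpace 𝒳] [MeasurableSpace 𝒱] [MeasurableSpace S]
  {P : Measure (𝒳 × 𝒱)} [IsProbabilityMeasure P] {ρ : Measure S} [IsProbabilityMeasure ρ]
  {n m : ℕ} {f : 𝒳 → ℝ} {g : 𝒱 → ℝ} {c δ s₁ s₂ b : ℝ}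

/-- The oracle estimate of `E f(X)`. -/
def oracleMean (f : 𝒳 → ℝ) (g : 𝒱 → ℝ) (d : GroupSample 𝒳 𝒱 S n m) : ℝ :=
  muHat (fun i => f (d.1 i).1) (fun i => g (d.1 i).2) (fun j => g (d.2.1 j))

omit [MeasurableSpace 𝒳] [MeasurableSpace 𝒱] [MeasurableSpace S] in
theorem oracleMean_sub_eq (hn : 0 < n) (c : ℝ) (d : GroupSample 𝒳 𝒱 S n m) :
    oracleMean f g d - c
      = ∑ i, ((f (d.1 i).1 - g (d.1 i).2) / n + (g (d.1 i).2 - c) / ((n : ℝ) + m))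
        + ∑ j, (g (d.2.1 j) - c) / ((n : ℝ) + m) := by
  have hN : (n : ℝ) + m ≠ 0 := by positivity
  rw [oracleMean, muHat]
  simp only [Finset.sum_add_distrib, ← Finset.sum_div, Finset.sum_sub_distrib]
  simp only [Finset.sum_const, Finset.card_univ, Fintype.card_fin, nsmul_eq_mul]
  field_simp
  ring

theorem integral_cexp_oracleMean (hn : 0 < n) (u c : ℝ) :
    ∫ d, Complex.exp (Complex.I * (u * (oracleMean f g d - c) : ℝ)) ∂(groupLaw P ρ n m)
      = (∫ p, Complex.exp (Complex.I * (u * ((f p.1 - g p.2) / n + (g p.2 - c) / ((n : ℝ) + m)) : ℝ))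
          ∂P) ^ n
        * (∫ v, Complex.exp (Complex.I * (u * ((g v - c) / ((n : ℝ) + m)) : ℝ)) ∂P.snd) ^ m := by
  have h1 : ∀ d : GroupSample 𝒳 𝒱 S n m,
      Complex.exp (Complex.I * (u * (oracleMean f g d - c) : ℝ))
      = (∏ i, Complex.exp (Complex.I *
          (u * ((f (d.1 i).1 - g (d.1 i).2) / n + (g (d.1 i).2 - c) / ((n : ℝ) + m)) : ℝ)))
        * ∏ j, Complex.exp (Complex.I * (u * ((g (d.2.1 j) - c) / ((n : ℝ) + m)) : ℝ)) := by
    intro d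
    rw [oracleMean_sub_eq hn, ← Complex.exp_sum, ← Complex.exp_sum, ← Complex.exp_add,
      ← Finset.mul_sum, ← Finset.mul_sum, ← mul_add, mul_add u, Finset.mul_sum, Finset.mul_sum]
    push_cast
    rfl
  simp_rw [h1]
  unfold groupLaw
  have h2 := integral_prod_mul (μ := Measure.pi fun _ : Fin n => P)
    (ν := (Measure.pi fun _ : Fin m => P.snd).prod (ρ.prod ρ))
    (fun w => ∏ i, Complex.exp (Complex.I *
          (u * ((f (w i).1 - g (w i).2) / n + (g (w i).2 - c) / ((n : ℝ) + m)) : ℝ)))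
    (fun w => ∏ j, Complex.exp (Complex.I * (u * ((g (w.1 j) - c) / ((n : ℝ) + m)) : ℝ)))
  rw [h2, integral_fintype_prod_eq_pow (fun p : 𝒳 × 𝒱 => Complex.exp (Complex.I *
          (u * ((f p.1 - g p.2) / n + (g p.2 - c) / ((n : ℝ) + m)) : ℝ))),
    integral_fun_fst (fun w : Fin m → 𝒱 =>
      ∏ j, Complex.exp (Complex.I * (u * ((g (w j) - c) / ((n : ℝ) + m)) : ℝ))),
    integral_fintype_prod_eq_pow (fun v : 𝒱 =>
      Complex.exp (Complex.I * (u * ((g v - c) / ((n : ℝ) + m)) : ℝ)))]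
  simp

/-- The characteristic function of the centred oracle mean estimate is close to that of the normal
law with variance `s₁ / n + s₂ / (n + m)`. -/
theorem norm_integral_cexp_oracleMean_sub_le (hg : Measurable g)
    (hD : Decomposition P (fun p => f p.1 - g p.2) (fun p => g p.2 - c) δ s₁ s₂ b) (hδ : 0 < δ)
    {η β : ℝ} (hη : 0 < η) (hn : 0 < n) (hβ : b * √(n : ℝ) ^ (-δ) ≤ β) (u : ℝ) {σ2 Λ : ℝ}
    (hσ : σ2 = s₁ / n + s₂ / ((n : ℝ) + m))
    (hΛ : Λ = 2 * 2 ^ (2 + δ) * β * (|u| * √σ2) ^ (2 + δ)) :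
    ‖∫ d, Complex.exp (Complex.I * (u * (oracleMean f g d - c) : ℝ)) ∂(groupLaw P ρ n m)
        - Complex.exp (-(u ^ 2 * σ2 : ℝ) / 2)‖
      ≤ (3 * η + η ^ 2 + η ^ (-δ) * Λ) * (u ^ 2 * σ2) + 6 * η ^ (-δ) * Λ := by
  have hn' : (0 : ℝ) < n := by exact_mod_cast hn
  have hN : (0 : ℝ) < n + m := by positivity
  have hnN : (n : ℝ) ≤ n + m := by simp
  have hb := hD.nonneg
  have hs1 := hD.pos₁
  have hs2 := hD.pos₂
  have hq : 0 < 2 + δ := by linarith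
  have hβN : b * √((n : ℝ) + m) ^ (-δ) ≤ β := by
    refine le_trans ?_ hβ
    gcongr b * ?_
    exact Real.rpow_le_rpow_of_nonpos (Real.sqrt_pos.2 hn') (Real.sqrt_le_sqrt hnN) (by linarith)
  have hβ0 : 0 ≤ β := le_trans (by positivity) hβ
  set N : ℝ := (n : ℝ) + m with hNdef
  set ε : 𝒳 × 𝒱 → ℝ := fun p => f p.1 - g p.2 with hε
  set γ : 𝒳 × 𝒱 → ℝ := fun p => g p.2 - c with hγ
  set a₁ : 𝒳 × 𝒱 → ℝ := fun p => u * (ε p / n + γ p / N) with ha₁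
  set a₂ : 𝒱 → ℝ := fun v => u * ((g v - c) / N) with ha₂
  have hγm : Measurable fun v => g v - c := hg.sub_const c
  have hm₁ : Measurable a₁ := ((hD.measurable₁.div_const _).add (hD.measurable₂.div_const _)).const_mul u
  have hm₂ : Measurable a₂ := (hγm.div_const _).const_mul u
  have hε2 : MemLp ε 2 P :=
    (memLp_two_iff_integrable_sq hD.measurable₁.aestronglyMeasurable).2 hD.integrable_sq₁
  have hγ2 : MemLp γ 2 P :=
    (memLp_two_iff_integrable_sq hD.measurable₂.aestronglyMeasurable).2 hD.integrable_sq₂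
  have hεγ : Integrable (fun p => ε p * γ p) P := hε2.integrable_mul hγ2
  -- the second moments
  have hsq : ∀ p, a₁ p ^ 2 = u ^ 2 * (ε p ^ 2 / n ^ 2 + γ p ^ 2 / N ^ 2
      + 2 / (n * N) * (ε p * γ p)) := fun p => by rw [ha₁]; field_simp; ring
  have hi12 : Integrable (fun p => ε p ^ 2 / (n : ℝ) ^ 2 + γ p ^ 2 / N ^ 2) P :=
    (hD.integrable_sq₁.div_const _).add (hD.integrable_sq₂.div_const _)
  have hi1 : Integrable (fun p => a₁ p ^ 2) P := by
    simp_rw [hsq]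
    exact (hi12.add (hεγ.const_mul _)).const_mul _
  have hv1 : ∫ p, a₁ p ^ 2 ∂P = u ^ 2 * (s₁ / n ^ 2 + s₂ / N ^ 2) := by
    simp_rw [hsq]
    rw [integral_const_mul, integral_add hi12 (hεγ.const_mul _),
      integral_add (hD.integrable_sq₁.div_const _) (hD.integrable_sq₂.div_const _),
      integral_const_mul, hD.integral_mul, integral_div, integral_div, hD.integral_sq₁,
      hD.integral_sq₂]
    ring
  have hsq2 : ∀ v, a₂ v ^ 2 = u ^ 2 / N ^ 2 * (g v - c) ^ 2 := fun v => by
    rw [ha₂]; field_simp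
  have hi2 : Integrable (fun v => a₂ v ^ 2) P.snd := by
    simp_rw [hsq2]
    exact ((integrable_covariate (hγm.pow_const 2)).2 hD.integrable_sq₂).const_mul _
  have hv2 : ∫ v, a₂ v ^ 2 ∂P.snd = u ^ 2 * (s₂ / N ^ 2) := by
    simp_rw [hsq2]
    rw [integral_const_mul, integral_covariate (hγm.pow_const 2), hD.integral_sq₂]
    ring
  -- the means
  have h01 : ∫ p, a₁ p ∂P = 0 := by
    rw [ha₁, integral_const_mul, integral_add ((hε2.integrable one_le_two).div_const _)
      ((hγ2.integrable one_le_two).div_const _), integral_div, integral_div, hD.integral₁,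
      hD.integral₂]
    simp
  have h02 : ∫ v, a₂ v ∂P.snd = 0 := by
    rw [ha₂, integral_const_mul, integral_div, integral_covariate hγm, hD.integral₂]
    simp
  -- the moments of order `2 + δ`
  have hpt : ∀ p, |a₁ p| ^ (2 + δ) ≤ |u| ^ (2 + δ) * (2 ^ (2 + δ) * ((1 / (n : ℝ)) ^ (2 + δ)
      * |ε p| ^ (2 + δ) + (1 / N) ^ (2 + δ) * |γ p| ^ (2 + δ))) := by
    intro p
    rw [ha₁, abs_mul, Real.mul_rpow (abs_nonneg _) (abs_nonneg _)]
    gcongr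
    refine (abs_add_rpow_le hq.le _ _).trans_eq ?_
    rw [← Real.mul_rpow (by positivity) (abs_nonneg _),
      ← Real.mul_rpow (by positivity) (abs_nonneg _), abs_div, abs_div, abs_of_pos hn',
      abs_of_pos hN, one_div_mul_eq_div, one_div_mul_eq_div]
  have hiB : Integrable (fun p => |u| ^ (2 + δ) * (2 ^ (2 + δ) * ((1 / (n : ℝ)) ^ (2 + δ)
      * |ε p| ^ (2 + δ) + (1 / N) ^ (2 + δ) * |γ p| ^ (2 + δ)))) P :=
    (((hD.integrable_rpow₁.const_mul _).add (hD.integrable_rpow₂.const_mul _)).const_mul _).const_mul _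
  have hiq1 : Integrable (fun p => |a₁ p| ^ (2 + δ)) P :=
    hiB.mono' (hm₁.abs.pow_const _).aestronglyMeasurable (Eventually.of_forall fun p => by
      rw [Real.norm_of_nonneg (by positivity)]; exact hpt p)
  have hdiv : ∀ {x y : ℝ}, 0 < y → (√x / y) ^ (2 + δ) = (1 / y) ^ (2 + δ) * √x ^ (2 + δ) := by
    intro x y hy
    rw [← Real.mul_rpow (by positivity) (Real.sqrt_nonneg _), one_div_mul_eq_div]
  have hL1 : ∫ p, |a₁ p| ^ (2 + δ) ∂P ≤ |u| ^ (2 + δ) * (2 ^ (2 + δ) *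
      (b * (√s₁ / n) ^ (2 + δ) + b * (√s₂ / N) ^ (2 + δ))) := by
    refine (integral_mono hiq1 hiB hpt).trans ?_
    rw [integral_const_mul, integral_const_mul,
      integral_add (hD.integrable_rpow₁.const_mul _) (hD.integrable_rpow₂.const_mul _),
      integral_const_mul, integral_const_mul, hdiv hn', hdiv hN]
    have e1 := hD.integral_rpow₁
    have e2 := hD.integral_rpow₂
    calc _ ≤ |u| ^ (2 + δ) * (2 ^ (2 + δ) * ((1 / (n : ℝ)) ^ (2 + δ) * (b * √s₁ ^ (2 + δ))
          + (1 / N) ^ (2 + δ) * (b * √s₂ ^ (2 + δ)))) := by gcongr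
      _ = _ := by ring
  have hpt2 : ∀ v, |a₂ v| ^ (2 + δ) = |u| ^ (2 + δ) * (1 / N) ^ (2 + δ) * |g v - c| ^ (2 + δ) := by
    intro v
    rw [ha₂, abs_mul, abs_div, abs_of_pos hN, ← one_div_mul_eq_div,
      Real.mul_rpow (abs_nonneg _) (by positivity), Real.mul_rpow (by positivity) (abs_nonneg _),
      mul_assoc]
  have hiq2 : Integrable (fun v => |a₂ v| ^ (2 + δ)) P.snd := by
    simp_rw [hpt2]
    exact ((integrable_covariate (hγm.abs.pow_const _)).2 hD.integrable_rpow₂).const_mul _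
  have hL2 : ∫ v, |a₂ v| ^ (2 + δ) ∂P.snd ≤ |u| ^ (2 + δ) * (b * (√s₂ / N) ^ (2 + δ)) := by
    simp_rw [hpt2]
    rw [integral_const_mul, integral_covariate (hγm.abs.pow_const _), hdiv hN]
    have e2 := hD.integral_rpow₂
    calc _ ≤ |u| ^ (2 + δ) * (1 / N) ^ (2 + δ) * (b * √s₂ ^ (2 + δ)) := by gcongr
      _ = _ := by ring
  -- both Lyapunov sums are at most `Λ`
  have hσ1 : s₁ / n ≤ σ2 := by rw [hσ]; linarith [div_pos hs2 hN]
  have hσ2 : s₂ / N ≤ σ2 := by rw [hσ]; linarith [div_pos hs1 hn']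
  have hK1 : n * (b * (√s₁ / n) ^ (2 + δ)) ≤ β * √σ2 ^ (2 + δ) := by
    rw [mul_sqrt_div_rpow hn']; gcongr
  have hK2 : N * (b * (√s₂ / N) ^ (2 + δ)) ≤ β * √σ2 ^ (2 + δ) := by
    rw [mul_sqrt_div_rpow hN]; gcongr
  have h2q : (1 : ℝ) ≤ 2 ^ (2 + δ) := Real.one_le_rpow (by norm_num) hq.le
  rw [Real.mul_rpow (abs_nonneg u) (Real.sqrt_nonneg _)] at hΛ
  have hΛ1 : n * ∫ p, |a₁ p| ^ (2 + δ) ∂P ≤ Λ := by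
    calc n * ∫ p, |a₁ p| ^ (2 + δ) ∂P ≤ n * (|u| ^ (2 + δ) * (2 ^ (2 + δ) *
          (b * (√s₁ / n) ^ (2 + δ) + b * (√s₂ / N) ^ (2 + δ)))) := by gcongr
      _ = |u| ^ (2 + δ) * 2 ^ (2 + δ) *
          (n * (b * (√s₁ / n) ^ (2 + δ)) + n * (b * (√s₂ / N) ^ (2 + δ))) := by ring
      _ ≤ |u| ^ (2 + δ) * 2 ^ (2 + δ) * (β * √σ2 ^ (2 + δ) + β * √σ2 ^ (2 + δ)) := by
          exact mul_le_mul_of_nonneg_left (add_le_add hK1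
            ((mul_le_mul_of_nonneg_right hnN (by positivity)).trans hK2)) (by positivity)
      _ = Λ := by rw [hΛ]; ring
  have hΛ2 : m * ∫ v, |a₂ v| ^ (2 + δ) ∂P.snd ≤ Λ := by
    calc m * ∫ v, |a₂ v| ^ (2 + δ) ∂P.snd ≤ N * (|u| ^ (2 + δ) * (b * (√s₂ / N) ^ (2 + δ))) := by
          gcongr; rw [hNdef]; linarith
      _ = |u| ^ (2 + δ) * (N * (b * (√s₂ / N) ^ (2 + δ))) := by ring
      _ ≤ |u| ^ (2 + δ) * (β * √σ2 ^ (2 + δ)) := by gcongr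
      _ = 1 * (β * |u| ^ (2 + δ) * √σ2 ^ (2 + δ)) := by ring
      _ ≤ (2 * 2 ^ (2 + δ)) * (β * |u| ^ (2 + δ) * √σ2 ^ (2 + δ)) := by gcongr; linarith
      _ = Λ := by rw [hΛ]; ring
  have hB1 := norm_integral_cexp_pow_sub_le hδ hη hm₁.aestronglyMeasurable hi1 hiq1 h01 n hΛ1
  have hB2 := norm_integral_cexp_pow_sub_le hδ hη hm₂.aestronglyMeasurable hi2 hiq2 h02 m hΛ2
  have hvar : n * ∫ p, a₁ p ^ 2 ∂P + m * ∫ v, a₂ v ^ 2 ∂P.snd = u ^ 2 * σ2 := by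
    rw [hv1, hv2, hσ]
    have hm : (m : ℝ) = N - n := by rw [hNdef]; ring
    rw [hm]
    field_simp
    ring
  have hexp : Complex.exp (-(u ^ 2 * σ2 : ℝ) / 2)
      = Complex.exp (-(n * ∫ p, a₁ p ^ 2 ∂P : ℝ) / 2)
        * Complex.exp (-(m * ∫ v, a₂ v ^ 2 ∂P.snd : ℝ) / 2) := by
    rw [← hvar, ← Complex.exp_add]
    congr 1
    push_cast
    ring
  have hone : ‖Complex.exp (-(m * ∫ v, a₂ v ^ 2 ∂P.snd : ℝ) / 2)‖ ≤ 1 := by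
    have h0 : 0 ≤ m * ∫ v, a₂ v ^ 2 ∂P.snd := by
      have : 0 ≤ ∫ v, a₂ v ^ 2 ∂P.snd := integral_nonneg fun v => sq_nonneg _
      positivity
    have hc : (-(m * ∫ v, a₂ v ^ 2 ∂P.snd : ℝ) / 2 : ℂ)
        = ((-(m * ∫ v, a₂ v ^ 2 ∂P.snd) / 2 : ℝ) : ℂ) := by push_cast; ring
    rw [hc, Complex.norm_exp, Complex.ofReal_re, Real.exp_le_one_iff]
    linarith
  rw [integral_cexp_oracleMean hn, hexp]
  refine (norm_mul_sub_mul_le ?_ hone).trans ((add_le_add hB1 hB2).trans_eq ?_)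
  · rw [norm_pow]
    exact pow_le_one₀ (norm_nonneg _) (norm_integral_cexp_le_one a₁)
  · rw [← hvar]; ring

end

/-! ### The two folds -/

/-- The entries of a tuple at the even positions `0, 2, …`, which carry the odd indices. -/
def takeEvenPos {β : Type*} {n : ℕ} (w : Fin n → β) : Fin (n / 2) → β :=
  fun j => w ⟨2 * j, by omega⟩

/-- The entries of a tuple at the odd positions `1, 3, …`, which carry the even indices. -/
def takeOddPos {β : Type*} {n : ℕ} (w : Fin n → β) : Fin (n / 2) → β :=
  fun j => w ⟨2 * j + 1, by omega⟩

/-- The positions below an even number, split by parity. -/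
def parityEquiv {n : ℕ} (hn : Even n) : Fin (n / 2) ⊕ Fin (n / 2) ≃ Fin n where
  toFun := Sum.elim (fun j => ⟨2 * j, by omega⟩) (fun j => ⟨2 * j + 1, by omega⟩)
  invFun i := if i.1 % 2 = 0 then Sum.inl ⟨i / 2, by have := hn.two_dvd; omega⟩
    else Sum.inr ⟨i / 2, by have := hn.two_dvd; omega⟩
  left_inv := by
    rintro (j | j)
    · simp
    · have h : (2 * (j : ℕ) + 1) % 2 = 1 := by omega
      have h' : (2 * (j : ℕ) + 1) / 2 = j := by omega
      simp [h, h']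
  right_inv i := by
    by_cases h : i.1 % 2 = 0
    · simp only [h, if_true, Sum.elim_inl]
      ext; simp only; omega
    · simp only [h, if_false, Sum.elim_inr]
      ext; simp only; omega

theorem sum_eq_sum_parity {n : ℕ} (hn : Even n) (φ : Fin n → ℝ) :
    ∑ i, φ i = ∑ j : Fin (n / 2), φ ⟨2 * j, by omega⟩
      + ∑ j : Fin (n / 2), φ ⟨2 * j + 1, by omega⟩ := by
  rw [← (parityEquiv hn).sum_comp, Fintype.sum_sum_type]
  rfl

theorem measurePreserving_parity {β : Type*} [MeasurableSpace β] (ν : Measure β) [SigmaFinite ν]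
    {n : ℕ} (hn : Even n) :
    MeasurePreserving (fun w : Fin n → β => (takeEvenPos w, takeOddPos w))
      (Measure.pi fun _ => ν) ((Measure.pi fun _ => ν).prod (Measure.pi fun _ => ν)) :=
  (measurePreserving_sumPiEquivProdPi (X := fun _ : Fin (n / 2) ⊕ Fin (n / 2) => β)
    fun _ => ν).comp
    ((measurePreserving_piCongrLeft (α := fun _ : Fin n => β) (fun _ => ν) (parityEquiv hn)).symm)

section

variable {A B C D : Type*} [MeasurableSpace A] [MeasurableSpace B] [MeasurableSpace C]
  [MeasurableSpace D]

theorem measurePreserving_prodComm_assoc (a : Measure A) (b : Measure B) (c : Measure C)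
    (d : Measure D) [SigmaFinite a] [SigmaFinite b] [SigmaFinite c] [SigmaFinite d] :
    MeasurePreserving (fun x : (A × B) × (C × D) => ((x.2.2, x.1.1), (x.1.2, x.2.1)))
      ((a.prod b).prod (c.prod d)) ((d.prod a).prod (b.prod c)) := by
  have h1 := measurePreserving_prodAssoc (a.prod b) c d
  have h2 := measurePreserving_prodAssoc a b c
  have h3 : MeasurePreserving Prod.swap ((a.prod (b.prod c)).prod d) (d.prod (a.prod (b.prod c))) :=
    Measure.measurePreserving_swap
  have h4 := measurePreserving_prodAssoc d a (b.prod c)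
  exact ((h4.symm).comp (h3.comp ((h2.prod (MeasurePreserving.id d)).comp h1.symm)))

end

section

variable {𝒳 𝒱 S : Type*} [MeasurableSpace 𝒳] [MeasurableSpace 𝒱] [MeasurableSpace S]
  {n m : ℕ}

/-- The law of a seed, a training fold, and the labelled and unlabelled covariates at which the
trained estimator is evaluated. -/
def foldLaw (P : Measure (𝒳 × 𝒱)) (ρ : Measure S) (n m : ℕ) :
    Measure ((S × (Fin (n / 2) → 𝒳 × 𝒱)) × ((Fin (n / 2) → 𝒳 × 𝒱) × (Fin (m / 2) → 𝒱))) :=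
  (ρ.prod (Measure.pi fun _ => P)).prod ((Measure.pi fun _ => P).prod (Measure.pi fun _ => P.snd))

/-- The data used by the estimator trained on the odd fold, evaluated at even indices. -/
def trainOdd (d : GroupSample 𝒳 𝒱 S n m) :
    (S × (Fin (n / 2) → 𝒳 × 𝒱)) × ((Fin (n / 2) → 𝒳 × 𝒱) × (Fin (m / 2) → 𝒱)) :=
  ((d.2.2.1, oddFold d.1), (evenFold d.1, takeOddPos d.2.1))

/-- The data used by the estimator trained on the even fold, evaluated at odd indices. -/
def trainEven (d : GroupSample 𝒳 𝒱 S n m) :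
    (S × (Fin (n / 2) → 𝒳 × 𝒱)) × ((Fin (n / 2) → 𝒳 × 𝒱) × (Fin (m / 2) → 𝒱)) :=
  ((d.2.2.2, evenFold d.1), (oddFold d.1, takeEvenPos d.2.1))

variable (P : Measure (𝒳 × 𝒱)) [IsProbabilityMeasure P] (ρ : Measure S) [IsProbabilityMeasure ρ]

instance : IsProbabilityMeasure (foldLaw P ρ n m) := by
  unfold foldLaw; infer_instance

theorem measurePreserving_trainOdd (hn : Even n) (hm : Even m) :
    MeasurePreserving trainOdd (groupLaw P ρ n m) (foldLaw P ρ n m) := by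
  have hU : MeasurePreserving (fun w : Fin m → 𝒱 => takeOddPos w) (Measure.pi fun _ => P.snd)
      (Measure.pi fun _ => P.snd) :=
    measurePreserving_snd.comp (measurePreserving_parity P.snd hm)
  have hS : MeasurePreserving (Prod.fst : S × S → S) (ρ.prod ρ) ρ := measurePreserving_fst
  exact (measurePreserving_prodComm_assoc _ _ _ _).comp
    ((measurePreserving_parity P hn).prod (hU.prod hS))

theorem measurePreserving_trainEven (hn : Even n) (hm : Even m) :
    MeasurePreserving trainEven (groupLaw P ρ n m) (foldLaw P ρ n m) := by
  have hU : MeasurePreserving (fun w : Fin m → 𝒱 => takeEvenPos w) (Measure.pi fun _ => P.snd)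
      (Measure.pi fun _ => P.snd) :=
    measurePreserving_fst.comp (measurePreserving_parity P.snd hm)
  have hS : MeasurePreserving (Prod.snd : S × S → S) (ρ.prod ρ) ρ := measurePreserving_snd
  have hL : MeasurePreserving (fun w : Fin n → 𝒳 × 𝒱 => (takeOddPos w, takeEvenPos w))
      (Measure.pi fun _ => P) ((Measure.pi fun _ => P).prod (Measure.pi fun _ => P)) :=
    Measure.measurePreserving_swap.comp (measurePreserving_parity P hn)
  exact (measurePreserving_prodComm_assoc _ _ _ _).comp (hL.prod (hU.prod hS))

end

/-! ### The effect of estimating the regression function -/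

section

variable {𝒳 𝒱 S : Type*} {n m : ℕ}

/-- The contribution of one fold to the error of the cross-fit mean estimate. -/
def foldMean (Δ : S → (Fin (n / 2) → 𝒳 × 𝒱) → 𝒱 → ℝ) (m : ℕ)
    (x : (S × (Fin (n / 2) → 𝒳 × 𝒱)) × ((Fin (n / 2) → 𝒳 × 𝒱) × (Fin (m / 2) → 𝒱))) : ℝ :=
  (∑ j, Δ x.1.1 x.1.2 (x.2.1 j).2) / n
    - (∑ j, Δ x.1.1 x.1.2 (x.2.1 j).2 + ∑ j, Δ x.1.1 x.1.2 (x.2.2 j)) / ((n : ℝ) + m)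

/-- The contribution of one fold to the mean squared estimation error at labelled covariates. -/
def foldSq₁ (Δ : S → (Fin (n / 2) → 𝒳 × 𝒱) → 𝒱 → ℝ) (m : ℕ)
    (x : (S × (Fin (n / 2) → 𝒳 × 𝒱)) × ((Fin (n / 2) → 𝒳 × 𝒱) × (Fin (m / 2) → 𝒱))) : ℝ :=
  (∑ j, Δ x.1.1 x.1.2 (x.2.1 j).2 ^ 2) / n

/-- The contribution of one fold to the mean squared estimation error at all covariates. -/
def foldSq₂ (Δ : S → (Fin (n / 2) → 𝒳 × 𝒱) → 𝒱 → ℝ) (m : ℕ)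
    (x : (S × (Fin (n / 2) → 𝒳 × 𝒱)) × ((Fin (n / 2) → 𝒳 × 𝒱) × (Fin (m / 2) → 𝒱))) : ℝ :=
  (∑ j, Δ x.1.1 x.1.2 (x.2.1 j).2 ^ 2 + ∑ j, Δ x.1.1 x.1.2 (x.2.2 j) ^ 2) / ((n : ℝ) + m)

/-- The error of the estimator of the regression function `g`. -/
def fitError (ghat : S → (Fin (n / 2) → 𝒳 × 𝒱) → 𝒱 → ℝ) (g : 𝒱 → ℝ) :
    S → (Fin (n / 2) → 𝒳 × 𝒱) → 𝒱 → ℝ := fun s T v => ghat s T v - g v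

variable (ghat : S → (Fin (n / 2) → 𝒳 × 𝒱) → 𝒱 → ℝ) (g : 𝒱 → ℝ)

/-- A sum over the labelled indices of a function of the fitting error splits over the folds. -/
theorem sum_labelled_eq (hn : Even n) (φ : ℝ → ℝ) (d : GroupSample 𝒳 𝒱 S n m) :
    ∑ i : Fin n, φ (crossFit ghat d (i + 1) (d.1 i).2 - g (d.1 i).2)
      = ∑ j, φ (fitError ghat g (trainOdd d).1.1 (trainOdd d).1.2 ((trainOdd d).2.1 j).2)
        + ∑ j, φ (fitError ghat g (trainEven d).1.1 (trainEven d).1.2 ((trainEven d).2.1 j).2) := by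
  rw [sum_eq_sum_parity hn, add_comm]
  congr 1
  · refine Finset.sum_congr rfl fun j _ => ?_
    have h : Even (2 * (j : ℕ) + 1 + 1) := ⟨j + 1, by ring⟩
    simp only [crossFit, h, if_true]
    rfl
  · refine Finset.sum_congr rfl fun j _ => ?_
    have h : ¬ Even (2 * (j : ℕ) + 1) := by simp
    simp only [crossFit, h, if_false]
    rfl

theorem sum_unlabelled_eq (hn : Even n) (hm : Even m) (φ : ℝ → ℝ) (d : GroupSample 𝒳 𝒱 S n m) :
    ∑ i : Fin m, φ (crossFit ghat d (n + i + 1) (d.2.1 i) - g (d.2.1 i))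
      = ∑ j, φ (fitError ghat g (trainOdd d).1.1 (trainOdd d).1.2 ((trainOdd d).2.2 j))
        + ∑ j, φ (fitError ghat g (trainEven d).1.1 (trainEven d).1.2 ((trainEven d).2.2 j)) := by
  rw [sum_eq_sum_parity hm, add_comm]
  congr 1
  · refine Finset.sum_congr rfl fun j _ => ?_
    have h : Even (n + (2 * (j : ℕ) + 1) + 1) := by
      rw [show n + (2 * (j : ℕ) + 1) + 1 = n + 2 * (j + 1) by ring]
      exact hn.add (even_two_mul _)
    simp only [crossFit, h, if_true]
    rfl
  · refine Finset.sum_congr rfl fun j _ => ?_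
    have h : ¬ Even (n + 2 * (j : ℕ) + 1) := by
      rw [Nat.not_even_iff_odd]
      exact (hn.add (even_two_mul _)).add_one
    simp only [crossFit, h, if_false]
    rfl

/-- The cross-fit mean estimate. -/
def crossMean (f : 𝒳 → ℝ) (d : GroupSample 𝒳 𝒱 S n m) : ℝ :=
  (groupEstimates f (crossFit ghat d) d).1

/-- In the labelled sum each fitting error enters with weight `-1 / n`, in the pooled mean with
weight `1 / (n + m)`, and the sums split over the folds. -/
theorem crossMean_sub_oracleMean (hn : Even n) (hm : Even m) (f : 𝒳 → ℝ)
    (d : GroupSample 𝒳 𝒱 S n m) :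
    crossMean ghat f d - oracleMean f g d
      = -(foldMean (fitError ghat g) m (trainOdd d)
        + foldMean (fitError ghat g) m (trainEven d)) := by
  have h1 := sum_labelled_eq ghat g hn (fun x => x) d
  have h2 := sum_unlabelled_eq ghat g hn hm (fun x => x) d
  simp only [Finset.sum_sub_distrib] at h1 h2
  simp only [crossMean, groupEstimates, oracleMean, muHat, foldMean, Finset.sum_sub_distrib]
  rw [sub_eq_iff_eq_add] at h1 h2
  rw [h1, h2]
  ring

/-- The mean squared estimation error at labelled covariates. -/
def crossSqError₁ (d : GroupSample 𝒳 𝒱 S n m) : ℝ :=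
  (∑ i : Fin n, (crossFit ghat d (i + 1) (d.1 i).2 - g (d.1 i).2) ^ 2) / n

/-- The mean squared estimation error at all covariates. -/
def crossSqError₂ (d : GroupSample 𝒳 𝒱 S n m) : ℝ :=
  (∑ i : Fin n, (crossFit ghat d (i + 1) (d.1 i).2 - g (d.1 i).2) ^ 2
    + ∑ j : Fin m, (crossFit ghat d (n + j + 1) (d.2.1 j) - g (d.2.1 j)) ^ 2) / ((n : ℝ) + m)

theorem crossSqError₁_eq (hn : Even n) (d : GroupSample 𝒳 𝒱 S n m) :
    crossSqError₁ ghat g d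
      = foldSq₁ (fitError ghat g) m (trainOdd d) + foldSq₁ (fitError ghat g) m (trainEven d) := by
  rw [crossSqError₁, sum_labelled_eq ghat g hn (fun x => x ^ 2) d, foldSq₁, foldSq₁, add_div]

theorem crossSqError₂_eq (hn : Even n) (hm : Even m) (d : GroupSample 𝒳 𝒱 S n m) :
    crossSqError₂ ghat g d
      = foldSq₂ (fitError ghat g) m (trainOdd d) + foldSq₂ (fitError ghat g) m (trainEven d) := by
  rw [crossSqError₂, sum_labelled_eq ghat g hn (fun x => x ^ 2) d,
    sum_unlabelled_eq ghat g hn hm (fun x => x ^ 2) d, foldSq₂, foldSq₂]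
  ring

end

/-! ### Moments of the contribution of one fold -/

section

variable {𝒳 𝒱 S : Type*} [MeasurableSpace 𝒳] [MeasurableSpace 𝒱] [MeasurableSpace S]
  {n m : ℕ} {P : Measure (𝒳 × 𝒱)} [IsProbabilityMeasure P]

theorem integral_prod_fst {A B : Type*} [MeasurableSpace A] [MeasurableSpace B] {a : Measure A}
    {b : Measure B} [IsProbabilityMeasure a] [IsProbabilityMeasure b] (φ : A → ℝ) :
    ∫ x, φ x.1 ∂(a.prod b) = ∫ x, φ x ∂a := by
  rw [integral_fun_fst]; simp

theorem integral_prod_snd {A B : Type*} [MeasurableSpace A] [MeasurableSpace B] {a : Measure A}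
    {b : Measure B} [IsProbabilityMeasure a] [IsProbabilityMeasure b] (φ : B → ℝ) :
    ∫ x, φ x.2 ∂(a.prod b) = ∫ x, φ x ∂b := by
  rw [integral_fun_snd]; simp

omit [IsProbabilityMeasure P] in
/-- For a nonnegative statistic `Z` and a measurable `h`, a bound on the expectation of `Z` by a
multiple of `E h(V)²` only has to be checked for square integrable `h`. -/
theorem lintegral_le_of_integrable_sq {Ω : Type*} [MeasurableSpace Ω] {μ : Measure Ω} {h : 𝒱 → ℝ}
    (hh : Measurable h) {Z : Ω → ℝ} (hZ : ∀ ω, 0 ≤ Z ω) {C : ℝ} (hC : 0 < C)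
    (H : Integrable (fun v => h v ^ 2) P.snd →
      Integrable Z μ ∧ ∫ ω, Z ω ∂μ ≤ C * ∫ v, h v ^ 2 ∂P.snd) :
    ∫⁻ ω, ENNReal.ofReal (Z ω) ∂μ
      ≤ ENNReal.ofReal C * ∫⁻ v, ENNReal.ofReal (h v ^ 2) ∂P.snd := by
  by_cases hi : Integrable (fun v => h v ^ 2) P.snd
  · obtain ⟨h1, h2⟩ := H hi
    rw [← ofReal_integral_eq_lintegral_ofReal h1 (Eventually.of_forall hZ),
      ← ofReal_integral_eq_lintegral_ofReal hi (Eventually.of_forall fun _ => sq_nonneg _),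
      ← ENNReal.ofReal_mul hC.le]
    exact ENNReal.ofReal_le_ofReal h2
  · have htop : ∫⁻ v, ENNReal.ofReal (h v ^ 2) ∂P.snd = ⊤ := by
      by_contra hne
      refine hi ⟨(hh.pow_const 2).aestronglyMeasurable, ?_⟩
      rw [hasFiniteIntegral_iff_ofReal (Eventually.of_forall fun _ => sq_nonneg _)]
      exact lt_top_iff_ne_top.2 hne
    rw [htop, ENNReal.mul_top (ENNReal.ofReal_pos.2 hC).ne']
    exact le_top

/-- The error of the mean estimate on one fold has mean zero given the training data, because the
proportion of labelled indices in the fold is the same as in the sample; hence it is of order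
`n ^ (-1/2)` times the estimation error. -/
theorem lintegral_foldMean_inner_le (hn : Even n) (hm : Even m) (hn0 : 0 < n) {h : 𝒱 → ℝ}
    (hh : Measurable h) :
    ∫⁻ y : (Fin (n / 2) → 𝒳 × 𝒱) × (Fin (m / 2) → 𝒱),
        ENNReal.ofReal (((∑ j, h (y.1 j).2) / n
          - (∑ j, h (y.1 j).2 + ∑ j, h (y.2 j)) / ((n : ℝ) + m)) ^ 2)
        ∂((Measure.pi fun _ => P).prod (Measure.pi fun _ => P.snd))
      ≤ ENNReal.ofReal (2 / n) * ∫⁻ v, ENNReal.ofReal (h v ^ 2) ∂P.snd := by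
  have hn' : (0 : ℝ) < n := by exact_mod_cast hn0
  have hN : (0 : ℝ) < n + m := by positivity
  refine lintegral_le_of_integrable_sq hh (fun _ => sq_nonneg _) (by positivity) fun hi => ?_
  have hp : ((n / 2 : ℕ) : ℝ) = n / 2 := by
    rw [Nat.cast_div hn.two_dvd (by norm_num)]; norm_num
  have hq : ((m / 2 : ℕ) : ℝ) = m / 2 := by
    rw [Nat.cast_div hm.two_dvd (by norm_num)]; norm_num
  set e := ∫ v, h v ∂P.snd with he
  have heP : ∫ p, h p.2 ∂P = e := (integral_covariate hh).symm
  have h2V : MemLp h 2 P.snd := (memLp_two_iff_integrable_sq hh.aestronglyMeasurable).2 hi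
  have h2P : MemLp (fun p : 𝒳 × 𝒱 => h p.2) 2 P :=
    h2V.comp_measurePreserving measurePreserving_covariate
  have hsq : ∫ p, h p.2 ^ 2 ∂P = ∫ v, h v ^ 2 ∂P.snd := (integral_covariate (hh.pow_const 2)).symm
  set M := ∫ v, h v ^ 2 ∂P.snd with hM
  have hM0 : 0 ≤ M := integral_nonneg fun _ => sq_nonneg _
  have hA := integral_sq_sum_sub_le (n / 2) h2P
  have hB := integral_sq_sum_sub_le (m / 2) h2V
  simp only [heP, hsq] at hA
  rw [← he, ← hM] at hB
  rw [hp] at hA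
  rw [hq] at hB
  have hiA : Integrable (fun w : Fin (n / 2) → 𝒳 × 𝒱 => (∑ j, (h (w j).2 - e)) ^ 2)
      (Measure.pi fun _ => P) :=
    (memLp_sum_comp_eval (ψ := fun p : 𝒳 × 𝒱 => h p.2 - e) _ (h2P.sub (memLp_const e))).integrable_sq
  have hiB : Integrable (fun w : Fin (m / 2) → 𝒱 => (∑ j, (h (w j) - e)) ^ 2)
      (Measure.pi fun _ => P.snd) :=
    (memLp_sum_comp_eval (ψ := fun v => h v - e) _ (h2V.sub (memLp_const e))).integrable_sq
  set μ := (Measure.pi fun _ : Fin (n / 2) => P).prod (Measure.pi fun _ : Fin (m / 2) => P.snd)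
    with hμ
  have hiA' : Integrable (fun y : (Fin (n / 2) → 𝒳 × 𝒱) × (Fin (m / 2) → 𝒱) =>
      (∑ j, (h (y.1 j).2 - e)) ^ 2) μ := hiA.comp_fst _
  have hiB' : Integrable (fun y : (Fin (n / 2) → 𝒳 × 𝒱) × (Fin (m / 2) → 𝒱) =>
      (∑ j, (h (y.2 j) - e)) ^ 2) μ := hiB.comp_snd _
  have hiR : Integrable (fun y : (Fin (n / 2) → 𝒳 × 𝒱) × (Fin (m / 2) → 𝒱) =>
      2 / (n : ℝ) ^ 2 * (∑ j, (h (y.1 j).2 - e)) ^ 2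
        + 2 / ((n : ℝ) + m) ^ 2 * (∑ j, (h (y.2 j) - e)) ^ 2) μ :=
    (hiA'.const_mul _).add (hiB'.const_mul _)
  have hle : ∀ y : (Fin (n / 2) → 𝒳 × 𝒱) × (Fin (m / 2) → 𝒱),
      ((∑ j, h (y.1 j).2) / n - (∑ j, h (y.1 j).2 + ∑ j, h (y.2 j)) / ((n : ℝ) + m)) ^ 2
      ≤ 2 / (n : ℝ) ^ 2 * (∑ j, (h (y.1 j).2 - e)) ^ 2
        + 2 / ((n : ℝ) + m) ^ 2 * (∑ j, (h (y.2 j) - e)) ^ 2 := by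
    intro y
    have e1 : ∑ j, (h (y.1 j).2 - e) = ∑ j, h (y.1 j).2 - n / 2 * e := by
      rw [Finset.sum_sub_distrib, ← hp]; simp
    have e2 : ∑ j, (h (y.2 j) - e) = ∑ j, h (y.2 j) - m / 2 * e := by
      rw [Finset.sum_sub_distrib, ← hq]; simp
    set a := ∑ j, (h (y.1 j).2 - e) with ha
    set b := ∑ j, (h (y.2 j) - e) with hb
    have e1' : ∑ j, h (y.1 j).2 = a + n / 2 * e := by rw [e1]; ring
    have e2' : ∑ j, h (y.2 j) = b + m / 2 * e := by rw [e2]; ring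
    -- the centring constants cancel
    have e3 : (a + n / 2 * e) / n - (a + n / 2 * e + (b + m / 2 * e)) / ((n : ℝ) + m)
        = (1 / n - 1 / (n + m)) * a - 1 / ((n : ℝ) + m) * b := by
      field_simp; ring
    rw [e1', e2', e3]
    have h1 : 0 ≤ 1 / (n : ℝ) - 1 / (n + m) := by
      rw [sub_nonneg]; gcongr; simp
    have h2 : 1 / (n : ℝ) - 1 / (n + m) ≤ 1 / n := by
      have : 0 < 1 / ((n : ℝ) + m) := by positivity
      linarith
    have h3 : (1 / (n : ℝ) - 1 / (n + m)) ^ 2 ≤ (1 / n) ^ 2 := by gcongr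
    have h4 : 2 / (n : ℝ) ^ 2 = 2 * (1 / n) ^ 2 := by field_simp
    have h5 : 2 / ((n : ℝ) + m) ^ 2 = 2 * (1 / (n + m)) ^ 2 := by field_simp
    rw [h4, h5]
    have h6 := mul_le_mul_of_nonneg_right h3 (sq_nonneg a)
    nlinarith [sq_nonneg ((1 / (n : ℝ) - 1 / (n + m)) * a + 1 / ((n : ℝ) + m) * b)]
  refine ⟨hiR.mono' (by fun_prop) (Eventually.of_forall fun y => ?_), ?_⟩
  · rw [Real.norm_of_nonneg (sq_nonneg _)]; exact hle y
  refine (integral_mono_of_nonneg (Eventually.of_forall fun y => sq_nonneg _) hiR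
    (Eventually.of_forall hle)).trans ?_
  rw [integral_add (hiA'.const_mul _) (hiB'.const_mul _), integral_const_mul, integral_const_mul,
    hμ, integral_prod_fst (fun w : Fin (n / 2) → 𝒳 × 𝒱 => (∑ j, (h (w j).2 - e)) ^ 2),
    integral_prod_snd (fun w : Fin (m / 2) → 𝒱 => (∑ j, (h (w j) - e)) ^ 2)]
  have h1 : 1 / ((n : ℝ) + m) ≤ 1 / n := by gcongr; simp
  calc _ ≤ 2 / (n : ℝ) ^ 2 * (n / 2 * M) + 2 / ((n : ℝ) + m) ^ 2 * (m / 2 * M) := by gcongr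
    _ ≤ 2 / (n : ℝ) ^ 2 * (n / 2 * M) + 2 / ((n : ℝ) + m) ^ 2 * ((n + m) / 2 * M) := by
        gcongr; simp
    _ = 1 / n * M + 1 / ((n : ℝ) + m) * M := by field_simp
    _ ≤ 1 / n * M + 1 / n * M := by gcongr
    _ = _ := by ring

theorem lintegral_foldSq_inner_le (hn : Even n) (hm : Even m) (hn0 : 0 < n) {h : 𝒱 → ℝ}
    (hh : Measurable h) :
    ∫⁻ y : (Fin (n / 2) → 𝒳 × 𝒱) × (Fin (m / 2) → 𝒱),
        ENNReal.ofReal ((∑ j, h (y.1 j).2 ^ 2) / n)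
        ∂((Measure.pi fun _ => P).prod (Measure.pi fun _ => P.snd))
      ≤ ENNReal.ofReal 1 * ∫⁻ v, ENNReal.ofReal (h v ^ 2) ∂P.snd ∧
    ∫⁻ y : (Fin (n / 2) → 𝒳 × 𝒱) × (Fin (m / 2) → 𝒱),
        ENNReal.ofReal ((∑ j, h (y.1 j).2 ^ 2 + ∑ j, h (y.2 j) ^ 2) / ((n : ℝ) + m))
        ∂((Measure.pi fun _ => P).prod (Measure.pi fun _ => P.snd))
      ≤ ENNReal.ofReal 1 * ∫⁻ v, ENNReal.ofReal (h v ^ 2) ∂P.snd := by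
  have hn' : (0 : ℝ) < n := by exact_mod_cast hn0
  have hp : ((n / 2 : ℕ) : ℝ) = n / 2 := by
    rw [Nat.cast_div hn.two_dvd (by norm_num)]; norm_num
  have hq : ((m / 2 : ℕ) : ℝ) = m / 2 := by
    rw [Nat.cast_div hm.two_dvd (by norm_num)]; norm_num
  have hM0 : 0 ≤ ∫ v, h v ^ 2 ∂P.snd := integral_nonneg fun _ => sq_nonneg _
  have hiL (hi : Integrable (fun v => h v ^ 2) P.snd) :
      Integrable (fun w : Fin (n / 2) → 𝒳 × 𝒱 => ∑ j, h (w j).2 ^ 2) (Measure.pi fun _ => P) :=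
    integrable_sum_comp_eval (ψ := fun p : 𝒳 × 𝒱 => h p.2 ^ 2) _
      ((integrable_covariate (hh.pow_const 2)).1 hi)
  have hiU (hi : Integrable (fun v => h v ^ 2) P.snd) :
      Integrable (fun w : Fin (m / 2) → 𝒱 => ∑ j, h (w j) ^ 2) (Measure.pi fun _ => P.snd) :=
    integrable_sum_comp_eval (ψ := fun v => h v ^ 2) _ hi
  have heL (hi : Integrable (fun v => h v ^ 2) P.snd) :
      ∫ w : Fin (n / 2) → 𝒳 × 𝒱, ∑ j, h (w j).2 ^ 2 ∂(Measure.pi fun _ => P)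
        = n / 2 * ∫ v, h v ^ 2 ∂P.snd := by
    rw [integral_sum_comp_eval (ψ := fun p : 𝒳 × 𝒱 => h p.2 ^ 2) _
      ((integrable_covariate (hh.pow_const 2)).1 hi), hp, integral_covariate (hh.pow_const 2)]
  have heU (hi : Integrable (fun v => h v ^ 2) P.snd) :
      ∫ w : Fin (m / 2) → 𝒱, ∑ j, h (w j) ^ 2 ∂(Measure.pi fun _ => P.snd)
        = m / 2 * ∫ v, h v ^ 2 ∂P.snd := by
    rw [integral_sum_comp_eval (ψ := fun v => h v ^ 2) _ hi, hq]
  constructor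
  · refine lintegral_le_of_integrable_sq hh
      (fun y => div_nonneg (Finset.sum_nonneg fun _ _ => sq_nonneg _) hn'.le) one_pos fun hi => ?_
    refine ⟨((hiL hi).comp_fst _).div_const _, ?_⟩
    rw [integral_div, integral_prod_fst (fun w : Fin (n / 2) → 𝒳 × 𝒱 => ∑ j, h (w j).2 ^ 2),
      heL hi, div_le_iff₀ hn']
    nlinarith
  · refine lintegral_le_of_integrable_sq hh
      (fun y => div_nonneg (add_nonneg (Finset.sum_nonneg fun _ _ => sq_nonneg _)
        (Finset.sum_nonneg fun _ _ => sq_nonneg _)) (by positivity)) one_pos fun hi => ?_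
    refine ⟨(((hiL hi).comp_fst _).add ((hiU hi).comp_snd _)).div_const _, ?_⟩
    rw [integral_div, integral_add ((hiL hi).comp_fst _) ((hiU hi).comp_snd _),
      integral_prod_fst (fun w : Fin (n / 2) → 𝒳 × 𝒱 => ∑ j, h (w j).2 ^ 2),
      integral_prod_snd (fun w : Fin (m / 2) → 𝒱 => ∑ j, h (w j) ^ 2),
      heL hi, heU hi, div_le_iff₀ (by positivity)]
    have : (0 : ℝ) ≤ m := m.cast_nonneg
    nlinarith

variable {ρ : Measure S}

/-- The mean squared error of a fitted function, over seed, training sample and a new covariate. -/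
def fitRisk (P : Measure (𝒳 × 𝒱)) (ρ : Measure S) (Δ : S → (Fin (n / 2) → 𝒳 × 𝒱) → 𝒱 → ℝ) :
    ℝ≥0∞ :=
  ∫⁻ z, ∫⁻ v, ENNReal.ofReal (Δ z.1 z.2 v ^ 2) ∂P.snd ∂(ρ.prod (Measure.pi fun _ => P))

theorem l2Risk_eq_fitRisk {f : 𝒳 → ℝ} {g : 𝒱 → ℝ}
    (hfg : (fun p : 𝒳 × 𝒱 => g p.2) =ᵐ[P] condMean P f)
    {ghat : S → (Fin (n / 2) → 𝒳 × 𝒱) → 𝒱 → ℝ}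
    (hΔ : Measurable fun q : S × (Fin (n / 2) → 𝒳 × 𝒱) × 𝒱 => fitError ghat g q.1 q.2.1 q.2.2) :
    l2Risk P ρ f ghat = fitRisk P ρ (fitError ghat g) := by
  have hcomp : Measurable fun q : S × (Fin (n / 2) → 𝒳 × 𝒱) × (𝒳 × 𝒱) =>
      ENNReal.ofReal (fitError ghat g q.1 q.2.1 q.2.2.2 ^ 2) :=
    ((hΔ.comp (measurable_fst.prodMk ((measurable_fst.comp measurable_snd).prodMk
      (measurable_snd.comp (measurable_snd.comp measurable_snd))))).pow_const 2).ennreal_ofReal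
  have hae : ∀ᵐ q ∂(ρ.prod ((Measure.pi fun _ : Fin (n / 2) => P).prod P)),
      condMean P f q.2.2 = g q.2.2.2 :=
    ((Measure.quasiMeasurePreserving_snd.comp Measure.quasiMeasurePreserving_snd).ae hfg).mono
      fun _ h => h.symm
  have h1 : l2Risk P ρ f ghat = ∫⁻ q, ENNReal.ofReal (fitError ghat g q.1 q.2.1 q.2.2.2 ^ 2)
      ∂(ρ.prod ((Measure.pi fun _ : Fin (n / 2) => P).prod P)) := by
    refine lintegral_congr_ae (hae.mono fun q hq => ?_)
    simp only [hq]
    rfl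
  rw [h1, ← (measurePreserving_prodAssoc ρ (Measure.pi fun _ : Fin (n / 2) => P) P).lintegral_comp
    hcomp]
  refine (lintegral_prod (fun a : (S × (Fin (n / 2) → 𝒳 × 𝒱)) × (𝒳 × 𝒱) =>
    ENNReal.ofReal (fitError ghat g a.1.1 a.1.2 a.2.2 ^ 2))
    (hcomp.comp MeasurableEquiv.prodAssoc.measurable).aemeasurable).trans ?_
  rw [fitRisk]
  refine lintegral_congr fun z => ?_
  have hz : Measurable fun v => ENNReal.ofReal (fitError ghat g z.1 z.2 v ^ 2) :=
    ((hΔ.comp (measurable_const.prodMk (measurable_const.prodMk measurable_id))).pow_const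
      2).ennreal_ofReal
  exact measurePreserving_covariate.lintegral_comp hz

theorem lintegral_foldLaw_le {Δ : S → (Fin (n / 2) → 𝒳 × 𝒱) → 𝒱 → ℝ} {C : ℝ}
    {φ : (S × (Fin (n / 2) → 𝒳 × 𝒱)) × ((Fin (n / 2) → 𝒳 × 𝒱) × (Fin (m / 2) → 𝒱)) → ℝ}
    (hφ : Measurable φ)
    (h : ∀ z, ∫⁻ y, ENNReal.ofReal (φ (z, y))
      ∂((Measure.pi fun _ => P).prod (Measure.pi fun _ => P.snd))
        ≤ ENNReal.ofReal C * ∫⁻ v, ENNReal.ofReal (Δ z.1 z.2 v ^ 2) ∂P.snd) :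
    ∫⁻ x, ENNReal.ofReal (φ x) ∂(foldLaw P ρ n m) ≤ ENNReal.ofReal C * fitRisk P ρ Δ := by
  rw [foldLaw, lintegral_prod _ hφ.ennreal_ofReal.aemeasurable, fitRisk,
    ← lintegral_const_mul' _ _ ENNReal.ofReal_ne_top]
  exact lintegral_mono h

variable {Δ : S → (Fin (n / 2) → 𝒳 × 𝒱) → 𝒱 → ℝ}

theorem measurable_foldMean (hΔ : Measurable fun q : S × (Fin (n / 2) → 𝒳 × 𝒱) × 𝒱 =>
    Δ q.1 q.2.1 q.2.2) : Measurable (foldMean Δ m) ∧ Measurable (foldSq₁ Δ m) ∧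
      Measurable (foldSq₂ Δ m) := by
  have h1 (j : Fin (n / 2)) : Measurable
      fun x : (S × (Fin (n / 2) → 𝒳 × 𝒱)) × ((Fin (n / 2) → 𝒳 × 𝒱) × (Fin (m / 2) → 𝒱)) =>
        Δ x.1.1 x.1.2 (x.2.1 j).2 :=
    hΔ.comp (by fun_prop : Measurable fun x : (S × (Fin (n / 2) → 𝒳 × 𝒱)) ×
      ((Fin (n / 2) → 𝒳 × 𝒱) × (Fin (m / 2) → 𝒱)) => (x.1.1, x.1.2, (x.2.1 j).2))
  have h2 (j : Fin (m / 2)) : Measurable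
      fun x : (S × (Fin (n / 2) → 𝒳 × 𝒱)) × ((Fin (n / 2) → 𝒳 × 𝒱) × (Fin (m / 2) → 𝒱)) =>
        Δ x.1.1 x.1.2 (x.2.2 j) :=
    hΔ.comp (by fun_prop : Measurable fun x : (S × (Fin (n / 2) → 𝒳 × 𝒱)) ×
      ((Fin (n / 2) → 𝒳 × 𝒱) × (Fin (m / 2) → 𝒱)) => (x.1.1, x.1.2, x.2.2 j))
  refine ⟨?_, ?_, ?_⟩
  · unfold foldMean; fun_prop
  · unfold foldSq₁; fun_prop
  · unfold foldSq₂; fun_prop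

theorem measurable_section (hΔ : Measurable fun q : S × (Fin (n / 2) → 𝒳 × 𝒱) × 𝒱 =>
    Δ q.1 q.2.1 q.2.2) (z : S × (Fin (n / 2) → 𝒳 × 𝒱)) : Measurable (Δ z.1 z.2) :=
  hΔ.comp (measurable_const.prodMk (measurable_const.prodMk measurable_id))

theorem lintegral_foldMean_sq_le (hn : Even n) (hm : Even m) (hn0 : 0 < n)
    (hΔ : Measurable fun q : S × (Fin (n / 2) → 𝒳 × 𝒱) × 𝒱 => Δ q.1 q.2.1 q.2.2) :
    ∫⁻ x, ENNReal.ofReal (foldMean Δ m x ^ 2) ∂(foldLaw P ρ n m)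
      ≤ ENNReal.ofReal (2 / n) * fitRisk P ρ Δ :=
  lintegral_foldLaw_le (φ := fun x => foldMean Δ m x ^ 2) ((measurable_foldMean hΔ).1.pow_const 2)
    fun z => by
      simp only [foldMean]
      exact lintegral_foldMean_inner_le hn hm hn0 (measurable_section hΔ z)

theorem lintegral_foldSq₁_le (hn : Even n) (hm : Even m) (hn0 : 0 < n)
    (hΔ : Measurable fun q : S × (Fin (n / 2) → 𝒳 × 𝒱) × 𝒱 => Δ q.1 q.2.1 q.2.2) :
    ∫⁻ x, ENNReal.ofReal (foldSq₁ Δ m x) ∂(foldLaw P ρ n m)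
      ≤ ENNReal.ofReal 1 * fitRisk P ρ Δ :=
  lintegral_foldLaw_le (measurable_foldMean hΔ).2.1 fun z =>
    (lintegral_foldSq_inner_le hn hm hn0
      (measurable_section hΔ z)).1

theorem lintegral_foldSq₂_le (hn : Even n) (hm : Even m) (hn0 : 0 < n)
    (hΔ : Measurable fun q : S × (Fin (n / 2) → 𝒳 × 𝒱) × 𝒱 => Δ q.1 q.2.1 q.2.2) :
    ∫⁻ x, ENNReal.ofReal (foldSq₂ Δ m x) ∂(foldLaw P ρ n m)
      ≤ ENNReal.ofReal 1 * fitRisk P ρ Δ :=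
  lintegral_foldLaw_le (measurable_foldMean hΔ).2.2 fun z =>
    (lintegral_foldSq_inner_le hn hm hn0
      (measurable_section hΔ z)).2

end

/-! ### The cross-fit variance estimate -/

/-- Young's inequality for the cross term of a perturbed square. -/
theorem abs_sq_sub_sub_sq_le {η : ℝ} (hη : 0 < η) (a e : ℝ) :
    |(a - e) ^ 2 - a ^ 2| ≤ η * a ^ 2 + (1 + 1 / η) * e ^ 2 := by
  have h1 : 0 ≤ (η * a - e) ^ 2 / η := by positivity
  have h2 : 0 ≤ (η * a + e) ^ 2 / η := by positivity
  have e1 : (η * a - e) ^ 2 / η = η * a ^ 2 - 2 * a * e + 1 / η * e ^ 2 := by field_simp; ring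
  have e2 : (η * a + e) ^ 2 / η = η * a ^ 2 + 2 * a * e + 1 / η * e ^ 2 := by field_simp; ring
  rw [e1] at h1
  rw [e2] at h2
  rw [abs_le]
  constructor <;> nlinarith [sq_nonneg e]

theorem abs_sum_sq_sub_sub_le {ι : Type*} (s : Finset ι) {η : ℝ} (hη : 0 < η) (a e : ι → ℝ) :
    |∑ i ∈ s, (a i - e i) ^ 2 - ∑ i ∈ s, a i ^ 2|
      ≤ η * ∑ i ∈ s, a i ^ 2 + (1 + 1 / η) * ∑ i ∈ s, e i ^ 2 := by
  rw [← Finset.sum_sub_distrib, Finset.mul_sum, Finset.mul_sum, ← Finset.sum_add_distrib]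
  exact (Finset.abs_sum_le_sum_abs _ _).trans
    (Finset.sum_le_sum fun i _ => abs_sq_sub_sub_sq_le hη _ _)

section

variable {n m : ℕ}

theorem abs_sigmaSqHat₁_sub_le {η : ℝ} (hη : 0 < η) (y h h' : Fin n → ℝ) :
    |sigmaSqHat₁ y h' - sigmaSqHat₁ y h|
      ≤ η * sigmaSqHat₁ y h + (1 + 1 / η) * ((∑ i, (h' i - h i) ^ 2) / n) := by
  have hn : (0 : ℝ) ≤ n := n.cast_nonneg
  have h1 := abs_sum_sq_sub_sub_le Finset.univ hη (fun i => y i - h i) (fun i => h' i - h i)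
  have h2 : ∀ i, y i - h i - (h' i - h i) = y i - h' i := fun i => by ring
  simp only [h2] at h1
  rw [sigmaSqHat₁, sigmaSqHat₁, ← sub_div, abs_div, abs_of_nonneg hn, ← mul_div_assoc,
    ← mul_div_assoc, ← add_div]
  exact div_le_div_of_nonneg_right h1 hn

/-- Centring at the pooled mean does not increase the sum of squares. -/
theorem sum_sq_sub_pooledMean_le (hn : 0 < n) (h : Fin n → ℝ) (u : Fin m → ℝ) :
    ∑ i, (h i - pooledMean h u) ^ 2 + ∑ j, (u j - pooledMean h u) ^ 2
      ≤ ∑ i, h i ^ 2 + ∑ j, u j ^ 2 := by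
  have hN : (0 : ℝ) < n + m := by positivity
  set e := pooledMean h u with he
  have he' : ∑ i, h i + ∑ j, u j = (n + m) * e := by
    rw [he, pooledMean]; field_simp
  have h1 : ∀ x : ℝ, (x - e) ^ 2 = x ^ 2 - 2 * e * x + e ^ 2 := fun x => by ring
  simp only [h1, Finset.sum_add_distrib, Finset.sum_sub_distrib, ← Finset.mul_sum]
  simp only [Finset.sum_const, Finset.card_univ, Fintype.card_fin, nsmul_eq_mul]
  have h2 : 0 ≤ (n + m) * e ^ 2 := by positivity
  have h3 : 2 * e * ∑ i, h i + 2 * e * ∑ j, u j = 2 * ((n + m) * e ^ 2) := by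
    rw [← mul_add, he']; ring
  linarith

theorem abs_sigmaSqHat₂_sub_le {η : ℝ} (hη : 0 < η) (hn : 0 < n) (h h' : Fin n → ℝ)
    (u u' : Fin m → ℝ) :
    |sigmaSqHat₂ h' u' - sigmaSqHat₂ h u| ≤ η * sigmaSqHat₂ h u
      + (1 + 1 / η) * ((∑ i, (h' i - h i) ^ 2 + ∑ j, (u' j - u j) ^ 2) / ((n : ℝ) + m)) := by
  have hN : (0 : ℝ) < n + m := by positivity
  set a := pooledMean h u with ha
  set e := pooledMean (fun i => h' i - h i) (fun j => u' j - u j) with he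
  have hae : pooledMean h' u' = a + e := by
    rw [ha, he, pooledMean, pooledMean, pooledMean, Finset.sum_sub_distrib, Finset.sum_sub_distrib]
    ring
  have h1 := abs_sum_sq_sub_sub_le Finset.univ hη (fun i => h i - a)
    (fun i => -(h' i - h i - e))
  have h2 := abs_sum_sq_sub_sub_le Finset.univ hη (fun j => u j - a)
    (fun j => -(u' j - u j - e))
  have e1 : ∀ i, h i - a - -(h' i - h i - e) = h' i - (a + e) := fun i => by ring
  have e2 : ∀ j, u j - a - -(u' j - u j - e) = u' j - (a + e) := fun j => by ring
  simp only [e1, e2, neg_sq] at h1 h2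
  have h3 := sum_sq_sub_pooledMean_le hn (fun i => h' i - h i) (fun j => u' j - u j)
  rw [← he] at h3
  rw [sigmaSqHat₂, sigmaSqHat₂, hae, ← ha, ← sub_div, abs_div, abs_of_pos hN, ← mul_div_assoc,
    ← mul_div_assoc, ← add_div]
  refine div_le_div_of_nonneg_right ?_ hN.le
  have h4 : 0 ≤ 1 + 1 / η := by positivity
  have h5 := mul_le_mul_of_nonneg_left h3 h4
  have h6 := abs_add_le
    (∑ i, (h' i - (a + e)) ^ 2 - ∑ i, (h i - a) ^ 2)
    (∑ j, (u' j - (a + e)) ^ 2 - ∑ j, (u j - a) ^ 2)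
  rw [show ∑ i, (h' i - (a + e)) ^ 2 - ∑ i, (h i - a) ^ 2
      + (∑ j, (u' j - (a + e)) ^ 2 - ∑ j, (u j - a) ^ 2)
      = ∑ i, (h' i - (a + e)) ^ 2 + ∑ j, (u' j - (a + e)) ^ 2
        - (∑ i, (h i - a) ^ 2 + ∑ j, (u j - a) ^ 2) by ring] at h6
  rw [mul_add] at h5 ⊢
  linarith

/-- A relative perturbation bound: `o` close to `s` and `x` close to `o` up to `η o + D`. -/
theorem abs_sub_le_of_perturbation {η s v o x D C : ℝ} (hη : 0 < η) (hs : 0 < s) (hv : 0 < v)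
    (hvs : v ≤ s) (hC : 0 ≤ C) (hD : 0 ≤ D) (h : |x - o| ≤ η * o + C * D) :
    |x - s| ≤ s * (η + ((1 + η) * |o / s - 1| + C * (D / v))) := by
  have h1 : s * |o / s - 1| = |o - s| := by
    rw [← abs_of_pos hs, ← abs_mul, abs_of_pos hs]; congr 1; field_simp
  have h2 : C * D ≤ s * (C * (D / v)) := by
    have : C * D = v * (C * (D / v)) := by field_simp
    rw [this]; gcongr
  have h3 : |x - s| ≤ |x - o| + |o - s| := abs_sub_le _ _ _
  have h4 : o ≤ |o - s| + s := by linarith [le_abs_self (o - s)]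
  have h5 : s * (η + ((1 + η) * |o / s - 1| + C * (D / v)))
      = η * s + (1 + η) * (s * |o / s - 1|) + s * (C * (D / v)) := by ring
  rw [h5, h1]
  nlinarith

end

section

variable {𝒳 𝒱 S : Type*} {n m : ℕ} (ghat : S → (Fin (n / 2) → 𝒳 × 𝒱) → 𝒱 → ℝ) (g : 𝒱 → ℝ)

/-- The cross-fit variance estimate. -/
def crossVar (f : 𝒳 → ℝ) (d : GroupSample 𝒳 𝒱 S n m) : ℝ :=
  (groupEstimates f (crossFit ghat d) d).2

theorem abs_crossVar_div_sub_one_le {η s₁ s₂ v σ2 : ℝ} (hη : 0 < η) (hn : 0 < n) (hv : 0 < v)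
    (h₁ : v ≤ s₁) (h₂ : v ≤ s₂) (hσ : σ2 = s₁ / n + s₂ / ((n : ℝ) + m)) (f : 𝒳 → ℝ)
    (d : GroupSample 𝒳 𝒱 S n m) :
    |crossVar ghat f d / σ2 - 1| ≤ η + ((1 + η) * (|oracleSq₁ f g d / s₁ - 1|
      + |oracleSq₂ g d / s₂ - 1|) + (1 + 1 / η) * (crossSqError₁ ghat g d / v
      + crossSqError₂ ghat g d / v)) := by
  have hn' : (0 : ℝ) < n := by exact_mod_cast hn
  have hN : (0 : ℝ) < n + m := by positivity
  have hs1 := hv.trans_le h₁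
  have hs2 := hv.trans_le h₂
  have hC : 0 ≤ 1 + 1 / η := by positivity
  have hD1 : 0 ≤ crossSqError₁ ghat g d :=
    div_nonneg (Finset.sum_nonneg fun _ _ => sq_nonneg _) hn'.le
  have hD2 : 0 ≤ crossSqError₂ ghat g d :=
    div_nonneg (add_nonneg (Finset.sum_nonneg fun _ _ => sq_nonneg _)
      (Finset.sum_nonneg fun _ _ => sq_nonneg _)) hN.le
  have hσ0 : 0 < σ2 := by rw [hσ]; positivity
  have b1 := abs_sub_le_of_perturbation hη hs1 hv h₁ hC hD1
    (abs_sigmaSqHat₁_sub_le hη (fun i => f (d.1 i).1) (fun i => g (d.1 i).2)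
      (fun i => crossFit ghat d (i + 1) (d.1 i).2))
  have b2 := abs_sub_le_of_perturbation hη hs2 hv h₂ hC hD2
    (abs_sigmaSqHat₂_sub_le hη hn (fun i => g (d.1 i).2)
      (fun i => crossFit ghat d (i + 1) (d.1 i).2) (fun j => g (d.2.1 j))
      (fun j : Fin m => crossFit ghat d (n + j + 1) (d.2.1 j)))
  change |_ - s₁| ≤ s₁ * (η + ((1 + η) * |oracleSq₁ f g d / s₁ - 1| + _)) at b1
  change |_ - s₂| ≤ s₂ * (η + ((1 + η) * |oracleSq₂ g d / s₂ - 1| + _)) at b2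
  set x₁ := sigmaSqHat₁ (fun i => f (d.1 i).1) (fun i => crossFit ghat d (i + 1) (d.1 i).2)
  set x₂ := sigmaSqHat₂ (fun i : Fin n => crossFit ghat d (i + 1) (d.1 i).2)
    (fun j : Fin m => crossFit ghat d (n + j + 1) (d.2.1 j))
  have hx : crossVar ghat f d = x₁ / n + x₂ / ((n : ℝ) + m) := rfl
  set A := |oracleSq₁ f g d / s₁ - 1|
  set B := |oracleSq₂ g d / s₂ - 1|
  set D := crossSqError₁ ghat g d / v
  set E := crossSqError₂ ghat g d / v
  have hA : 0 ≤ A := abs_nonneg _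
  have hB : 0 ≤ B := abs_nonneg _
  have hD : 0 ≤ D := div_nonneg hD1 hv.le
  have hE : 0 ≤ E := div_nonneg hD2 hv.le
  set K := η + ((1 + η) * (A + B) + (1 + 1 / η) * (D + E)) with hK
  have c1 : |x₁ - s₁| ≤ s₁ * K := b1.trans (by
    rw [hK]
    have := mul_nonneg hη.le hB
    have := mul_nonneg hC hE
    gcongr <;> nlinarith)
  have c2 : |x₂ - s₂| ≤ s₂ * K := b2.trans (by
    rw [hK]
    have := mul_nonneg hη.le hA
    have := mul_nonneg hC hD
    gcongr <;> nlinarith)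
  have h1 : crossVar ghat f d / σ2 - 1 = ((x₁ - s₁) / n + (x₂ - s₂) / ((n : ℝ) + m)) / σ2 := by
    rw [hx, eq_div_iff hσ0.ne', sub_mul, div_mul_cancel₀ _ hσ0.ne', hσ]; ring
  rw [h1, abs_div, abs_of_pos hσ0, div_le_iff₀ hσ0]
  calc |(x₁ - s₁) / n + (x₂ - s₂) / ((n : ℝ) + m)|
      ≤ |x₁ - s₁| / n + |x₂ - s₂| / ((n : ℝ) + m) := by
        refine (abs_add_le _ _).trans_eq ?_
        rw [abs_div, abs_div, abs_of_pos hn', abs_of_pos hN]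
    _ ≤ s₁ * K / n + s₂ * K / ((n : ℝ) + m) := by gcongr
    _ = K * σ2 := by rw [hσ]; ring

end

/-! ### Asymptotics of one group along a sequence -/

/-- A sequence of groups satisfying the moment condition and the consistency condition for a fixed
function `f`, in terms of a version `g` of the regression function. Here `c k` is the mean of `f`,
`s₁ k` and `s₂ k` are the two variance components, and `b k` bounds the relative moments of order
`2 + δ`. -/
structure AsymptoticGroup {𝒳 𝒱 S : ℕ → Type*} [∀ k, MeasurableSpace (𝒳 k)]
    [∀ k, MeasurableSpace (𝒱 k)] [∀ k, MeasurableSpace (S k)] (P : ∀ k, Measure (𝒳 k × 𝒱 k))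
    (ρ : ∀ k, Measure (S k)) (n m : ℕ → ℕ) (f : ∀ k, 𝒳 k → ℝ) (g : ∀ k, 𝒱 k → ℝ)
    (ghat : ∀ k, S k → (Fin (n k / 2) → 𝒳 k × 𝒱 k) → 𝒱 k → ℝ) (c s₁ s₂ b : ℕ → ℝ) (δ : ℝ) :
    Prop where
  even₁ : ∀ k, Even (n k)
  even₂ : ∀ k, Even (m k)
  tendsto : Tendsto n atTop atTop
  delta_pos : 0 < δ
  measurable : ∀ k, Measurable (g k)
  measurable_fitError : ∀ k, Measurable fun q : S k × (Fin (n k / 2) → 𝒳 k × 𝒱 k) × 𝒱 k =>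
    fitError (ghat k) (g k) q.1 q.2.1 q.2.2
  decomposition : ∀ᶠ k in atTop, Decomposition (P k) (fun p => f k p.1 - g k p.2)
    (fun p => g k p.2 - c k) δ (s₁ k) (s₂ k) (b k)
  moment : Tendsto (fun k => b k * √(n k : ℝ) ^ (-δ)) atTop (𝓝 0)
  risk : Tendsto (fun k => fitRisk (P k) (ρ k) (fitError (ghat k) (g k))
    / ENNReal.ofReal (min (s₁ k) (s₂ k))) atTop (𝓝 0)

theorem exists_llnError_eq {δ : ℝ} {β : ℕ → ℝ} (hβ : Tendsto β atTop (𝓝 0)) {η : ℝ}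
    (hη : 0 < η) : ∃ y : ℕ → ℝ, Tendsto y atTop (𝓝 0) ∧
      ∀ k, llnError δ (η ^ 2) (β k) = η + y k := by
  refine ⟨fun k => 2 * (η ^ (-δ) * β k), ?_, fun k => ?_⟩
  · simpa using (hβ.const_mul (η ^ (-δ))).const_mul 2
  · rw [llnError, Real.sqrt_sq hη.le]

namespace AsymptoticGroup

variable {𝒳 𝒱 S : ℕ → Type*} [∀ k, MeasurableSpace (𝒳 k)]
    [∀ k, MeasurableSpace (𝒱 k)] [∀ k, MeasurableSpace (S k)] {P : ∀ k, Measure (𝒳 k × 𝒱 k)}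
    [∀ k, IsProbabilityMeasure (P k)]
    {ρ : ∀ k, Measure (S k)} [∀ k, IsProbabilityMeasure (ρ k)] {n m : ℕ → ℕ} {f : ∀ k, 𝒳 k → ℝ}
    {g : ∀ k, 𝒱 k → ℝ} {ghat : ∀ k, S k → (Fin (n k / 2) → 𝒳 k × 𝒱 k) → 𝒱 k → ℝ}
    {c s₁ s₂ b : ℕ → ℝ} {δ : ℝ}

omit [∀ k, IsProbabilityMeasure (P k)] [∀ k, IsProbabilityMeasure (ρ k)] in
theorem pos (G : AsymptoticGroup P ρ n m f g ghat c s₁ s₂ b δ) : ∀ᶠ k in atTop, 0 < n k :=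
  G.tendsto.eventually_gt_atTop 0

theorem vanishes_oracleSq₁ (G : AsymptoticGroup P ρ n m f g ghat c s₁ s₂ b δ) :
    VanishesInProb (fun k => groupLaw (P k) (ρ k) (n k) (m k))
      fun k d => oracleSq₁ (f k) (g k) d / s₁ k - 1 := by
  have heq : ∀ᶠ k in atTop, ∀ d : GroupSample (𝒳 k) (𝒱 k) (S k) (n k) (m k),
      oracleSq₁ (f k) (g k) d / s₁ k - 1 = (s₁ k)⁻¹ * (oracleSq₁ (f k) (g k) d - s₁ k) := by
    filter_upwards [G.decomposition] with k hD d
    have := hD.pos₁.ne'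
    field_simp
  refine VanishesInProb.of_integral ?_ ?_
  · filter_upwards [G.decomposition, G.pos, heq] with k hD hn he
    simp_rw [he]
    exact (integrable_oracleSq₁_sub hD hn).const_mul _
  · refine tendsto_zero_of_forall_le_add (fun k => integral_nonneg fun _ => abs_nonneg _)
      fun η hη => ?_
    obtain ⟨y, hy, hle⟩ := exists_llnError_eq (δ := δ) G.moment hη
    refine ⟨y, hy, ?_⟩
    filter_upwards [G.decomposition, G.pos, heq] with k hD hn he
    have hs := hD.pos₁
    simp_rw [he, abs_mul, abs_of_pos (inv_pos.2 hs)]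
    rw [integral_const_mul, ← hle, inv_mul_le_iff₀ hs]
    exact integral_abs_oracleSq₁_sub_le hD G.delta_pos (by positivity) hn le_rfl
      (mul_nonneg hD.nonneg (by positivity))

theorem vanishes_oracleSq₂ (G : AsymptoticGroup P ρ n m f g ghat c s₁ s₂ b δ) :
    VanishesInProb (fun k => groupLaw (P k) (ρ k) (n k) (m k))
      fun k d => oracleSq₂ (g k) d / s₂ k - 1 := by
  have heq : ∀ᶠ k in atTop, ∀ d : GroupSample (𝒳 k) (𝒱 k) (S k) (n k) (m k),
      oracleSq₂ (g k) d / s₂ k - 1 = (s₂ k)⁻¹ * (oracleSq₂ (g k) d - s₂ k) := by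
    filter_upwards [G.decomposition] with k hD d
    have := hD.pos₂.ne'
    field_simp
  refine VanishesInProb.of_integral ?_ ?_
  · filter_upwards [G.decomposition, G.pos, heq] with k hD hn he
    simp_rw [he]
    exact (integral_abs_oracleSq₂_sub_le (G.measurable k) hD G.delta_pos one_pos hn
      le_rfl).1.const_mul _
  · refine tendsto_zero_of_forall_le_add (fun k => integral_nonneg fun _ => abs_nonneg _)
      fun η hη => ?_
    obtain ⟨y, hy, hle⟩ := exists_llnError_eq (δ := δ) G.moment (half_pos hη)
    refine ⟨fun k => 2 * y k + 2 / (n k : ℝ), ?_, ?_⟩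
    · have h1 : Tendsto (fun k => 2 / (n k : ℝ)) atTop (𝓝 0) :=
        (tendsto_natCast_atTop_atTop.comp G.tendsto).const_div_atTop 2
      simpa using (hy.const_mul 2).add h1
    filter_upwards [G.decomposition, G.pos, heq] with k hD hn he
    have hs := hD.pos₂
    simp_rw [he, abs_mul, abs_of_pos (inv_pos.2 hs)]
    rw [integral_const_mul, inv_mul_le_iff₀ hs]
    refine (integral_abs_oracleSq₂_sub_le (G.measurable k) hD G.delta_pos
      (by positivity : 0 < (η / 2) ^ 2) hn le_rfl).2.trans_eq ?_
    rw [hle]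
    ring

/-- Both folds, with their training data, have the law `foldLaw`, so the expectation of a sum over
the two folds is at most twice that of one term. -/
theorem _root_.SemiSupTest.lintegral_folds_le {𝒳 𝒱 S : Type*} [MeasurableSpace 𝒳]
    [MeasurableSpace 𝒱] [MeasurableSpace S] {P : Measure (𝒳 × 𝒱)} [IsProbabilityMeasure P]
    {ρ : Measure S} [IsProbabilityMeasure ρ] {n m : ℕ} (hn : Even n) (hm : Even m)
    {φ : (S × (Fin (n / 2) → 𝒳 × 𝒱)) × ((Fin (n / 2) → 𝒳 × 𝒱) × (Fin (m / 2) → 𝒱)) → ℝ}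
    (hφ : Measurable φ) :
    ∫⁻ d, ENNReal.ofReal (φ (trainOdd d) + φ (trainEven d)) ∂(groupLaw P ρ n m)
      ≤ 2 * ∫⁻ x, ENNReal.ofReal (φ x) ∂(foldLaw P ρ n m) := by
  have h1 := measurePreserving_trainOdd (n := n) (m := m) P ρ hn hm
  have h2 := measurePreserving_trainEven (n := n) (m := m) P ρ hn hm
  have h3 := h1.lintegral_comp hφ.ennreal_ofReal
  have h4 := h2.lintegral_comp hφ.ennreal_ofReal
  calc _ ≤ ∫⁻ d, (ENNReal.ofReal (φ (trainOdd d)) + ENNReal.ofReal (φ (trainEven d)))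
        ∂(groupLaw P ρ n m) := lintegral_mono fun d => ENNReal.ofReal_add_le
    _ = _ := by
        have h5 : Measurable fun d : GroupSample 𝒳 𝒱 S n m => ENNReal.ofReal (φ (trainOdd d)) :=
          (hφ.comp h1.measurable).ennreal_ofReal
        rw [lintegral_add_left h5, h3, h4, two_mul]

/-- Markov's inequality for a sum over the two folds whose expectation is a bounded multiple of the
estimation risk relative to `min s₁ s₂`. -/
theorem vanishes_folds (G : AsymptoticGroup P ρ n m f g ghat c s₁ s₂ b δ)
    {φ : ∀ k, (S k × (Fin (n k / 2) → 𝒳 k × 𝒱 k)) ×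
      ((Fin (n k / 2) → 𝒳 k × 𝒱 k) × (Fin (m k / 2) → 𝒱 k)) → ℝ}
    (hφ : ∀ k, Measurable (φ k)) (hφ0 : ∀ k x, 0 ≤ φ k x) {C : ℝ}
    (h : ∀ᶠ k in atTop, ∫⁻ x, ENNReal.ofReal (φ k x) ∂(foldLaw (P k) (ρ k) (n k) (m k))
      ≤ ENNReal.ofReal C * (fitRisk (P k) (ρ k) (fitError (ghat k) (g k))
        / ENNReal.ofReal (min (s₁ k) (s₂ k)))) :
    VanishesInProb (fun k => groupLaw (P k) (ρ k) (n k) (m k))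
      fun k d => φ k (trainOdd d) + φ k (trainEven d) := by
  refine VanishesInProb.of_lintegral (Eventually.of_forall fun k => ?_) ?_
  · exact (((hφ k).comp (measurePreserving_trainOdd (P k) (ρ k) (G.even₁ k)
      (G.even₂ k)).measurable).add
      ((hφ k).comp (measurePreserving_trainEven (P k) (ρ k) (G.even₁ k)
        (G.even₂ k)).measurable)).aemeasurable
  · have h0 := ENNReal.Tendsto.const_mul (a := 2 * ENNReal.ofReal C) G.risk
      (Or.inr (ENNReal.mul_ne_top (by simp) ENNReal.ofReal_ne_top))
    rw [mul_zero] at h0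
    refine tendsto_of_tendsto_of_tendsto_of_le_of_le' tendsto_const_nhds h0
      (Eventually.of_forall fun _ => zero_le) ?_
    filter_upwards [h] with k hk
    have he : ∀ d : GroupSample (𝒳 k) (𝒱 k) (S k) (n k) (m k),
        |φ k (trainOdd d) + φ k (trainEven d)| = φ k (trainOdd d) + φ k (trainEven d) :=
      fun d => abs_of_nonneg (add_nonneg (hφ0 k _) (hφ0 k _))
    simp_rw [he]
    refine (lintegral_folds_le (G.even₁ k) (G.even₂ k) (hφ k)).trans ?_
    rw [mul_assoc]
    gcongr

theorem vanishes_crossSqError₁ (G : AsymptoticGroup P ρ n m f g ghat c s₁ s₂ b δ) :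
    VanishesInProb (fun k => groupLaw (P k) (ρ k) (n k) (m k))
      fun k d => crossSqError₁ (ghat k) (g k) d / min (s₁ k) (s₂ k) := by
  refine (G.vanishes_folds
    (φ := fun k x => foldSq₁ (fitError (ghat k) (g k)) (m k) x / |min (s₁ k) (s₂ k)|) (C := 1)
    (fun k => (measurable_foldMean (G.measurable_fitError k)).2.1.div_const _)
    (fun k x => div_nonneg (div_nonneg (Finset.sum_nonneg fun _ _ => sq_nonneg _)
      (Nat.cast_nonneg _)) (abs_nonneg _)) ?_).of_le ?_
  · filter_upwards [G.decomposition, G.pos] with k hD hn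
    have hv : 0 < min (s₁ k) (s₂ k) := lt_min hD.pos₁ hD.pos₂
    simp_rw [abs_of_pos hv, ENNReal.ofReal_div_of_pos hv, div_eq_mul_inv]
    rw [lintegral_mul_const' _ _ (ENNReal.inv_ne_top.2 (ENNReal.ofReal_pos.2 hv).ne'), ← mul_assoc]
    gcongr
    exact lintegral_foldSq₁_le (G.even₁ k) (G.even₂ k) hn (G.measurable_fitError k)
  · filter_upwards [G.decomposition] with k hD d
    have hv : 0 < min (s₁ k) (s₂ k) := lt_min hD.pos₁ hD.pos₂
    rw [crossSqError₁_eq (ghat k) (g k) (G.even₁ k), abs_of_pos hv, ← add_div]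

theorem vanishes_crossSqError₂ (G : AsymptoticGroup P ρ n m f g ghat c s₁ s₂ b δ) :
    VanishesInProb (fun k => groupLaw (P k) (ρ k) (n k) (m k))
      fun k d => crossSqError₂ (ghat k) (g k) d / min (s₁ k) (s₂ k) := by
  refine (G.vanishes_folds
    (φ := fun k x => foldSq₂ (fitError (ghat k) (g k)) (m k) x / |min (s₁ k) (s₂ k)|) (C := 1)
    (fun k => (measurable_foldMean (G.measurable_fitError k)).2.2.div_const _)
    (fun k x => div_nonneg (div_nonneg (add_nonneg (Finset.sum_nonneg fun _ _ => sq_nonneg _)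
      (Finset.sum_nonneg fun _ _ => sq_nonneg _)) (by positivity)) (abs_nonneg _)) ?_).of_le ?_
  · filter_upwards [G.decomposition, G.pos] with k hD hn
    have hv : 0 < min (s₁ k) (s₂ k) := lt_min hD.pos₁ hD.pos₂
    simp_rw [abs_of_pos hv, ENNReal.ofReal_div_of_pos hv, div_eq_mul_inv]
    rw [lintegral_mul_const' _ _ (ENNReal.inv_ne_top.2 (ENNReal.ofReal_pos.2 hv).ne'), ← mul_assoc]
    gcongr
    exact lintegral_foldSq₂_le (G.even₁ k) (G.even₂ k) hn (G.measurable_fitError k)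
  · filter_upwards [G.decomposition] with k hD d
    have hv : 0 < min (s₁ k) (s₂ k) := lt_min hD.pos₁ hD.pos₂
    rw [crossSqError₂_eq (ghat k) (g k) (G.even₁ k) (G.even₂ k), abs_of_pos hv, ← add_div]

/-- The asymptotic variance of the mean estimate. -/
def _root_.SemiSupTest.asymVar (s₁ s₂ : ℝ) (n m : ℕ) : ℝ := s₁ / n + s₂ / ((n : ℝ) + m)

omit [∀ k, IsProbabilityMeasure (P k)] [∀ k, IsProbabilityMeasure (ρ k)] in
theorem asymVar_pos (G : AsymptoticGroup P ρ n m f g ghat c s₁ s₂ b δ) :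
    ∀ᶠ k in atTop, 0 < asymVar (s₁ k) (s₂ k) (n k) (m k) := by
  filter_upwards [G.decomposition, G.pos] with k hD hn
  have := hD.pos₁
  have := hD.pos₂
  unfold asymVar
  positivity

/-- The cross-fit variance estimate is ratio consistent. -/
theorem vanishes_crossVar (G : AsymptoticGroup P ρ n m f g ghat c s₁ s₂ b δ) :
    VanishesInProb (fun k => groupLaw (P k) (ρ k) (n k) (m k))
      fun k d => crossVar (ghat k) (f k) d / asymVar (s₁ k) (s₂ k) (n k) (m k) - 1 := by
  refine VanishesInProb.of_forall_le_add fun η hη => ?_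
  have habs {X : ∀ k, GroupSample (𝒳 k) (𝒱 k) (S k) (n k) (m k) → ℝ}
      (h : VanishesInProb (fun k => groupLaw (P k) (ρ k) (n k) (m k)) X) :
      VanishesInProb (fun k => groupLaw (P k) (ρ k) (n k) (m k)) fun k d => |X k d| :=
    h.of_le (Eventually.of_forall fun k d => by rw [abs_abs])
  refine ⟨_, (((habs G.vanishes_oracleSq₁).add (habs G.vanishes_oracleSq₂)).const_mul
    (1 + η)).add ((G.vanishes_crossSqError₁.add G.vanishes_crossSqError₂).const_mul (1 + 1 / η)), ?_⟩
  filter_upwards [G.decomposition, G.pos] with k hD hn d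
  exact abs_crossVar_div_sub_one_le (ghat k) (g k) hη hn (lt_min hD.pos₁ hD.pos₂)
    (min_le_left _ _) (min_le_right _ _) rfl (f k) d

/-- The cross-fit and the oracle mean estimates differ by less than the order of their standard
deviation. -/
theorem vanishes_crossMean_sub (G : AsymptoticGroup P ρ n m f g ghat c s₁ s₂ b δ) :
    VanishesInProb (fun k => groupLaw (P k) (ρ k) (n k) (m k))
      fun k d => (crossMean (ghat k) (f k) d - oracleMean (f k) (g k) d)
        / √(asymVar (s₁ k) (s₂ k) (n k) (m k)) := by
  refine VanishesInProb.of_sq (((G.vanishes_folds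
    (φ := fun k x => foldMean (fitError (ghat k) (g k)) (m k) x ^ 2
      / |asymVar (s₁ k) (s₂ k) (n k) (m k)|) (C := 2)
    (fun k => ((measurable_foldMean (G.measurable_fitError k)).1.pow_const 2).div_const _)
    (fun k x => div_nonneg (sq_nonneg _) (abs_nonneg _)) ?_).const_mul 2).of_le ?_)
  · filter_upwards [G.decomposition, G.pos, G.asymVar_pos] with k hD hn hσ
    have hn' : (0 : ℝ) < n k := by exact_mod_cast hn
    have hv : 0 < min (s₁ k) (s₂ k) := lt_min hD.pos₁ hD.pos₂
    have hle : min (s₁ k) (s₂ k) / n k ≤ asymVar (s₁ k) (s₂ k) (n k) (m k) := by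
      have h1 : min (s₁ k) (s₂ k) / n k ≤ s₁ k / n k := by gcongr; exact min_le_left _ _
      have h2 : 0 < s₂ k / ((n k : ℝ) + m k) := by have := hD.pos₂; positivity
      unfold asymVar
      linarith
    simp_rw [abs_of_pos hσ, ENNReal.ofReal_div_of_pos hσ, div_eq_mul_inv]
    rw [lintegral_mul_const' _ _ (ENNReal.inv_ne_top.2 (ENNReal.ofReal_pos.2 hσ).ne')]
    refine (mul_le_mul_left (lintegral_foldMean_sq_le (G.even₁ k) (G.even₂ k) hn
      (G.measurable_fitError k)) _).trans ?_
    have key : ENNReal.ofReal (2 / n k) * (ENNReal.ofReal (asymVar (s₁ k) (s₂ k) (n k) (m k)))⁻¹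
        ≤ ENNReal.ofReal 2 * (ENNReal.ofReal (min (s₁ k) (s₂ k)))⁻¹ := by
      rw [← ENNReal.ofReal_inv_of_pos hσ, ← ENNReal.ofReal_inv_of_pos hv,
        ← ENNReal.ofReal_mul (by positivity), ← ENNReal.ofReal_mul (by positivity)]
      refine ENNReal.ofReal_le_ofReal ?_
      rw [← div_eq_mul_inv, ← div_eq_mul_inv, div_div]
      rw [div_le_iff₀ hn'] at hle
      gcongr
      linarith
    calc _ = ENNReal.ofReal (2 / n k)
          * (ENNReal.ofReal (asymVar (s₁ k) (s₂ k) (n k) (m k)))⁻¹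
          * fitRisk (P k) (ρ k) (fitError (ghat k) (g k)) := by ring
      _ ≤ ENNReal.ofReal 2 * (ENNReal.ofReal (min (s₁ k) (s₂ k)))⁻¹
          * fitRisk (P k) (ρ k) (fitError (ghat k) (g k)) := by gcongr
      _ = _ := by ring
  · filter_upwards [G.asymVar_pos] with k hσ d
    rw [crossMean_sub_oracleMean (ghat k) (g k) (G.even₁ k) (G.even₂ k), div_pow,
      Real.sq_sqrt hσ.le, abs_of_pos hσ, neg_sq, ← add_div, ← mul_div_assoc, abs_div, abs_div]
    gcongr
    nlinarith [sq_nonneg (foldMean (fitError (ghat k) (g k)) (m k) (trainOdd d)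
      - foldMean (fitError (ghat k) (g k)) (m k) (trainEven d))]

/-- The oracle mean estimate is asymptotically normal: its characteristic function at frequencies
of the order of the inverse standard deviation approaches that of a normal law. -/
theorem tendsto_integral_cexp_oracleMean (G : AsymptoticGroup P ρ n m f g ghat c s₁ s₂ b δ)
    (u : ℕ → ℝ) (t : ℝ) (hu : ∀ᶠ k in atTop, |u k| * √(asymVar (s₁ k) (s₂ k) (n k) (m k)) ≤ |t|) :
    Tendsto (fun k => ‖∫ d, Complex.exp (Complex.I * (u k * (oracleMean (f k) (g k) d - c k) : ℝ))
        ∂(groupLaw (P k) (ρ k) (n k) (m k))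
        - Complex.exp (-(u k ^ 2 * asymVar (s₁ k) (s₂ k) (n k) (m k) : ℝ) / 2)‖) atTop (𝓝 0) := by
  have hδ := G.delta_pos
  refine tendsto_zero_of_forall_le_add (fun k => norm_nonneg _) fun ε hε => ?_
  -- choose the truncation level so small that the main error term is below `ε`
  obtain ⟨η, hη, hηε⟩ : ∃ η : ℝ, 0 < η ∧ (3 * η + η ^ 2) * t ^ 2 ≤ ε := by
    have hc : Tendsto (fun η : ℝ => (3 * η + η ^ 2) * t ^ 2) (𝓝[>] 0) (𝓝 0) := by
      have : Continuous fun η : ℝ => (3 * η + η ^ 2) * t ^ 2 := by fun_prop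
      have h := this.tendsto 0
      simp only [mul_zero, ne_eq, OfNat.ofNat_ne_zero, not_false_eq_true, zero_pow, add_zero,
        zero_mul] at h
      exact h.mono_left nhdsWithin_le_nhds
    obtain ⟨η, h1, h2⟩ := ((hc.eventually_le_const hε).and self_mem_nhdsWithin).exists
    exact ⟨η, h2, h1⟩
  set Λ : ℕ → ℝ := fun k => 2 * 2 ^ (2 + δ) * (b k * √(n k : ℝ) ^ (-δ)) * |t| ^ (2 + δ) with hΛ
  have hΛ0 : Tendsto Λ atTop (𝓝 0) := by
    simpa using (G.moment.const_mul (2 * 2 ^ (2 + δ))).mul_const (|t| ^ (2 + δ))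
  refine ⟨fun k => η ^ (-δ) * Λ k * t ^ 2 + 6 * η ^ (-δ) * Λ k, ?_, ?_⟩
  · simpa using ((hΛ0.const_mul (η ^ (-δ))).mul_const (t ^ 2)).add (hΛ0.const_mul (6 * η ^ (-δ)))
  · filter_upwards [G.decomposition, G.pos, G.asymVar_pos, hu] with k hD hn hσ huk
    set σ2 := asymVar (s₁ k) (s₂ k) (n k) (m k) with hσ2
    set Λ' := 2 * 2 ^ (2 + δ) * (b k * √(n k : ℝ) ^ (-δ)) * (|u k| * √σ2) ^ (2 + δ) with hΛ'
    have h := norm_integral_cexp_oracleMean_sub_le (ρ := ρ k) (m := m k) (G.measurable k) hD hδ hη hn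
      le_rfl (u k) hσ2 hΛ'
    have hb : 0 ≤ b k * √(n k : ℝ) ^ (-δ) := mul_nonneg hD.nonneg (by positivity)
    have h1 : Λ' ≤ Λ k :=
      mul_le_mul_of_nonneg_left (Real.rpow_le_rpow (by positivity) huk (by linarith))
        (mul_nonneg (by positivity) hb)
    have hΛk : 0 ≤ Λ k := by rw [hΛ]; positivity
    have h2 : u k ^ 2 * σ2 ≤ t ^ 2 := by
      have := pow_le_pow_left₀ (by positivity) huk 2
      rwa [mul_pow, sq_abs, sq_abs, Real.sq_sqrt hσ.le] at this
    calc _ ≤ (3 * η + η ^ 2 + η ^ (-δ) * Λ') * (u k ^ 2 * σ2) + 6 * η ^ (-δ) * Λ' := h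
      _ ≤ (3 * η + η ^ 2 + η ^ (-δ) * Λ k) * t ^ 2 + 6 * η ^ (-δ) * Λ k := by gcongr
      _ ≤ _ := by linarith

end AsymptoticGroup

/-! ### The standard normal distribution function -/

theorem stdNormalCDF_eq_real (x : ℝ) : stdNormalCDF x = (gaussianReal 0 1).real (Set.Iic x) :=
  cdf_eq_real _ x

theorem monotone_stdNormalCDF : Monotone stdNormalCDF := monotone_cdf _

theorem stdNormalCDF_nonneg (x : ℝ) : 0 ≤ stdNormalCDF x := cdf_nonneg _ x

theorem stdNormalCDF_le_one (x : ℝ) : stdNormalCDF x ≤ 1 := cdf_le_one _ x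

theorem continuous_stdNormalCDF : Continuous stdNormalCDF := by
  have : NullSingletonClass (gaussianReal 0 1) := nullSingletonClass_gaussianReal one_ne_zero
  refine continuous_iff_continuousAt.2 fun x => ?_
  change ContinuousAt (cdf (gaussianReal 0 1)) x
  rw [(monotone_cdf _).continuousAt_iff_leftLim_eq_rightLim, StieltjesFunction.rightLim_eq]
  refine le_antisymm ((monotone_cdf _).leftLim_le le_rfl) ?_
  have h := StieltjesFunction.measure_singleton (cdf (gaussianReal 0 1)) x
  rw [measure_cdf, measure_singleton] at h
  linarith [ENNReal.ofReal_eq_zero.1 h.symm]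

theorem strictMono_stdNormalCDF : StrictMono stdNormalCDF := by
  intro x y hxy
  have h1 : (gaussianReal 0 1).real (Set.Iic y)
      = (gaussianReal 0 1).real (Set.Iic x) + (gaussianReal 0 1).real (Set.Ioc x y) := by
    rw [← measureReal_union (Set.Iic_disjoint_Ioc le_rfl) measurableSet_Ioc,
      Set.Iic_union_Ioc_eq_Iic hxy.le]
  have h2 : (gaussianReal 0 1) (Set.Ioc x y) ≠ 0 := by
    intro h
    have := gaussianReal_absolutelyContinuous' 0 one_ne_zero h
    rw [Real.volume_Ioc, ENNReal.ofReal_eq_zero] at this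
    linarith
  have h3 : 0 < (gaussianReal 0 1).real (Set.Ioc x y) :=
    ENNReal.toReal_pos h2 (measure_ne_top _ _)
  rw [stdNormalCDF_eq_real, stdNormalCDF_eq_real, h1]
  linarith

theorem stdNormalCDF_neg (x : ℝ) : stdNormalCDF (-x) = 1 - stdNormalCDF x := by
  have : NullSingletonClass (gaussianReal 0 1) := nullSingletonClass_gaussianReal one_ne_zero
  have h1 : (gaussianReal 0 1).real (Set.Iic (-x)) = (gaussianReal 0 1).real (Set.Ici x) := by
    have h := gaussianReal_map_neg (μ := 0) (v := 1)
    rw [neg_zero] at h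
    conv_lhs => rw [← h]
    rw [map_measureReal_apply measurable_neg measurableSet_Iic]
    congr 1
    ext y; simp
  have h2 : Set.Ici x = (Set.Iio x)ᶜ := by ext y; simp
  rw [stdNormalCDF_eq_real, stdNormalCDF_eq_real, h1, h2, probReal_compl_eq_one_sub measurableSet_Iio,
    measureReal_congr (Iio_ae_eq_Iic (μ := gaussianReal 0 1) (a := x))]

theorem exists_stdNormalCDF_eq {p : ℝ} (hp : p ∈ Set.Ioo (0 : ℝ) 1) : ∃ x, stdNormalCDF x = p := by
  refine mem_range_of_exists_le_of_exists_ge continuous_stdNormalCDF ?_ ?_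
  · exact ((tendsto_cdf_atBot (gaussianReal 0 1)).eventually_le_const hp.1).exists
  · exact ((tendsto_cdf_atTop (gaussianReal 0 1)).eventually_const_le hp.2).exists

theorem stdNormalCDF_quantile {p : ℝ} (hp : p ∈ Set.Ioo (0 : ℝ) 1) :
    stdNormalCDF (stdNormalQuantile p) = p := by
  obtain ⟨x, hx⟩ := exists_stdNormalCDF_eq hp
  have h : {y : ℝ | p ≤ stdNormalCDF y} = Set.Ici x := by
    ext y
    rw [← hx]
    exact strictMono_stdNormalCDF.le_iff_le
  rw [stdNormalQuantile, h, csInf_Ici, hx]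

theorem stdNormalQuantile_one_sub {α : ℝ} (hα : α ∈ Set.Ioo (0 : ℝ) 1) :
    stdNormalQuantile (1 - α) = -stdNormalQuantile α := by
  refine strictMono_stdNormalCDF.injective ?_
  rw [stdNormalCDF_neg, stdNormalCDF_quantile hα,
    stdNormalCDF_quantile ⟨by linarith [hα.2], by linarith [hα.1]⟩]

/-- Pólya's theorem for the normal limit: pointwise convergence of monotone functions with values
in `[0, 1]` to `Φ` is uniform. The comparison is made at finitely many quantiles of `Φ`. -/
theorem eventually_forall_abs_sub_stdNormalCDF_le {ι : Type*} {l : Filter ι} {F : ι → ℝ → ℝ}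
    (hF : ∀ i, Monotone (F i)) (hF0 : ∀ i x, 0 ≤ F i x) (hF1 : ∀ i x, F i x ≤ 1)
    (h : ∀ x, Tendsto (fun i => F i x) l (𝓝 (stdNormalCDF x))) {ε : ℝ} (hε : 0 < ε) :
    ∀ᶠ i in l, ∀ x, |F i x - stdNormalCDF x| ≤ ε := by
  obtain ⟨J, hJ⟩ := exists_nat_gt (2 / ε)
  have hJ0 : (0 : ℝ) < J := lt_trans (by positivity) hJ
  have hJε : 1 / (J : ℝ) < ε / 2 := by
    rw [div_lt_iff₀ hε] at hJ
    rw [div_lt_iff₀ hJ0]; linarith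
  -- the quantiles of order `j / J`
  have hq : ∀ j : ℕ, ∃ x, 0 < j → j < J → stdNormalCDF x = j / J := by
    intro j
    by_cases hj : 0 < j ∧ j < J
    · obtain ⟨x, hx⟩ := exists_stdNormalCDF_eq (p := (j : ℝ) / J)
        ⟨div_pos (by exact_mod_cast hj.1) hJ0, (div_lt_one hJ0).2 (by exact_mod_cast hj.2)⟩
      exact ⟨x, fun _ _ => hx⟩
    · exact ⟨0, fun h1 h2 => absurd ⟨h1, h2⟩ hj⟩
  choose q hq using hq
  have hfin : ∀ᶠ i in l, ∀ j ∈ Finset.range J, |F i (q j) - stdNormalCDF (q j)| < ε / 2 := by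
    rw [Filter.eventually_all_finset]
    intro j _
    have := (Metric.tendsto_nhds.1 (h (q j))) (ε / 2) (by linarith)
    simpa only [Real.dist_eq] using this
  filter_upwards [hfin] with i hi x
  have hx0 := stdNormalCDF_nonneg x
  have hx1 := stdNormalCDF_le_one x
  rw [abs_le]
  constructor
  · -- compare with the largest quantile below `x`
    set j := ⌊J * stdNormalCDF x⌋₊ with hj
    have hj1 : (j : ℝ) ≤ J * stdNormalCDF x := Nat.floor_le (by positivity)
    have hj2 : J * stdNormalCDF x < j + 1 := Nat.lt_floor_add_one _
    have hle : stdNormalCDF x ≤ j / J + 1 / J := by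
      rw [← add_div, le_div_iff₀ hJ0]; linarith
    rcases Nat.eq_zero_or_pos j with h0 | h0
    · rw [h0] at hle
      have := hF0 i x
      simp only [Nat.cast_zero, zero_div, zero_add] at hle
      linarith
    · by_cases hjl : j < J
      · have hqj := hq j h0 hjl
        have hqx : q j ≤ x := by
          rw [← strictMono_stdNormalCDF.le_iff_le, hqj, div_le_iff₀ hJ0]; linarith
        have h3 := hF i hqx
        have h4 := hi j (Finset.mem_range.2 hjl)
        rw [hqj, abs_lt] at h4
        linarith [h4.1]
      · -- `Φ x < 1`, so the largest quantile has order below one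
        exfalso
        have hlt : stdNormalCDF x < 1 :=
          (strictMono_stdNormalCDF (lt_add_one x)).trans_le (stdNormalCDF_le_one _)
        have : (J : ℝ) ≤ j := by exact_mod_cast not_lt.1 hjl
        nlinarith
  · -- compare with the smallest quantile above `x`
    set j := ⌈J * stdNormalCDF x⌉₊ with hj
    have hj1 : J * stdNormalCDF x ≤ j := Nat.le_ceil _
    have hj2 : (j : ℝ) < J * stdNormalCDF x + 1 := Nat.ceil_lt_add_one (by positivity)
    have hle : j / J - 1 / J ≤ stdNormalCDF x := by
      rw [← sub_div, div_le_iff₀ hJ0]; linarith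
    by_cases hjl : j < J
    · have hpos : 0 < stdNormalCDF x :=
        (stdNormalCDF_nonneg (x - 1)).trans_lt (strictMono_stdNormalCDF (by linarith))
      have h0 : 0 < j := Nat.ceil_pos.2 (by positivity)
      have hqj := hq j h0 hjl
      have hqx : x ≤ q j := by
        rw [← strictMono_stdNormalCDF.le_iff_le, hqj, le_div_iff₀ hJ0]; linarith
      have h3 := hF i hqx
      have h4 := hi j (Finset.mem_range.2 hjl)
      rw [hqj, abs_lt] at h4
      linarith [h4.2]
    · have h1 : (1 : ℝ) ≤ j / J := by
        rw [le_div_iff₀ hJ0, one_mul]; exact_mod_cast not_lt.1 hjl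
      have := hF1 i x
      linarith

theorem exists_pos_forall_abs_stdNormalCDF_sub_le {ε : ℝ} (hε : 0 < ε) :
    ∃ ω : ℝ, 0 < ω ∧ ∀ x, |stdNormalCDF (x + ω) - stdNormalCDF x| ≤ ε := by
  have h := eventually_forall_abs_sub_stdNormalCDF_le (l := 𝓝[>] (0 : ℝ))
    (F := fun ω x => stdNormalCDF (x + ω)) (fun ω x y hxy => monotone_stdNormalCDF (by linarith))
    (fun _ _ => stdNormalCDF_nonneg _) (fun _ _ => stdNormalCDF_le_one _) (fun x => by
      have hc : Continuous fun ω : ℝ => stdNormalCDF (x + ω) :=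
        continuous_stdNormalCDF.comp (by fun_prop)
      have := hc.tendsto 0
      rw [add_zero] at this
      exact this.mono_left nhdsWithin_le_nhds) hε
  obtain ⟨ω, h1, h2⟩ := (h.and self_mem_nhdsWithin).exists
  exact ⟨ω, h2, h1⟩

/-- If characteristic functions converge to that of the standard normal law, the distribution
functions converge uniformly. -/
theorem eventually_forall_abs_measureReal_sub_le {Ω : ℕ → Type*} [∀ k, MeasurableSpace (Ω k)]
    {μ : ∀ k, Measure (Ω k)} [∀ k, IsProbabilityMeasure (μ k)] {N : ∀ k, Ω k → ℝ}
    (hN : ∀ k, Measurable (N k))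
    (h : ∀ t : ℝ, Tendsto (fun k => ∫ ω, Complex.exp (Complex.I * (t * N k ω : ℝ)) ∂(μ k)) atTop
      (𝓝 (Complex.exp (-(t ^ 2 : ℝ) / 2)))) {ε : ℝ} (hε : 0 < ε) :
    ∀ᶠ k in atTop, ∀ x, |(μ k).real {ω | N k ω ≤ x} - stdNormalCDF x| ≤ ε := by
  have : NullSingletonClass (gaussianReal 0 1) := nullSingletonClass_gaussianReal one_ne_zero
  have hp (k : ℕ) : IsProbabilityMeasure ((μ k).map (N k)) :=
    Measure.isProbabilityMeasure_map (hN k).aemeasurable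
  let μ₀ : ProbabilityMeasure ℝ := ⟨gaussianReal 0 1, inferInstance⟩
  let μs : ℕ → ProbabilityMeasure ℝ := fun k => ⟨(μ k).map (N k), hp k⟩
  have hconv : Tendsto μs atTop (𝓝 μ₀) := by
    refine ProbabilityMeasure.tendsto_of_tendsto_charFun fun t => ?_
    change Tendsto (fun k => charFun ((μ k).map (N k)) t) atTop (𝓝 (charFun (gaussianReal 0 1) t))
    rw [charFun_gaussianReal]
    have e : Complex.exp (↑t * ↑(0 : ℝ) * Complex.I - ↑(1 : NNReal) * ↑t ^ 2 / 2)
        = Complex.exp (-(t ^ 2 : ℝ) / 2) := by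
      congr 1; push_cast; simp; ring
    rw [e]
    refine (h t).congr fun k => ?_
    rw [charFun_apply_real, integral_map (hN k).aemeasurable (by fun_prop)]
    refine integral_congr_ae (Eventually.of_forall fun ω => ?_)
    simp only
    congr 1
    push_cast
    ring
  refine eventually_forall_abs_sub_stdNormalCDF_le (F := fun k x => (μ k).real {ω | N k ω ≤ x})
    (fun k x y hxy => measureReal_mono fun ω hω => le_trans hω hxy)
    (fun k x => measureReal_nonneg) (fun k x => measureReal_le_one) (fun x => ?_) hε
  have h1 := ProbabilityMeasure.tendsto_measure_of_null_frontier_of_tendsto' hconv (E := Set.Iic x)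
    (by rw [frontier_Iic]; exact measure_singleton (μ := gaussianReal 0 1) x)
  have h2 := (ENNReal.tendsto_toReal
    (measure_ne_top (gaussianReal 0 1) (Set.Iic x))).comp h1
  rw [stdNormalCDF_eq_real]
  refine h2.congr fun k => ?_
  change ((μ k).map (N k) (Set.Iic x)).toReal = _
  rw [Measure.map_apply (hN k) measurableSet_Iic]
  rfl

/-! ### The power of a studentized statistic -/

/-- The rejection probability of `(N + e + δ) / √R` is close to `Φ (δ - z)` when `N` is nearly
standard normal, `e` is small and `R` is close to one. -/
theorem abs_measureReal_sub_stdNormalCDF_le {Ω : Type*} [MeasurableSpace Ω] {μ : Measure Ω}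
    [IsProbabilityMeasure μ] {N e R : Ω → ℝ} (hN : Measurable N) {z δ ε ω ω₁ ω₂ : ℝ}
    (hω₂ : ω₂ < 1) (hω : |z| * ω₂ + ω₁ ≤ ω)
    (hF : ∀ x, |μ.real {a | N a ≤ x} - stdNormalCDF x| ≤ ε)
    (hΦ : ∀ x, |stdNormalCDF (x + ω) - stdNormalCDF x| ≤ ε)
    (he : μ.real {a | ω₁ ≤ |e a|} ≤ ε) (hR : μ.real {a | ω₂ ≤ |R a - 1|} ≤ ε) :
    |μ.real {a | z < (N a + e a + δ) / √(R a)} - stdNormalCDF (δ - z)| ≤ 4 * ε := by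
  have hgood : ∀ a, |e a| < ω₁ → |R a - 1| < ω₂ →
      0 < √(R a) ∧ |z * √(R a) - e a - z| ≤ ω := by
    intro a h1 h2
    have h2' := abs_lt.1 (h2.trans hω₂)
    have hR0 : 0 < R a := by linarith
    have hs : 0 < √(R a) := Real.sqrt_pos.2 hR0
    refine ⟨hs, ?_⟩
    have h3 : |√(R a) - 1| ≤ |R a - 1| := by
      have : R a - 1 = (√(R a) - 1) * (√(R a) + 1) := by
        nlinarith [Real.mul_self_sqrt hR0.le]
      rw [this, abs_mul]
      have h4 : 1 ≤ |√(R a) + 1| := by rw [abs_of_pos (by linarith)]; linarith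
      nlinarith [abs_nonneg (√(R a) - 1)]
    calc |z * √(R a) - e a - z| = |z * (√(R a) - 1) - e a| := by congr 1; ring
      _ ≤ |z| * |√(R a) - 1| + |e a| := by rw [← abs_mul]; exact abs_sub _ _
      _ ≤ |z| * ω₂ + ω₁ := by
          have := abs_nonneg z
          gcongr
          exact h3.trans h2.le
      _ ≤ ω := hω
  have hcompl : ∀ x, μ.real {a | x < N a} = 1 - μ.real {a | N a ≤ x} := by
    intro x
    have h : {a | x < N a} = {a | N a ≤ x}ᶜ := by ext a; simp
    rw [h, probReal_compl_eq_one_sub (measurableSet_le hN measurable_const)]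
  have hsym : stdNormalCDF (δ - z) = 1 - stdNormalCDF (z - δ) := by
    rw [← stdNormalCDF_neg]; congr 1; ring
  rw [abs_le]
  constructor
  · have hsub : {a | z - δ + ω < N a} ⊆ {a | z < (N a + e a + δ) / √(R a)}
        ∪ ({a | ω₁ ≤ |e a|} ∪ {a | ω₂ ≤ |R a - 1|}) := by
      intro a ha
      by_contra hnot
      simp only [Set.mem_union, Set.mem_ofPred_eq, not_or, not_le] at hnot ha
      obtain ⟨h1, h2, h3⟩ := hnot
      obtain ⟨hs, h4⟩ := hgood a h2 h3
      refine h1 ?_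
      rw [lt_div_iff₀ hs]
      linarith [(abs_le.1 h4).2]
    have h1 := (measureReal_mono (μ := μ) hsub).trans ((measureReal_union_le _ _).trans
      (add_le_add_right (measureReal_union_le _ _) _))
    rw [hcompl] at h1
    have h2 := (abs_le.1 (hF (z - δ + ω))).2
    have h3 := (abs_le.1 (hΦ (z - δ))).2
    linarith
  · have hsub : {a | z < (N a + e a + δ) / √(R a)} ⊆ {a | z - δ - ω < N a}
        ∪ ({a | ω₁ ≤ |e a|} ∪ {a | ω₂ ≤ |R a - 1|}) := by
      intro a ha
      by_contra hnot
      simp only [Set.mem_union, Set.mem_ofPred_eq, not_or, not_le, not_lt] at hnot ha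
      obtain ⟨h1, h2, h3⟩ := hnot
      obtain ⟨hs, h4⟩ := hgood a h2 h3
      rw [lt_div_iff₀ hs] at ha
      linarith [(abs_le.1 h4).1]
    have h1 := (measureReal_mono (μ := μ) hsub).trans ((measureReal_union_le _ _).trans
      (add_le_add_right (measureReal_union_le _ _) _))
    rw [hcompl] at h1
    have h2 := (abs_le.1 (hF (z - δ - ω))).1
    have h3 := (abs_le.1 (hΦ (z - δ - ω))).2
    rw [sub_add_cancel] at h3
    linarith

/-- Slutsky's argument for the power: the location shifts `δ k` are arbitrary. -/
theorem tendsto_measureReal_sub_stdNormalCDF {Ω : ℕ → Type*} [∀ k, MeasurableSpace (Ω k)]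
    {μ : ∀ k, Measure (Ω k)} [∀ k, IsProbabilityMeasure (μ k)] {N e R : ∀ k, Ω k → ℝ}
    (hN : ∀ k, Measurable (N k))
    (h : ∀ t : ℝ, Tendsto (fun k => ∫ ω, Complex.exp (Complex.I * (t * N k ω : ℝ)) ∂(μ k)) atTop
      (𝓝 (Complex.exp (-(t ^ 2 : ℝ) / 2))))
    (he : VanishesInProb μ e) (hR : VanishesInProb μ fun k ω => R k ω - 1) (z : ℝ) (δ : ℕ → ℝ) :
    Tendsto (fun k => (μ k).real {ω | z < (N k ω + e k ω + δ k) / √(R k ω)}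
      - stdNormalCDF (δ k - z)) atTop (𝓝 0) := by
  have hreal : ∀ {X : ∀ k, Ω k → ℝ}, VanishesInProb μ X → ∀ η : ℝ, 0 < η → ∀ ε : ℝ, 0 < ε →
      ∀ᶠ k in atTop, (μ k).real {ω | η ≤ |X k ω|} ≤ ε := by
    intro X hX η hη ε hε
    have h1 := (ENNReal.tendsto_toReal ENNReal.zero_ne_top).comp (hX η hη)
    exact h1.eventually_le_const hε
  rw [Metric.tendsto_nhds]
  intro ε hε
  have hε' : 0 < ε / 5 := by positivity
  obtain ⟨ω, hω, hΦ⟩ := exists_pos_forall_abs_stdNormalCDF_sub_le hε'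
  set ω₂ := min (1 / 2) (ω / (2 * (|z| + 1))) with hω₂
  have hω₂0 : 0 < ω₂ := lt_min (by norm_num) (by positivity)
  have hω₂1 : ω₂ < 1 := (min_le_left _ _).trans_lt (by norm_num)
  have hle : |z| * ω₂ + ω / 2 ≤ ω := by
    have h1 : ω₂ * (2 * (|z| + 1)) ≤ ω := (le_div_iff₀ (by positivity)).1 (min_le_right _ _)
    nlinarith [abs_nonneg z]
  filter_upwards [eventually_forall_abs_measureReal_sub_le hN h hε',
    hreal he (ω / 2) (by positivity) _ hε', hreal hR ω₂ hω₂0 _ hε'] with k h1 h2 h3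
  rw [Real.dist_eq, sub_zero]
  have := abs_measureReal_sub_stdNormalCDF_le (hN k) (δ := δ k) hω₂1 hle h1 hΦ h2 h3
  linarith

/-! ### The power of the cross-fit test for a fixed function -/

section

variable {𝒳 𝒱 S : Type*} [MeasurableSpace 𝒳] [MeasurableSpace 𝒱] [MeasurableSpace S] {n m : ℕ}

theorem measurable_oracleMean {f : 𝒳 → ℝ} {g : 𝒱 → ℝ} (hf : Measurable f) (hg : Measurable g) :
    Measurable (oracleMean f g : GroupSample 𝒳 𝒱 S n m → ℝ) := by
  unfold oracleMean muHat
  fun_prop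

end

/-- The relative error of a sum of positive quantities is at most the sum of the relative errors. -/
theorem abs_div_add_sub_one_le {a b A B : ℝ} (hA : 0 < A) (hB : 0 < B) :
    |(a + b) / (A + B) - 1| ≤ |a / A - 1| + |b / B - 1| := by
  have h1 : (a + b) / (A + B) - 1 = A / (A + B) * (a / A - 1) + B / (A + B) * (b / B - 1) := by
    field_simp
    ring
  have h2 : A / (A + B) ≤ 1 := (div_le_one (by positivity)).2 (by linarith)
  have h3 : B / (A + B) ≤ 1 := (div_le_one (by positivity)).2 (by linarith)
  rw [h1]
  refine (abs_add_le _ _).trans ?_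
  rw [abs_mul, abs_mul, abs_of_pos (by positivity : 0 < A / (A + B)),
    abs_of_pos (by positivity : 0 < B / (A + B))]
  exact add_le_add (mul_le_of_le_one_left (abs_nonneg _) h2)
    (mul_le_of_le_one_left (abs_nonneg _) h3)

theorem abs_sub_div_sqrt_add_le {a b A B : ℝ} (hA : 0 < A) (hB : 0 < B) :
    |(a - b) / √(A + B)| ≤ |a / √A| + |b / √B| := by
  rw [sub_div]
  refine (abs_sub _ _).trans ?_
  rw [abs_div, abs_div, abs_div, abs_div, abs_of_nonneg (Real.sqrt_nonneg _),
    abs_of_nonneg (Real.sqrt_nonneg _), abs_of_nonneg (Real.sqrt_nonneg _)]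
  have h1 : √A ≤ √(A + B) := Real.sqrt_le_sqrt (by linarith)
  have h2 : √B ≤ √(A + B) := Real.sqrt_le_sqrt (by linarith)
  exact add_le_add (div_le_div_of_nonneg_left (abs_nonneg _) (Real.sqrt_pos.2 hA) h1)
    (div_le_div_of_nonneg_left (abs_nonneg _) (Real.sqrt_pos.2 hB) h2)

section

variable {𝒳 𝒱 S S' : ℕ → Type*} [∀ k, MeasurableSpace (𝒳 k)]
    [∀ k, MeasurableSpace (𝒱 k)] [∀ k, MeasurableSpace (S k)] [∀ k, MeasurableSpace (S' k)]
    {P Q : ∀ k, Measure (𝒳 k × 𝒱 k)}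
    [∀ k, IsProbabilityMeasure (P k)] [∀ k, IsProbabilityMeasure (Q k)]
    {ρ : ∀ k, Measure (S k)} [∀ k, IsProbabilityMeasure (ρ k)]
    {ρ' : ∀ k, Measure (S' k)} [∀ k, IsProbabilityMeasure (ρ' k)]
    {n₁ m₁ n₂ m₂ : ℕ → ℕ} {f : ∀ k, 𝒳 k → ℝ} {g g' : ∀ k, 𝒱 k → ℝ}
    {ghat : ∀ k, S k → (Fin (n₁ k / 2) → 𝒳 k × 𝒱 k) → 𝒱 k → ℝ}
    {ghat' : ∀ k, S' k → (Fin (n₂ k / 2) → 𝒳 k × 𝒱 k) → 𝒱 k → ℝ}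
    {c s₁ s₂ b c' s₁' s₂' b' : ℕ → ℝ} {δ δ' : ℝ}

/-- The standardized difference of the oracle means is asymptotically standard normal. -/
theorem tendsto_integral_cexp_oracleMean_sub
    (G : AsymptoticGroup P ρ n₁ m₁ f g ghat c s₁ s₂ b δ)
    (G' : AsymptoticGroup Q ρ' n₂ m₂ f g' ghat' c' s₁' s₂' b' δ') (t : ℝ) :
    Tendsto (fun k => ∫ d, Complex.exp (Complex.I * (t *
        (((oracleMean (f k) (g k) d.1 - c k) - (oracleMean (f k) (g' k) d.2 - c' k))
          / √(asymVar (s₁ k) (s₂ k) (n₁ k) (m₁ k) + asymVar (s₁' k) (s₂' k) (n₂ k) (m₂ k))) : ℝ))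
        ∂((groupLaw (P k) (ρ k) (n₁ k) (m₁ k)).prod (groupLaw (Q k) (ρ' k) (n₂ k) (m₂ k)))) atTop
      (𝓝 (Complex.exp (-(t ^ 2 : ℝ) / 2))) := by
  set A : ℕ → ℝ := fun k => asymVar (s₁ k) (s₂ k) (n₁ k) (m₁ k) with hA
  set B : ℕ → ℝ := fun k => asymVar (s₁' k) (s₂' k) (n₂ k) (m₂ k) with hB
  set u : ℕ → ℝ := fun k => t / √(A k + B k) with hu
  have hAu : ∀ᶠ k in atTop, |u k| * √(A k) ≤ |t| := by
    filter_upwards [G.asymVar_pos, G'.asymVar_pos] with k h1 h2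
    have h3 : √(A k) ≤ √(A k + B k) := Real.sqrt_le_sqrt (by linarith)
    rw [hu, abs_div, abs_of_nonneg (Real.sqrt_nonneg _), div_mul_eq_mul_div,
      div_le_iff₀ (Real.sqrt_pos.2 (by linarith))]
    exact mul_le_mul_of_nonneg_left h3 (abs_nonneg _)
  have hBu : ∀ᶠ k in atTop, |-u k| * √(B k) ≤ |t| := by
    filter_upwards [G.asymVar_pos, G'.asymVar_pos] with k h1 h2
    have h3 : √(B k) ≤ √(A k + B k) := Real.sqrt_le_sqrt (by linarith)
    rw [hu, abs_neg, abs_div, abs_of_nonneg (Real.sqrt_nonneg _), div_mul_eq_mul_div,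
      div_le_iff₀ (Real.sqrt_pos.2 (by linarith))]
    exact mul_le_mul_of_nonneg_left h3 (abs_nonneg _)
  have hX := G.tendsto_integral_cexp_oracleMean u t hAu
  have hY := G'.tendsto_integral_cexp_oracleMean (fun k => -u k) t hBu
  have hXY := hX.add hY
  rw [add_zero] at hXY
  rw [tendsto_iff_norm_sub_tendsto_zero]
  refine squeeze_zero' (Eventually.of_forall fun _ => norm_nonneg _) ?_ hXY
  filter_upwards [G.asymVar_pos, G'.asymVar_pos] with k h1 h2
  have hlim : Complex.exp (-(t ^ 2 : ℝ) / 2) = Complex.exp (-(u k ^ 2 * A k : ℝ) / 2)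
      * Complex.exp (-((-u k) ^ 2 * B k : ℝ) / 2) := by
    rw [← Complex.exp_add]
    congr 1
    have h3 : t ^ 2 = u k ^ 2 * A k + (-u k) ^ 2 * B k := by
      have h4 : 0 < A k + B k := by linarith
      rw [neg_sq, ← mul_add, hu, div_pow, Real.sq_sqrt h4.le, div_mul_cancel₀ _ h4.ne']
    rw [h3]
    push_cast
    ring
  have hsplit : ∀ d : GroupSample (𝒳 k) (𝒱 k) (S k) (n₁ k) (m₁ k)
      × GroupSample (𝒳 k) (𝒱 k) (S' k) (n₂ k) (m₂ k),
      Complex.exp (Complex.I * (t *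
        (((oracleMean (f k) (g k) d.1 - c k) - (oracleMean (f k) (g' k) d.2 - c' k))
          / √(A k + B k)) : ℝ))
      = Complex.exp (Complex.I * (u k * (oracleMean (f k) (g k) d.1 - c k) : ℝ))
        * Complex.exp (Complex.I * (-u k * (oracleMean (f k) (g' k) d.2 - c' k) : ℝ)) := by
    intro d
    rw [← Complex.exp_add, ← mul_add, ← Complex.ofReal_add]
    congr 3
    rw [hu]
    ring
  have hprod := (integral_congr_ae (Eventually.of_forall hsplit)).trans (integral_prod_mul
    (μ := groupLaw (P k) (ρ k) (n₁ k) (m₁ k)) (ν := groupLaw (Q k) (ρ' k) (n₂ k) (m₂ k))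
    (fun d => Complex.exp (Complex.I * (u k * (oracleMean (f k) (g k) d - c k) : ℝ)))
    (fun d => Complex.exp (Complex.I * (-u k * (oracleMean (f k) (g' k) d - c' k) : ℝ))))
  refine (congrArg (fun z => ‖z - Complex.exp (-(t ^ 2 : ℝ) / 2)‖) hprod).trans_le ?_
  rw [hlim]
  refine norm_mul_sub_mul_le (norm_integral_cexp_le_one
    (ν := groupLaw (P k) (ρ k) (n₁ k) (m₁ k)) _) ?_
  rw [Complex.norm_exp]
  have h3 : (-((-u k) ^ 2 * B k : ℝ) / 2 : ℂ).re = -((-u k) ^ 2 * B k) / 2 := by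
    rw [← Complex.ofReal_neg, ← Complex.ofReal_ofNat, ← Complex.ofReal_div, Complex.ofReal_re]
  rw [h3, Real.exp_le_one_iff]
  have : 0 ≤ (-u k) ^ 2 * B k := mul_nonneg (sq_nonneg _) h2.le
  linarith

/-- The rejection probability of the cross-fit test for a fixed function. -/
theorem tendsto_measureReal_studentized_sub
    (G : AsymptoticGroup P ρ n₁ m₁ f g ghat c s₁ s₂ b δ)
    (G' : AsymptoticGroup Q ρ' n₂ m₂ f g' ghat' c' s₁' s₂' b' δ') (hf : ∀ k, Measurable (f k))
    (z : ℝ) :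
    Tendsto (fun k => ((groupLaw (P k) (ρ k) (n₁ k) (m₁ k)).prod
        (groupLaw (Q k) (ρ' k) (n₂ k) (m₂ k))).real
          {d | z < studentized (groupEstimates (f k) (crossFit (ghat k) d.1) d.1)
            (groupEstimates (f k) (crossFit (ghat' k) d.2) d.2)}
        - stdNormalCDF ((c k - c' k)
          / √(asymVar (s₁ k) (s₂ k) (n₁ k) (m₁ k) + asymVar (s₁' k) (s₂' k) (n₂ k) (m₂ k)) - z))
      atTop (𝓝 0) := by
  set A : ℕ → ℝ := fun k => asymVar (s₁ k) (s₂ k) (n₁ k) (m₁ k) with hA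
  set B : ℕ → ℝ := fun k => asymVar (s₁' k) (s₂' k) (n₂ k) (m₂ k) with hB
  have h := tendsto_measureReal_sub_stdNormalCDF
    (μ := fun k => (groupLaw (P k) (ρ k) (n₁ k) (m₁ k)).prod
        (groupLaw (Q k) (ρ' k) (n₂ k) (m₂ k)))
    (N := fun k d => ((oracleMean (f k) (g k) d.1 - c k) - (oracleMean (f k) (g' k) d.2 - c' k))
          / √(A k + B k))
    (e := fun k d => ((crossMean (ghat k) (f k) d.1 - oracleMean (f k) (g k) d.1)
      - (crossMean (ghat' k) (f k) d.2 - oracleMean (f k) (g' k) d.2)) / √(A k + B k))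
    (R := fun k d => (crossVar (ghat k) (f k) d.1 + crossVar (ghat' k) (f k) d.2) / (A k + B k))
    (fun k => ((((measurable_oracleMean (hf k) (G.measurable k)).comp measurable_fst).sub_const
      _).sub (((measurable_oracleMean (hf k) (G'.measurable k)).comp
        measurable_snd).sub_const _)).div_const _)
    (tendsto_integral_cexp_oracleMean_sub G G') ?_ ?_ z (fun k => (c k - c' k) / √(A k + B k))
  · refine h.congr' ?_
    filter_upwards [G.asymVar_pos, G'.asymVar_pos] with k h1 h2
    have h3 : 0 < √(A k + B k) := Real.sqrt_pos.2 (by linarith)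
    congr 3
    ext d
    change (z < _ ↔ z < (crossMean (ghat k) (f k) d.1 - crossMean (ghat' k) (f k) d.2)
      / √(crossVar (ghat k) (f k) d.1 + crossVar (ghat' k) (f k) d.2))
    have h4 : ((oracleMean (f k) (g k) d.1 - c k) - (oracleMean (f k) (g' k) d.2 - c' k))
          / √(A k + B k) + ((crossMean (ghat k) (f k) d.1 - oracleMean (f k) (g k) d.1)
      - (crossMean (ghat' k) (f k) d.2 - oracleMean (f k) (g' k) d.2)) / √(A k + B k)
        + (c k - c' k) / √(A k + B k)
        = (crossMean (ghat k) (f k) d.1 - crossMean (ghat' k) (f k) d.2) / √(A k + B k) := by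
      ring
    rw [h4, Real.sqrt_div' _ (by linarith), div_div_div_cancel_right₀ h3.ne']
  · refine ((VanishesInProb.of_le (X := fun k d => |_|) G.vanishes_crossMean_sub
      (Eventually.of_forall fun k d => (abs_abs _).le)).fst.add
      (VanishesInProb.of_le (X := fun k d => |_|) G'.vanishes_crossMean_sub
      (Eventually.of_forall fun k d => (abs_abs _).le)).snd).of_le ?_
    filter_upwards [G.asymVar_pos, G'.asymVar_pos] with k h1 h2 d
    exact (abs_sub_div_sqrt_add_le h1 h2).trans (le_abs_self _)
  · refine ((VanishesInProb.of_le (X := fun k d => |_|) G.vanishes_crossVar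
      (Eventually.of_forall fun k d => (abs_abs _).le)).fst.add
      (VanishesInProb.of_le (X := fun k d => |_|) G'.vanishes_crossVar
      (Eventually.of_forall fun k d => (abs_abs _).le)).snd).of_le ?_
    filter_upwards [G.asymVar_pos, G'.asymVar_pos] with k h1 h2 d
    exact (abs_div_add_sub_one_le h1 h2).trans (le_abs_self _)

end

/-! ### Uniformity in the function -/

/-- The conditions on one group, for a fixed function `f` with regression function `g`, at a fixed
sample size: the moment ratio and the relative risk are at most `η`, in the units of the theorem. -/
structure AdmissibleFit {𝒳 𝒱 S : Type*} [MeasurableSpace 𝒳] [MeasurableSpace 𝒱]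
    [MeasurableSpace S] (P : Measure (𝒳 × 𝒱)) (ρ : Measure S) (n : ℕ) (δ η : ℝ) (f : 𝒳 → ℝ)
    (g : 𝒱 → ℝ) (ghat : S → (Fin (n / 2) → 𝒳 × 𝒱) → 𝒱 → ℝ) : Prop where
  measurable_fun : Measurable f
  measurable : Measurable g
  measurable_fit : Measurable fun q : S × (Fin (n / 2) → 𝒳 × 𝒱) × 𝒱 => ghat q.1 q.2.1 q.2.2
  ae_eq : (fun p : 𝒳 × 𝒱 => g p.2) =ᵐ[P] condMean P f
  moment : momentRatio P δ f ≤ ENNReal.ofReal (η * (n : ℝ) ^ (δ / 2))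
  risk : riskRatio P ρ f ghat ≤ ENNReal.ofReal (η * 1)

section

variable {𝒳 𝒱 S : Type*} [MeasurableSpace 𝒳] [MeasurableSpace 𝒱]
  [MeasurableSpace S] {P : Measure (𝒳 × 𝒱)} {ρ : Measure S} {n : ℕ} {δ η : ℝ} {f : 𝒳 → ℝ}
  {g : 𝒱 → ℝ} {ghat : S → (Fin (n / 2) → 𝒳 × 𝒱) → 𝒱 → ℝ}

theorem AdmissibleFit.measurable_fitError (h : AdmissibleFit P ρ n δ η f g ghat) :
    Measurable fun q : S × (Fin (n / 2) → 𝒳 × 𝒱) × 𝒱 => fitError ghat g q.1 q.2.1 q.2.2 :=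
  h.measurable_fit.sub (h.measurable.comp (measurable_snd.comp measurable_snd))

end

theorem asymptoticGroup_of_admissibleFit {𝒳 𝒱 S : ℕ → Type*} [∀ k, MeasurableSpace (𝒳 k)]
    [∀ k, MeasurableSpace (𝒱 k)] [∀ k, MeasurableSpace (S k)] {P : ∀ k, Measure (𝒳 k × 𝒱 k)}
    [∀ k, IsProbabilityMeasure (P k)] {ρ : ∀ k, Measure (S k)} [∀ k, IsProbabilityMeasure (ρ k)]
    {n m : ℕ → ℕ} {f : ∀ k, 𝒳 k → ℝ} {g : ∀ k, 𝒱 k → ℝ}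
    {ghat : ∀ k, S k → (Fin (n k / 2) → 𝒳 k × 𝒱 k) → 𝒱 k → ℝ} {η : ℕ → ℝ} {δ : ℝ}
    (hn : ∀ k, Even (n k)) (hm : ∀ k, Even (m k)) (hlim : Tendsto n atTop atTop) (hδ : 0 < δ)
    (hη0 : ∀ k, 0 < η k) (hη : Tendsto η atTop (𝓝 0))
    (h : ∀ k, AdmissibleFit (P k) (ρ k) (n k) δ (η k) (f k) (g k) (ghat k)) :
    AsymptoticGroup P ρ n m f g ghat (fun k => popMean (P k) (f k))
      (fun k => sigmaSq₁ (P k) (f k)) (fun k => sigmaSq₂ (P k) (f k))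
      (fun k => 2 ^ (2 + δ) * (η k * (n k : ℝ) ^ (δ / 2) + η k * (n k : ℝ) ^ (δ / 2))) δ := by
  have hD : ∀ k, Decomposition (P k) (fun p => f k p.1 - g k p.2)
      (fun p => g k p.2 - popMean (P k) (f k)) δ (sigmaSq₁ (P k) (f k)) (sigmaSq₂ (P k) (f k))
      (2 ^ (2 + δ) * (η k * (n k : ℝ) ^ (δ / 2) + η k * (n k : ℝ) ^ (δ / 2))) := fun k =>
    decomposition_of_momentRatio hδ (h k).measurable_fun (h k).measurable (h k).ae_eq
      (mul_nonneg (hη0 k).le (by positivity)) (h k).moment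
  refine ⟨hn, hm, hlim, hδ, fun k => (h k).measurable, fun k => (h k).measurable_fitError,
    Eventually.of_forall hD, ?_, ?_⟩
  · have h1 : Tendsto (fun k => 2 ^ (2 + δ) * (η k + η k)) atTop (𝓝 0) := by
      simpa using (hη.add hη).const_mul (2 ^ (2 + δ))
    refine h1.congr' ?_
    filter_upwards [hlim.eventually_gt_atTop 0] with k hk
    have hk' : (0 : ℝ) < n k := by exact_mod_cast hk
    have h2 : (n k : ℝ) ^ (δ / 2) * √(n k : ℝ) ^ (-δ) = 1 := by
      rw [Real.sqrt_eq_rpow, ← Real.rpow_mul hk'.le, ← Real.rpow_add hk']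
      ring_nf
      exact Real.rpow_zero _
    linear_combination (-2 * 2 ^ (2 + δ) * η k) * h2
  · have h1 : Tendsto (fun k => ENNReal.ofReal (η k * 1)) atTop (𝓝 0) := by
      simpa using ENNReal.tendsto_ofReal hη
    refine tendsto_of_tendsto_of_tendsto_of_le_of_le tendsto_const_nhds h1
      (fun _ => zero_le) fun k => ?_
    have h2 := (h k).risk
    rwa [riskRatio, ratio, if_pos (lt_min (hD k).pos₁ (hD k).pos₂),
      l2Risk_eq_fitRisk (h k).ae_eq (h k).measurable_fitError] at h2

/-- The difference between the power of the cross-fit test and the power expression, for a fixed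
function `f`. -/
def powerGap {𝒳 𝒱 S S' : Type*} [MeasurableSpace 𝒳] [MeasurableSpace 𝒱] [MeasurableSpace S]
    [MeasurableSpace S'] (α : ℝ) (P Q : Measure (𝒳 × 𝒱)) (ρ : Measure S) (ρ' : Measure S')
    (n₁ m₁ n₂ m₂ : ℕ) (f : 𝒳 → ℝ) (ghat : S → (Fin (n₁ / 2) → 𝒳 × 𝒱) → 𝒱 → ℝ)
    (ghat' : S' → (Fin (n₂ / 2) → 𝒳 × 𝒱) → 𝒱 → ℝ) : ℝ :=
  power ((groupLaw P ρ n₁ m₁).prod (groupLaw Q ρ' n₂ m₂))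
      (fun d => studentized (groupEstimates f (crossFit ghat d.1) d.1)
        (groupEstimates f (crossFit ghat' d.2) d.2)) α
    - powerExpression α P Q f n₁ m₁ n₂ m₂

/-- The fixed-function result along an arbitrary sequence of sample spaces, laws, functions and
estimators. -/
theorem tendsto_powerGap {𝒳 𝒱 S S' : ℕ → Type*} [∀ k, MeasurableSpace (𝒳 k)]
    [∀ k, MeasurableSpace (𝒱 k)] [∀ k, MeasurableSpace (S k)] [∀ k, MeasurableSpace (S' k)]
    {P Q : ∀ k, Measure (𝒳 k × 𝒱 k)}
    [∀ k, IsProbabilityMeasure (P k)] [∀ k, IsProbabilityMeasure (Q k)]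
    {ρ : ∀ k, Measure (S k)} [∀ k, IsProbabilityMeasure (ρ k)]
    {ρ' : ∀ k, Measure (S' k)} [∀ k, IsProbabilityMeasure (ρ' k)]
    {n₁ m₁ n₂ m₂ : ℕ → ℕ} {f : ∀ k, 𝒳 k → ℝ} {g g' : ∀ k, 𝒱 k → ℝ}
    {ghat : ∀ k, S k → (Fin (n₁ k / 2) → 𝒳 k × 𝒱 k) → 𝒱 k → ℝ}
    {ghat' : ∀ k, S' k → (Fin (n₂ k / 2) → 𝒳 k × 𝒱 k) → 𝒱 k → ℝ}
    {α δ : ℝ} (hα : α ∈ Set.Ioo (0 : ℝ) 1) {η : ℕ → ℝ}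
    (hn₁ : ∀ k, Even (n₁ k)) (hm₁ : ∀ k, Even (m₁ k))
    (hn₂ : ∀ k, Even (n₂ k)) (hm₂ : ∀ k, Even (m₂ k))
    (hlim₁ : Tendsto n₁ atTop atTop) (hlim₂ : Tendsto n₂ atTop atTop) (hδ : 0 < δ)
    (hη0 : ∀ k, 0 < η k) (hη : Tendsto η atTop (𝓝 0))
    (h : ∀ k, AdmissibleFit (P k) (ρ k) (n₁ k) δ (η k) (f k) (g k) (ghat k))
    (h' : ∀ k, AdmissibleFit (Q k) (ρ' k) (n₂ k) δ (η k) (f k) (g' k) (ghat' k)) :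
    Tendsto (fun k => powerGap α (P k) (Q k) (ρ k) (ρ' k) (n₁ k) (m₁ k) (n₂ k) (m₂ k) (f k)
      (ghat k) (ghat' k)) atTop (𝓝 0) := by
  have key := tendsto_measureReal_studentized_sub
    (asymptoticGroup_of_admissibleFit hn₁ hm₁ hlim₁ hδ hη0 hη h)
    (asymptoticGroup_of_admissibleFit hn₂ hm₂ hlim₂ hδ hη0 hη h')
    (fun k => (h k).measurable_fun) (stdNormalQuantile (1 - α))
  refine key.congr fun k => ?_
  rw [powerGap, power, powerExpression, stdNormalQuantile_one_sub hα, sub_neg_eq_add,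
    add_comm (stdNormalQuantile α)]
  rfl

/-- The power approximation holds uniformly over all functions and estimators for which the moment
ratios and relative risks are small. -/
theorem exists_forall_abs_powerGap_lt {𝒳 𝒱 S S' : ℕ → Type*} [∀ k, MeasurableSpace (𝒳 k)]
    [∀ k, MeasurableSpace (𝒱 k)] [∀ k, MeasurableSpace (S k)] [∀ k, MeasurableSpace (S' k)]
    (P Q : ∀ k, Measure (𝒳 k × 𝒱 k))
    [∀ k, IsProbabilityMeasure (P k)] [∀ k, IsProbabilityMeasure (Q k)]
    (ρ : ∀ k, Measure (S k)) [∀ k, IsProbabilityMeasure (ρ k)]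
    (ρ' : ∀ k, Measure (S' k)) [∀ k, IsProbabilityMeasure (ρ' k)]
    {n₁ m₁ n₂ m₂ : ℕ → ℕ} {α δ : ℝ} (hα : α ∈ Set.Ioo (0 : ℝ) 1)
    (hn₁ : ∀ k, Even (n₁ k)) (hm₁ : ∀ k, Even (m₁ k))
    (hn₂ : ∀ k, Even (n₂ k)) (hm₂ : ∀ k, Even (m₂ k))
    (hlim₁ : Tendsto n₁ atTop atTop) (hlim₂ : Tendsto n₂ atTop atTop) (hδ : 0 < δ)
    {ε : ℝ} (hε : 0 < ε) :
    ∃ η : ℝ, 0 < η ∧ ∀ᶠ k in atTop, ∀ f g g' ghat ghat',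
      AdmissibleFit (P k) (ρ k) (n₁ k) δ η f g ghat →
      AdmissibleFit (Q k) (ρ' k) (n₂ k) δ η f g' ghat' →
      |powerGap α (P k) (Q k) (ρ k) (ρ' k) (n₁ k) (m₁ k) (n₂ k) (m₂ k) f ghat ghat'| < ε := by
  by_contra hcon
  push Not at hcon
  -- otherwise there are functions, at a sequence of sample sizes, that violate the pointwise result
  have h1 : ∀ j : ℕ, ∃ k, j ≤ k ∧ ∃ f g g' ghat ghat',
      AdmissibleFit (P k) (ρ k) (n₁ k) δ (1 / ((j : ℝ) + 1)) f g ghat ∧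
      AdmissibleFit (Q k) (ρ' k) (n₂ k) δ (1 / ((j : ℝ) + 1)) f g' ghat' ∧
      ε ≤ |powerGap α (P k) (Q k) (ρ k) (ρ' k) (n₁ k) (m₁ k) (n₂ k) (m₂ k) f ghat ghat'| :=
    fun j => frequently_atTop.1 (hcon (1 / ((j : ℝ) + 1)) (by positivity)) j
  choose κ hκ f g g' ghat ghat' hX hY hlarge using h1
  have hκ' : Tendsto κ atTop atTop := tendsto_atTop_mono hκ tendsto_id
  have h2 := tendsto_powerGap (m₁ := fun j => m₁ (κ j)) (m₂ := fun j => m₂ (κ j)) hα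
    (fun j => hn₁ (κ j)) (fun j => hm₁ (κ j)) (fun j => hn₂ (κ j)) (fun j => hm₂ (κ j))
    (hlim₁.comp hκ') (hlim₂.comp hκ') hδ (fun j => by positivity)
    tendsto_one_div_add_atTop_nhds_zero_nat hX hY
  obtain ⟨j, hj⟩ := ((tendsto_zero_iff_abs_tendsto_zero _).1 h2 |>.eventually_lt_const hε).exists
  exact absurd hj (not_lt.2 (hlarge j))

/-! ### Measurability in the random function -/

section

variable {A : Type*} [MeasurableSpace A] {n m : ℕ}

theorem measurable_muHat {y h : A → Fin n → ℝ} {u : A → Fin m → ℝ} (hy : Measurable y)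
    (hh : Measurable h) (hu : Measurable u) : Measurable fun a => muHat (y a) (h a) (u a) := by
  unfold muHat
  fun_prop

theorem measurable_sigmaSqHat {y h : A → Fin n → ℝ} {u : A → Fin m → ℝ} (hy : Measurable y)
    (hh : Measurable h) (hu : Measurable u) :
    Measurable fun a => sigmaSqHat (y a) (h a) (u a) := by
  unfold sigmaSqHat sigmaSqHat₁ sigmaSqHat₂ pooledMean
  fun_prop

theorem measurable_studentized {a b : A → ℝ × ℝ} (ha : Measurable a) (hb : Measurable b) :
    Measurable fun x => studentized (a x) (b x) := by
  unfold studentized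
  exact (ha.fst.sub hb.fst).div (ha.snd.add hb.snd).sqrt

end

section

variable {𝒳 𝒱 Θ S S' : Type*} [MeasurableSpace 𝒳] [MeasurableSpace 𝒱] [MeasurableSpace Θ]
  [MeasurableSpace S] [MeasurableSpace S'] {n m : ℕ} {F : Θ → 𝒳 → ℝ}
  (hF : Measurable fun q : Θ × 𝒳 => F q.1 q.2)

theorem measurable_crossFit {ghat : Θ → S → (Fin (n / 2) → 𝒳 × 𝒱) → 𝒱 → ℝ}
    (hghat : Measurable fun q : Θ × S × (Fin (n / 2) → 𝒳 × 𝒱) × 𝒱 =>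
      ghat q.1 q.2.1 q.2.2.1 q.2.2.2) (i : ℕ) :
    Measurable fun q : Θ × GroupSample 𝒳 𝒱 S n m × 𝒱 => crossFit (ghat q.1) q.2.1 i q.2.2 := by
  unfold crossFit
  have hodd : Measurable fun q : Θ × GroupSample 𝒳 𝒱 S n m × 𝒱 => oddFold q.2.1.1 := by
    unfold oddFold
    fun_prop
  have heven : Measurable fun q : Θ × GroupSample 𝒳 𝒱 S n m × 𝒱 => evenFold q.2.1.1 := by
    unfold evenFold
    fun_prop
  split_ifs
  · exact hghat.comp (measurable_fst.prodMk ((by fun_prop :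
      Measurable fun q : Θ × GroupSample 𝒳 𝒱 S n m × 𝒱 => q.2.1.2.2.1).prodMk
        (hodd.prodMk (by fun_prop))))
  · exact hghat.comp (measurable_fst.prodMk ((by fun_prop :
      Measurable fun q : Θ × GroupSample 𝒳 𝒱 S n m × 𝒱 => q.2.1.2.2.2).prodMk
        (heven.prodMk (by fun_prop))))

include hF in
theorem measurable_groupEstimates {ghat : Θ → S → (Fin (n / 2) → 𝒳 × 𝒱) → 𝒱 → ℝ}
    (hghat : Measurable fun q : Θ × S × (Fin (n / 2) → 𝒳 × 𝒱) × 𝒱 =>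
      ghat q.1 q.2.1 q.2.2.1 q.2.2.2) :
    Measurable fun q : Θ × GroupSample 𝒳 𝒱 S n m =>
      groupEstimates (F q.1) (crossFit (ghat q.1) q.2) q.2 := by
  have hy : Measurable fun (q : Θ × GroupSample 𝒳 𝒱 S n m) (i : Fin n) => F q.1 (q.2.1 i).1 :=
    measurable_pi_lambda _ fun i => hF.comp (by fun_prop :
      Measurable fun q : Θ × GroupSample 𝒳 𝒱 S n m => (q.1, (q.2.1 i).1))
  have hh : Measurable fun (q : Θ × GroupSample 𝒳 𝒱 S n m) (i : Fin n) =>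
      crossFit (ghat q.1) q.2 (i + 1) (q.2.1 i).2 :=
    measurable_pi_lambda _ fun i => (measurable_crossFit hghat (i + 1)).comp (by fun_prop :
      Measurable fun q : Θ × GroupSample 𝒳 𝒱 S n m => (q.1, q.2, (q.2.1 i).2))
  have hu : Measurable fun (q : Θ × GroupSample 𝒳 𝒱 S n m) (j : Fin m) =>
      crossFit (ghat q.1) q.2 (n + j + 1) (q.2.2.1 j) :=
    measurable_pi_lambda _ fun j => (measurable_crossFit hghat (n + j + 1)).comp (by fun_prop :
      Measurable fun q : Θ × GroupSample 𝒳 𝒱 S n m => (q.1, q.2, q.2.2.1 j))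
  exact (measurable_muHat hy hh hu).prodMk (measurable_sigmaSqHat hy hh hu)

include hF in
theorem measurable_crossStat {n₁ m₁ n₂ m₂ : ℕ}
    {ghat : Θ → S → (Fin (n₁ / 2) → 𝒳 × 𝒱) → 𝒱 → ℝ}
    {ghat' : Θ → S' → (Fin (n₂ / 2) → 𝒳 × 𝒱) → 𝒱 → ℝ}
    (hghat : Measurable fun q : Θ × S × (Fin (n₁ / 2) → 𝒳 × 𝒱) × 𝒱 =>
      ghat q.1 q.2.1 q.2.2.1 q.2.2.2)
    (hghat' : Measurable fun q : Θ × S' × (Fin (n₂ / 2) → 𝒳 × 𝒱) × 𝒱 =>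
      ghat' q.1 q.2.1 q.2.2.1 q.2.2.2) :
    Measurable (crossStat F ghat ghat' :
      Θ × GroupSample 𝒳 𝒱 S n₁ m₁ × GroupSample 𝒳 𝒱 S' n₂ m₂ → ℝ) := by
  have h1 := measurable_groupEstimates (m := m₁) hF hghat
  have h2 := measurable_groupEstimates (m := m₂) hF hghat'
  have p1 : Measurable fun d : Θ × GroupSample 𝒳 𝒱 S n₁ m₁ × GroupSample 𝒳 𝒱 S' n₂ m₂ =>
    (d.1, d.2.1) := measurable_fst.prodMk (measurable_fst.comp measurable_snd)
  have p2 : Measurable fun d : Θ × GroupSample 𝒳 𝒱 S n₁ m₁ × GroupSample 𝒳 𝒱 S' n₂ m₂ =>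
    (d.1, d.2.2) := measurable_fst.prodMk (measurable_snd.comp measurable_snd)
  exact measurable_studentized (h1.comp p1) (h2.comp p2)

include hF in
theorem measurable_popMean (P : Measure (𝒳 × 𝒱)) [IsProbabilityMeasure P] :
    Measurable fun θ => popMean P (F θ) := by
  have h : StronglyMeasurable fun q : Θ × (𝒳 × 𝒱) => F q.1 q.2.1 :=
    (hF.comp (measurable_fst.prodMk (measurable_fst.comp measurable_snd))).stronglyMeasurable
  exact h.integral_prod_right.measurable

include hF in
theorem aemeasurable_sigmaSq {τ : Measure Θ} {P : Measure (𝒳 × 𝒱)} [IsProbabilityMeasure P]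
    {g : Θ → 𝒱 → ℝ} (hg : IsRegression τ P F g) (n m : ℕ) :
    AEMeasurable (fun θ => sigmaSq P (F θ) n m) τ := by
  have hf : Measurable fun q : Θ × (𝒳 × 𝒱) => F q.1 q.2.1 :=
    hF.comp (measurable_fst.prodMk (measurable_fst.comp measurable_snd))
  have hg' : Measurable fun q : Θ × (𝒳 × 𝒱) => g q.1 q.2.2 :=
    hg.measurable.comp (measurable_fst.prodMk (measurable_snd.comp measurable_snd))
  have h1 : Measurable fun θ => ∫ p, (F θ p.1 - g θ p.2) ^ 2 ∂P :=
    ((hf.sub hg').pow_const 2).stronglyMeasurable.integral_prod_right.measurable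
  have hmean : Measurable fun θ => ∫ p, g θ p.2 ∂P :=
    hg'.stronglyMeasurable.integral_prod_right.measurable
  have h2 : Measurable fun θ => ∫ p, (g θ p.2 - ∫ p', g θ p'.2 ∂P) ^ 2 ∂P :=
    ((hg'.sub (hmean.comp measurable_fst)).pow_const
      2).stronglyMeasurable.integral_prod_right.measurable
  refine AEMeasurable.congr ((h1.div_const (n : ℝ)).add
    (h2.div_const ((n : ℝ) + m))).aemeasurable ?_
  filter_upwards [hg.ae_eq] with θ hθ
  have e1 : sigmaSq₁ P (F θ) = ∫ p, (F θ p.1 - g θ p.2) ^ 2 ∂P := by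
    rw [sigmaSq₁, condVar, integral_condExp covariateSigma_le]
    refine integral_congr_ae (hθ.mono fun p hp => ?_)
    simp only [condMean] at hp
    simp only [Pi.pow_apply, Pi.sub_apply, hp]
  have e2 : sigmaSq₂ P (F θ) = ∫ p, (g θ p.2 - ∫ p', g θ p'.2 ∂P) ^ 2 ∂P := by
    have hgθ : Measurable fun p : 𝒳 × 𝒱 => g θ p.2 :=
      hg'.comp (measurable_const.prodMk measurable_id)
    rw [sigmaSq₂, ← variance_congr hθ, variance_eq_integral hgθ.aemeasurable]
  simp only [Pi.add_apply, sigmaSq, e1, e2]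

include hF in
theorem aestronglyMeasurable_powerExpression {τ : Measure Θ} {P Q : Measure (𝒳 × 𝒱)}
    [IsProbabilityMeasure P] [IsProbabilityMeasure Q] {g g' : Θ → 𝒱 → ℝ}
    (hg : IsRegression τ P F g) (hg' : IsRegression τ Q F g') (α : ℝ) (n₁ m₁ n₂ m₂ : ℕ) :
    AEStronglyMeasurable (fun θ => powerExpression α P Q (F θ) n₁ m₁ n₂ m₂) τ := by
  have h : AEMeasurable (fun θ => stdNormalQuantile α + (popMean P (F θ) - popMean Q (F θ)) /
      √(sigmaSq P (F θ) n₁ m₁ + sigmaSq Q (F θ) n₂ m₂)) τ :=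
    (((measurable_popMean hF P).sub (measurable_popMean hF Q)).aemeasurable.div
      ((aemeasurable_sigmaSq hF hg n₁ m₁).add (aemeasurable_sigmaSq hF hg' n₂ m₂)).sqrt).const_add _
  exact (monotone_stdNormalCDF.measurable.comp_aemeasurable h).aestronglyMeasurable

/-- The power for random `f` is the average of the powers for fixed `f`. -/
theorem power_jointLaw {τ : Measure Θ} [IsProbabilityMeasure τ] {P Q : Measure (𝒳 × 𝒱)}
    [IsProbabilityMeasure P] [IsProbabilityMeasure Q] {ρ : Measure S} [IsProbabilityMeasure ρ]
    {ρ' : Measure S'} [IsProbabilityMeasure ρ'] {n₁ m₁ n₂ m₂ : ℕ}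
    {T : Θ × GroupSample 𝒳 𝒱 S n₁ m₁ × GroupSample 𝒳 𝒱 S' n₂ m₂ → ℝ} (hT : Measurable T)
    (α : ℝ) :
    Integrable (fun θ => power ((groupLaw P ρ n₁ m₁).prod (groupLaw Q ρ' n₂ m₂))
      (fun d => T (θ, d)) α) τ ∧
    power (jointLaw τ P Q ρ ρ' n₁ m₁ n₂ m₂) T α
      = ∫ θ, power ((groupLaw P ρ n₁ m₁).prod (groupLaw Q ρ' n₂ m₂)) (fun d => T (θ, d)) α ∂τ := by
  have hE : MeasurableSet {d | stdNormalQuantile (1 - α) < T d} :=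
    measurableSet_lt measurable_const hT
  have hm := measurable_measure_prodMk_left (ν := (groupLaw P ρ n₁ m₁).prod (groupLaw Q ρ' n₂ m₂))
    hE
  refine ⟨?_, ?_⟩
  · refine Integrable.of_bound hm.ennreal_toReal.aestronglyMeasurable 1
      (Eventually.of_forall fun θ => ?_)
    rw [Real.norm_eq_abs, power, abs_of_nonneg measureReal_nonneg]
    exact measureReal_le_one
  · rw [power, jointLaw, Measure.real, Measure.prod_apply hE,
      ← integral_toReal hm.aemeasurable (Eventually.of_forall fun θ => measure_lt_top _ _)]
    rfl

end

/-- Bounded variables that vanish in probability have vanishing expectations. -/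
theorem VanishesInProb.tendsto_integral {Ω : ℕ → Type*} [∀ k, MeasurableSpace (Ω k)]
    {μ : ∀ k, Measure (Ω k)} [∀ k, IsProbabilityMeasure (μ k)] {X : ∀ k, Ω k → ℝ}
    (hX : VanishesInProb μ X) (hb : ∀ k ω, |X k ω| ≤ 1) :
    Tendsto (fun k => ∫ ω, X k ω ∂(μ k)) atTop (𝓝 0) := by
  rw [tendsto_zero_iff_abs_tendsto_zero]
  refine tendsto_zero_of_forall_le_add (fun k => abs_nonneg _) fun η hη =>
    ⟨fun k => (μ k).real {ω | η ≤ |X k ω|},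
      (ENNReal.tendsto_toReal ENNReal.zero_ne_top).comp (hX η hη), Eventually.of_forall fun k => ?_⟩
  set B := toMeasurable (μ k) {ω | η ≤ |X k ω|} with hB
  have hBm : MeasurableSet B := measurableSet_toMeasurable _ _
  have hint : Integrable (B.indicator fun _ => (1 : ℝ)) (μ k) :=
    (integrable_const _).indicator hBm
  calc |∫ ω, X k ω ∂(μ k)| ≤ ∫ ω, |X k ω| ∂(μ k) := abs_integral_le_integral_abs
    _ ≤ ∫ ω, (η + B.indicator (fun _ => (1 : ℝ)) ω) ∂(μ k) := by
        refine integral_mono_of_nonneg (Eventually.of_forall fun _ => abs_nonneg _)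
          ((integrable_const _).add hint) (Eventually.of_forall fun ω => ?_)
        by_cases hω : η ≤ |X k ω|
        · have : ω ∈ B := subset_toMeasurable _ _ hω
          simp only [Set.indicator_of_mem this]
          linarith [hb k ω]
        · have : 0 ≤ B.indicator (fun _ => (1 : ℝ)) ω :=
            Set.indicator_nonneg (fun _ _ => zero_le_one) _
          simp only
          linarith
    _ = η + (μ k).real {ω | η ≤ |X k ω|} := by
        rw [integral_add (integrable_const _) hint, integral_indicator_const _ hBm]
        rw [integral_const, probReal_univ, one_smul, smul_eq_mul, mul_one, hB, measureReal_def,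
          measureReal_def, measure_toMeasurable]

/-! ### Random functions -/

theorem power_nonneg {D : Type*} [MeasurableSpace D] (μ : Measure D) (T : D → ℝ) (α : ℝ) :
    0 ≤ power μ T α := measureReal_nonneg

theorem power_le_one {D : Type*} [MeasurableSpace D] (μ : Measure D) [IsProbabilityMeasure μ]
    (T : D → ℝ) (α : ℝ) : power μ T α ≤ 1 := measureReal_le_one

theorem abs_powerGap_le_one {𝒳 𝒱 S S' : Type*} [MeasurableSpace 𝒳] [MeasurableSpace 𝒱]
    [MeasurableSpace S] [MeasurableSpace S'] (α : ℝ) (P Q : Measure (𝒳 × 𝒱))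
    [IsProbabilityMeasure P] [IsProbabilityMeasure Q] (ρ : Measure S) [IsProbabilityMeasure ρ]
    (ρ' : Measure S') [IsProbabilityMeasure ρ'] (n₁ m₁ n₂ m₂ : ℕ) (f : 𝒳 → ℝ)
    (ghat : S → (Fin (n₁ / 2) → 𝒳 × 𝒱) → 𝒱 → ℝ) (ghat' : S' → (Fin (n₂ / 2) → 𝒳 × 𝒱) → 𝒱 → ℝ) :
    |powerGap α P Q ρ ρ' n₁ m₁ n₂ m₂ f ghat ghat'| ≤ 1 := by
  rw [powerGap, powerExpression, abs_le]
  constructor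
  · linarith [power_nonneg ((groupLaw P ρ n₁ m₁).prod (groupLaw Q ρ' n₂ m₂))
      (fun d => studentized (groupEstimates f (crossFit ghat d.1) d.1)
        (groupEstimates f (crossFit ghat' d.2) d.2)) α,
      stdNormalCDF_le_one (stdNormalQuantile α + (popMean P f - popMean Q f)
        / √(sigmaSq P f n₁ m₁ + sigmaSq Q f n₂ m₂))]
  · linarith [power_le_one ((groupLaw P ρ n₁ m₁).prod (groupLaw Q ρ' n₂ m₂))
      (fun d => studentized (groupEstimates f (crossFit ghat d.1) d.1)
        (groupEstimates f (crossFit ghat' d.2) d.2)) α,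
      stdNormalCDF_nonneg (stdNormalQuantile α + (popMean P f - popMean Q f)
        / √(sigmaSq P f n₁ m₁ + sigmaSq Q f n₂ m₂))]

section

variable {𝒳 𝒱 Θ S S' : ℕ → Type*}
    [∀ k, MeasurableSpace (𝒳 k)] [∀ k, MeasurableSpace (𝒱 k)] [∀ k, MeasurableSpace (Θ k)]
    [∀ k, MeasurableSpace (S k)] [∀ k, MeasurableSpace (S' k)]

/-- The power of the cross-fit test with arbitrary consistent estimators, exact regression
functions included, follows the power expression. -/
theorem tendsto_power_crossStat_sub {α δ : ℝ} (hα : α ∈ Set.Ioo (0 : ℝ) 1) (hδ : 0 < δ)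
    {n₁ m₁ n₂ m₂ : ℕ → ℕ}
    (hn₁ : ∀ k, Even (n₁ k)) (hm₁ : ∀ k, Even (m₁ k))
    (hn₂ : ∀ k, Even (n₂ k)) (hm₂ : ∀ k, Even (m₂ k))
    (hlim₁ : Tendsto n₁ atTop atTop) (hlim₂ : Tendsto n₂ atTop atTop)
    {P Q : ∀ k, Measure (𝒳 k × 𝒱 k)}
    [∀ k, IsProbabilityMeasure (P k)] [∀ k, IsProbabilityMeasure (Q k)]
    {τ : ∀ k, Measure (Θ k)} [∀ k, IsProbabilityMeasure (τ k)]
    {F : ∀ k, Θ k → 𝒳 k → ℝ} (hF : ∀ k, Measurable fun q : Θ k × 𝒳 k => F k q.1 q.2)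
    {gX gY : ∀ k, Θ k → 𝒱 k → ℝ}
    (hgX : ∀ k, IsRegression (τ k) (P k) (F k) (gX k))
    (hgY : ∀ k, IsRegression (τ k) (Q k) (F k) (gY k))
    {ρ : ∀ k, Measure (S k)} [∀ k, IsProbabilityMeasure (ρ k)]
    {ρ' : ∀ k, Measure (S' k)} [∀ k, IsProbabilityMeasure (ρ' k)]
    {ghatX : ∀ k, Θ k → S k → (Fin (n₁ k / 2) → 𝒳 k × 𝒱 k) → 𝒱 k → ℝ}
    {ghatY : ∀ k, Θ k → S' k → (Fin (n₂ k / 2) → 𝒳 k × 𝒱 k) → 𝒱 k → ℝ}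
    (hghatX : ∀ k, Measurable fun q : Θ k × S k × (Fin (n₁ k / 2) → 𝒳 k × 𝒱 k) × 𝒱 k =>
      ghatX k q.1 q.2.1 q.2.2.1 q.2.2.2)
    (hghatY : ∀ k, Measurable fun q : Θ k × S' k × (Fin (n₂ k / 2) → 𝒳 k × 𝒱 k) × 𝒱 k =>
      ghatY k q.1 q.2.1 q.2.2.1 q.2.2.2)
    (hmomX : IsLittleOP τ (fun k θ => momentRatio (P k) δ (F k θ)) fun k => (n₁ k : ℝ) ^ (δ / 2))
    (hmomY : IsLittleOP τ (fun k θ => momentRatio (Q k) δ (F k θ)) fun k => (n₂ k : ℝ) ^ (δ / 2))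
    (hriskX : IsLittleOP τ (fun k θ => riskRatio (P k) (ρ k) (F k θ) (ghatX k θ)) fun _ => 1)
    (hriskY : IsLittleOP τ (fun k θ => riskRatio (Q k) (ρ' k) (F k θ) (ghatY k θ)) fun _ => 1) :
    Tendsto (fun k =>
      power (jointLaw (τ k) (P k) (Q k) (ρ k) (ρ' k) (n₁ k) (m₁ k) (n₂ k) (m₂ k))
          (crossStat (F k) (ghatX k) (ghatY k)) α
        - ∫ θ, powerExpression α (P k) (Q k) (F k θ) (n₁ k) (m₁ k) (n₂ k) (m₂ k) ∂(τ k))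
      atTop (𝓝 0) := by
  have hvan : VanishesInProb τ fun k θ => powerGap α (P k) (Q k) (ρ k) (ρ' k) (n₁ k) (m₁ k) (n₂ k)
      (m₂ k) (F k θ) (ghatX k θ) (ghatY k θ) := by
    intro ε hε
    obtain ⟨η, hη, hk⟩ := exists_forall_abs_powerGap_lt P Q ρ ρ' hα hn₁ hm₁ hn₂ hm₂ hlim₁ hlim₂ hδ hε
    have hsum := ((hmomX η hη).add (hmomY η hη)).add ((hriskX η hη).add (hriskY η hη))
    simp only [add_zero] at hsum
    refine tendsto_of_tendsto_of_tendsto_of_le_of_le' tendsto_const_nhds hsum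
      (Eventually.of_forall fun _ => zero_le) ?_
    filter_upwards [hk] with k hk
    refine le_trans (measure_mono_ae ?_) ((measure_union_le _ _).trans
      (add_le_add (measure_union_le _ _) (measure_union_le _ _)))
    filter_upwards [(hgX k).ae_eq, (hgY k).ae_eq] with θ h1 h2 hθ
    by_contra hnot
    have hnot' := not_or.1 hnot
    have ha := not_or.1 hnot'.1
    have hb := not_or.1 hnot'.2
    refine absurd (hk (F k θ) (gX k θ) (gY k θ) (ghatX k θ) (ghatY k θ)
      ⟨(hF k).comp measurable_prodMk_left, (hgX k).measurable.comp measurable_prodMk_left,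
        (hghatX k).comp measurable_prodMk_left, h1, not_lt.1 ha.1, not_lt.1 hb.1⟩
      ⟨(hF k).comp measurable_prodMk_left, (hgY k).measurable.comp measurable_prodMk_left,
        (hghatY k).comp measurable_prodMk_left, h2, not_lt.1 ha.2, not_lt.1 hb.2⟩) (not_lt.2 hθ)
  refine (hvan.tendsto_integral fun k θ => abs_powerGap_le_one _ _ _ _ _ _ _ _ _ _ _ _).congr
    fun k => ?_
  obtain ⟨hint, heq⟩ := power_jointLaw (τ := τ k) (P := P k) (Q := Q k) (ρ := ρ k) (ρ' := ρ' k)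
    (measurable_crossStat (m₁ := m₁ k) (m₂ := m₂ k) (hF k) (hghatX k) (hghatY k)) α
  have hint' : Integrable
      (fun θ => powerExpression α (P k) (Q k) (F k θ) (n₁ k) (m₁ k) (n₂ k) (m₂ k)) (τ k) := by
    refine Integrable.of_bound (aestronglyMeasurable_powerExpression (hF k) (hgX k) (hgY k) α
      (n₁ k) (m₁ k) (n₂ k) (m₂ k)) 1 (Eventually.of_forall fun θ => ?_)
    rw [Real.norm_eq_abs, powerExpression, abs_of_nonneg (stdNormalCDF_nonneg _)]
    exact stdNormalCDF_le_one _
  rw [heq, ← integral_sub hint hint']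
  rfl

/-- The true regression function, used as its own estimator, has vanishing risk. -/
theorem isLittleOP_riskRatio_regression {δ : ℝ} (hδ : 0 < δ) {n : ℕ → ℕ}
    {P : ∀ k, Measure (𝒳 k × 𝒱 k)} [∀ k, IsProbabilityMeasure (P k)]
    {τ : ∀ k, Measure (Θ k)} {F : ∀ k, Θ k → 𝒳 k → ℝ}
    (hF : ∀ k, Measurable fun q : Θ k × 𝒳 k => F k q.1 q.2) {g : ∀ k, Θ k → 𝒱 k → ℝ}
    (hg : ∀ k, IsRegression (τ k) (P k) (F k) (g k))
    {ρ : ∀ k, Measure (S k)} [∀ k, IsProbabilityMeasure (ρ k)]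
    (hmom : IsLittleOP τ (fun k θ => momentRatio (P k) δ (F k θ)) fun k => (n k : ℝ) ^ (δ / 2)) :
    IsLittleOP τ (fun k θ => riskRatio (P k) (ρ k) (F k θ)
      (fun _ (_ : Fin (n k / 2) → 𝒳 k × 𝒱 k) => g k θ)) fun _ => 1 := by
  intro ε _
  refine tendsto_of_tendsto_of_tendsto_of_le_of_le tendsto_const_nhds (hmom 1 one_pos)
    (fun _ => zero_le) fun k => measure_mono_ae ?_
  filter_upwards [(hg k).ae_eq] with θ hθ hlt
  by_contra hM
  have hgm : Measurable (g k θ) := (hg k).measurable.comp measurable_prodMk_left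
  have hfit : Measurable fun q : S k × (Fin (n k / 2) → 𝒳 k × 𝒱 k) × 𝒱 k =>
      fitError (fun _ _ => g k θ) (g k θ) q.1 q.2.1 q.2.2 := by
    simp only [fitError, sub_self]
    exact measurable_const
  have hD := decomposition_of_momentRatio (f := F k θ) hδ ((hF k).comp measurable_prodMk_left) hgm
    hθ (by positivity) (not_lt.1 hM)
  have h0 : riskRatio (P k) (ρ k) (F k θ) (fun _ (_ : Fin (n k / 2) → 𝒳 k × 𝒱 k) => g k θ) = 0 := by
    rw [riskRatio, ratio, if_pos (lt_min hD.pos₁ hD.pos₂), l2Risk_eq_fitRisk hθ hfit]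
    simp [fitRisk, fitError]
  have hlt' : ENNReal.ofReal (ε * 1) < riskRatio (P k) (ρ k) (F k θ)
    (fun _ (_ : Fin (n k / 2) → 𝒳 k × 𝒱 k) => g k θ) := hlt
  rw [h0] at hlt'
  exact not_lt_zero hlt'

end

theorem oracleStat_eq_crossStat {𝒳 𝒱 Θ S S' : Type*} {n₁ m₁ n₂ m₂ : ℕ} (F : Θ → 𝒳 → ℝ)
    (gX gY : Θ → 𝒱 → ℝ) :
    (oracleStat F gX gY : Θ × GroupSample 𝒳 𝒱 S n₁ m₁ × GroupSample 𝒳 𝒱 S' n₂ m₂ → ℝ)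
      = crossStat F (fun θ _ _ => gX θ) (fun θ _ _ => gY θ) := by
  funext d
  simp only [oracleStat, crossStat, groupEstimates, crossFit, ite_self]

end SemiSupTest
end
open SemiSupTest in
theorem corollary1
    {𝒳 𝒱 Θ S S' : ℕ → Type*}
    [∀ k, MeasurableSpace (𝒳 k)] [∀ k, MeasurableSpace (𝒱 k)] [∀ k, MeasurableSpace (Θ k)]
    [∀ k, MeasurableSpace (S k)] [∀ k, MeasurableSpace (S' k)]
    -- level and sample sizes
    (α : ℝ) (hα : α ∈ Set.Ioo (0 : ℝ) 1)
    (n₁ m₁ n₂ m₂ : ℕ → ℕ)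
    (hn₁ : ∀ k, Even (n₁ k)) (hm₁ : ∀ k, Even (m₁ k))
    (hn₂ : ∀ k, Even (n₂ k)) (hm₂ : ∀ k, Even (m₂ k))
    (hn : Tendsto (fun k => min (n₁ k) (n₂ k)) atTop atTop)
    -- laws of `(X, V)` and `(Y, W)`
    (P Q : ∀ k, Measure (𝒳 k × 𝒱 k))
    [∀ k, IsProbabilityMeasure (P k)] [∀ k, IsProbabilityMeasure (Q k)]
    -- the random function `f`: parameter `θ` with law `τ`, and `f = F θ`
    (τ : ∀ k, Measure (Θ k)) [∀ k, IsProbabilityMeasure (τ k)]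
    (F : ∀ k, Θ k → 𝒳 k → ℝ)
    (hF : ∀ k, Measurable fun q : Θ k × 𝒳 k => F k q.1 q.2)
    -- versions of the conditional expectations of `f(X)` given `V` and of `f(Y)` given `W`
    (gX gY : ∀ k, Θ k → 𝒱 k → ℝ)
    (hgX : ∀ k, IsRegression (τ k) (P k) (F k) (gX k))
    (hgY : ∀ k, IsRegression (τ k) (Q k) (F k) (gY k))
    -- their estimators, and the laws of the algorithmic seeds
    (ρ : ∀ k, Measure (S k)) [∀ k, IsProbabilityMeasure (ρ k)]
    (ρ' : ∀ k, Measure (S' k)) [∀ k, IsProbabilityMeasure (ρ' k)]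
    (ghatX : ∀ k, Θ k → S k → (Fin (n₁ k / 2) → 𝒳 k × 𝒱 k) → 𝒱 k → ℝ)
    (ghatY : ∀ k, Θ k → S' k → (Fin (n₂ k / 2) → 𝒳 k × 𝒱 k) → 𝒱 k → ℝ)
    (hghatX : ∀ k, Measurable fun q : Θ k × S k × (Fin (n₁ k / 2) → 𝒳 k × 𝒱 k) × 𝒱 k =>
      ghatX k q.1 q.2.1 q.2.2.1 q.2.2.2)
    (hghatY : ∀ k, Measurable fun q : Θ k × S' k × (Fin (n₂ k / 2) → 𝒳 k × 𝒱 k) × 𝒱 k =>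
      ghatY k q.1 q.2.1 q.2.2.1 q.2.2.2)
    -- moment condition
    (hmoment : ∃ δ : ℝ, 0 < δ ∧
      IsLittleOP τ (fun k θ => momentRatio (P k) δ (F k θ)) (fun k => (n₁ k : ℝ) ^ (δ / 2)) ∧
      IsLittleOP τ (fun k θ => momentRatio (Q k) δ (F k θ)) (fun k => (n₂ k : ℝ) ^ (δ / 2)))
    -- consistency of the estimators
    (hriskX : IsLittleOP τ (fun k θ => riskRatio (P k) (ρ k) (F k θ) (ghatX k θ)) (fun _ => 1))
    (hriskY : IsLittleOP τ (fun k θ => riskRatio (Q k) (ρ' k) (F k θ) (ghatY k θ)) (fun _ => 1)) :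
    -- the power of the cross-fit test follows the asymptotic power expression of the oracle test
    Tendsto (fun k =>
      power (jointLaw (τ k) (P k) (Q k) (ρ k) (ρ' k) (n₁ k) (m₁ k) (n₂ k) (m₂ k))
          (crossStat (F k) (ghatX k) (ghatY k)) α
        - ∫ θ, powerExpression α (P k) (Q k) (F k θ) (n₁ k) (m₁ k) (n₂ k) (m₂ k) ∂(τ k))
      atTop (𝓝 0) ∧
    -- and differs from the power of the oracle test by a vanishing amount
    Tendsto (fun k =>
      power (jointLaw (τ k) (P k) (Q k) (ρ k) (ρ' k) (n₁ k) (m₁ k) (n₂ k) (m₂ k))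
          (crossStat (F k) (ghatX k) (ghatY k)) α
        - power (jointLaw (τ k) (P k) (Q k) (ρ k) (ρ' k) (n₁ k) (m₁ k) (n₂ k) (m₂ k))
            (oracleStat (F k) (gX k) (gY k)) α)
      atTop (𝓝 0) := by
  obtain ⟨δ, hδ, hmomX, hmomY⟩ := hmoment
  have hlim₁ : Tendsto n₁ atTop atTop := tendsto_atTop_mono (fun k => min_le_left _ _) hn
  have hlim₂ : Tendsto n₂ atTop atTop := tendsto_atTop_mono (fun k => min_le_right _ _) hn
  have hcross := tendsto_power_crossStat_sub hα hδ hn₁ hm₁ hn₂ hm₂ hlim₁ hlim₂ hF hgX hgY hghatX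
    hghatY hmomX hmomY hriskX hriskY
  -- the oracle test is the cross-fit test whose estimators return the true regression functions
  have horacle := tendsto_power_crossStat_sub hα hδ hn₁ hm₁ hn₂ hm₂ hlim₁ hlim₂ hF hgX hgY
    (ρ := ρ) (ρ' := ρ') (ghatX := fun k θ _ _ => gX k θ) (ghatY := fun k θ _ _ => gY k θ)
    (fun k => (hgX k).measurable.comp (measurable_fst.prodMk
      (measurable_snd.comp (measurable_snd.comp measurable_snd))))
    (fun k => (hgY k).measurable.comp (measurable_fst.prodMk
      (measurable_snd.comp (measurable_snd.comp measurable_snd))))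
    hmomX hmomY (isLittleOP_riskRatio_regression hδ hF hgX hmomX)
    (isLittleOP_riskRatio_regression hδ hF hgY hmomY)
  refine ⟨hcross, ?_⟩
  have hdiff := hcross.sub horacle
  rw [sub_zero] at hdiff
  refine hdiff.congr fun k => ?_
  rw [oracleStat_eq_crossStat]
  ring
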